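/- **Setting.** A proof-of-work protocol runs $m+1$ parallel block trees: tree $0$ is the pivot tree, trees $1,\dots,m$ are the non-pivot trees. The hash function is a random oracle with values in $\{0,\dots,2^\kappa-1\}$ (a new input gets a fresh uniform value, an old input its old value); put $p=2^{-\kappa}$. A query for a header with target $T$ and answer $y$ gives a block of tree $i$ iff $iT\le y<(i+1)T$; the difficulty of the block is $1/T$, and chain difficulty is the sum of the block difficulties. A header contains a timestamp, a target, a parent in every tree, arbitrary content and a nonce. Along a chain timestamps increase. The target of a block is the one determined by the pivot chain that its header refers to: the initial target is $T_0$ with $(m+1)T_0\le 2^\kappa$, and after each epoch of $\Phi$ pivot blocks with target $T$ and duration $\Lambda$ it becomes $T\Lambda f/\Phi$, truncated to $[T/\tau,\tau T]$, rounded down and kept between $1$ and $\lfloor 2^\kappa/(m+1)\rfloor$. On a non-pivot chain, the chain difficulties of the pivot chains that are referred to must not decrease. In round $r$ there are $n_r$ honest parties, each asking one query, and $t_r<(1-\delta)n_r$ adversarial queries. Honest parties adopt, on every tree, a heaviest valid chain they know (ties broken arbitrarily), and mine on it with a random nonce; everything received or mined by an honest party reaches every honest party within $\Delta$ rounds. The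 adversary and environment (an arbitrary strategy with finitely many coins) choose $n_r,t_r$, message delivery and contents at the beginning of the round and all adversarial queries one by one, knowing the whole past. The environment is $(\gamma,s)$-respecting with $s=2(1+\delta)\gamma^2\Phi/f$: for all coins, in any set of at most $s$ consecutive rounds, $\max n_r\le\gamma\min n_r$. **Parameters.** $m\ge0$, $\Delta\ge1$, $\Phi\ge 1$, $\tau\ge1$, $\gamma\ge1$, $f>0$, $\lambda>0$, $0<\delta<1$, $0<\varepsilon\le\delta/8$, and with $q=1-(1+\delta)\gamma^2f>0$: $q^\Delta\ge1-\varepsilon$, $$\ell\ \ge\ \frac{4(1+3\varepsilon)}{\varepsilon^2 f q^{\Delta+1}}\max\{\Delta,\tau\}\gamma^3\lambda,\qquad 2\ell+6\Delta\le\frac{\varepsilon\Phi}{2(1+\delta)\gamma^2f}.$$ **Notation.** Round $r$ is good if $f/(2\gamma^2)\le p\,n_rT\le(1+\delta)\gamma^2f$ for the next target $T$ of every pivot chain that belongs to an honest party at round $r$ or could be adopted by one, that is, every valid pivot chain made of blocks computed before round $r$, with timestamps before $r$, that is at least as heavy as the pivot chain of some honest party. For tree $i$: $D^i_r$ is the sum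 and $Y^i_r$ the maximum ($0$ if there is none) of the difficulties of the tree-$i$ blocks computed by honest parties in round $r$; $Q^i_r=Y^i_r$ if $D^i_u=0$ for all $r<u<r+\Delta$, and $Q^i_r=0$ otherwise. Sums over a set $S$ of rounds are written $n(S),D^i(S),Q^i(S)$. For a set $J$ of consecutive adversarial queries, $A^i(J)$ is the total difficulty of the new, valid tree-$i$ blocks created in $J$, and $b^i(J)$ is the maximum over $j\in J$ of the largest difficulty that the $j$-th query can add to $A^i(J)$, given the execution just before its answer. $T(J)$ is the target of the first query in $J$, and $A^P(J)$, $B^P(J)$ are the parts of $A^0(J)$ contributed by queries with target at least $T(J)/\tau$ and $T(J)$, respectively. **Typical executions.** For $c>0$, an execution is $c$-typical if (a) for every tree $i$ and every set $S$ of at least $\ell$ consecutive good rounds, $$(1-\varepsilon)q^\Delta\,p\,n(S)<Q^i(S)\le D^i(S)<(1+\varepsilon)\,p\,n(S);$$ (b) for every nonempty set $J$ of consecutive adversarial queries and $\alpha(J)=2(\tfrac1\varepsilon+\tfrac13)\lambda/T(J)$, $$A^P(J)<p|J|+\max\{\varepsilon p|J|,\tau\alpha(J)\},\qquad B^P(J)<p|J|+\max\{\varepsilon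 p|J|,\alpha(J)\},$$ and for every non-pivot tree $i$, $$A^i(J)<p|J|+\max\{\varepsilon p|J|,\ c\,b^i(J)\lambda(\tfrac1\varepsilon+\tfrac13)\};$$ (c) there are no insertions (a block created later than a block $B_2$ gets inserted between $B_2$ and its predecessor in a valid chain), no copies (a block with two different positions in valid chains of a tree) and no predictions (a header referring to one whose hash was not computed before). **Theorem.** There is a constant $K$, depending only on $m,\Delta,\tau,f,\gamma,\delta,\varepsilon$, such that for all $\kappa,\lambda,\ell,\Phi,T_0$ as above, every strategy of adversary and environment that obeys these rules, and every number of rounds, if the execution asks at most $N$ queries in total, then $$\Pr[\text{not }2\text{-typical}]\le K N^2\,(e^{-\lambda}+2^{-\kappa}),\qquad \Pr[\text{not }1\text{-typical}]\le K N^2\,(e^{-\lambda/2}+2^{-\kappa}).$$ In particular polynomially long executions are $1$-typical with overwhelming probability, including the bound $A^i(J)<p|J|+\max\{\varepsilon p|J|,b^i(J)\lambda(\frac1\varepsilon+\frac13)\}$. -/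

import Mathlib

/-!
Executions of a proof-of-work protocol with `m + 1` parallel block trees of variable difficulty.
Tree `0` is the pivot (proposer) tree, trees `1, …, m` are the non-pivot (voter) trees.
-/

noncomputable section

namespace ParallelChain

/-! ### Parameters -/

/-- The constants of the protocol and of the environment. -/
structure Constants where
  /-- number of non-pivot trees -/
  m : ℕ
  /-- bound on the message delay, in rounds -/
  Δ : ℕ
  /-- dampening filter of the target recalculation -/
  τ : ℝ
  /-- ideal number of blocks per round and tree -/
  f : ℝ
  /-- bound on the fluctuation of the number of honest parties -/
  γ : ℝ
  /-- advantage of the honest parties -/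
  δ : ℝ
  /-- quality of concentration -/
  ε : ℝ

/-- The constants together with the quantities that grow with the security level. -/
structure Setup extends Constants where
  /-- length of the hash values, in bits -/
  κ : ℕ
  /-- length of an epoch, in blocks -/
  Φ : ℕ
  /-- initial target -/
  T₀ : ℕ+
  /-- security parameter of the concentration bounds -/
  lam : ℝ
  /-- minimal number of consecutive rounds for which concentration is claimed -/
  ell : ℝ

namespace Setup

variable (S : Setup)

/-- Probability that one query succeeds on a given tree for target `1`. -/
def p : ℝ := 1 / 2 ^ S.κ

/-- The quantity `1 - (1 + δ) γ² f`. -/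
def q : ℝ := 1 - (1 + S.δ) * S.γ ^ 2 * S.f

/-- The number `s = 2 (1 + δ) γ² Φ / f` of rounds in which the number of honest parties
changes by a factor of at most `γ`. -/
def s : ℝ := 2 * (1 + S.δ) * S.γ ^ 2 * S.Φ / S.f

/-- The standing conditions on the parameters. -/
structure Admissible : Prop where
  Δ_pos : 1 ≤ S.Δ
  Φ_pos : 1 ≤ S.Φ
  τ_ge : 1 ≤ S.τ
  f_pos : 0 < S.f
  γ_ge : 1 ≤ S.γ
  δ_pos : 0 < S.δ
  δ_lt : S.δ < 1
  ε_pos : 0 < S.ε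
  lam_pos : 0 < S.lam
  q_pos : 0 < S.q
  /-- the hash range can be divided among the `m + 1` trees -/
  T₀_le : (S.m + 1) * (S.T₀ : ℕ) ≤ 2 ^ S.κ
  ell_ge : 4 * (1 + 3 * S.ε) / (S.ε ^ 2 * S.f * S.q ^ (S.Δ + 1)) * max (S.Δ : ℝ) S.τ * S.γ ^ 3
    * S.lam ≤ S.ell
  ell_le : 2 * S.ell + 6 * S.Δ ≤ S.ε * S.Φ / (2 * (1 + S.δ) * S.γ ^ 2 * S.f)
  q_pow_ge : 1 - S.ε ≤ S.q ^ S.Δ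
  ε_le : S.ε ≤ S.δ / 8

end Setup

/-! ### Blocks, sortition and chains -/

/-- An input of the random oracle. It commits to a timestamp, a target, a parent in each of the
trees (given by its hash value, `none` being the genesis block of the tree), the rest of the content
(transactions, votes, …, in some encoding) and a nonce. -/
structure Header (S : Setup) where
  time : ℕ
  target : ℕ+
  parent : Fin (S.m + 1) → Option (Fin (2 ^ S.κ))
  payload : ℕ
  nonce : Fin (2 ^ S.κ)

/-- A header with its hash value. -/
structure Block (S : Setup) where
  header : Header S
  hash : Fin (2 ^ S.κ)

variable {S : Setup}

/-- Difficulty of a header: the inverse of its target. -/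
def Header.diff (x : Header S) : ℝ := 1 / ((x.target : ℕ) : ℝ)

/-- Sortition: a hash value `y` obtained for the target `T` gives a block of the tree `i` if
`i T ≤ y < (i + 1) T`. -/
def OnTree (i : Fin (S.m + 1)) (T : ℕ+) (y : Fin (2 ^ S.κ)) : Prop :=
  (i : ℕ) * (T : ℕ) ≤ (y : ℕ) ∧ (y : ℕ) < ((i : ℕ) + 1) * (T : ℕ)

/-- Chain difficulty. Chains are lists of blocks, the newest block first, without the genesis. -/
def chainDiff (C : List (Block S)) : ℝ := (C.map fun B => B.header.diff).sum

/-- The reference to the last block of a chain. -/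
def tip (C : List (Block S)) : Option (Fin (2 ^ S.κ)) := C.head?.map fun B => B.hash

/-- All blocks of the chain have timestamps before `r`. -/
def Before (C : List (Block S)) (r : ℕ) : Prop := ∀ B ∈ C, B.header.time < r

/-- The target after an epoch with target `T` that took `Λ` rounds: `T Λ f / Φ`, kept in the interval
`[T / τ, τ T]`, as an integer, and between `1` and the largest target for which the regions of the
`m + 1` trees fit into the range of the hash function. -/
def recalculate (S : Setup) (T : ℕ+) (Λ : ℝ) : ℕ+ :=
  ⟨max 1 (min (2 ^ S.κ / (S.m + 1))
    ⌊max ((T : ℕ) / S.τ) (min (S.τ * (T : ℕ)) ((T : ℕ) * (Λ * S.f / S.Φ)))⌋₊),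
    lt_of_lt_of_le Nat.zero_lt_one (le_max_left _ _)⟩

/-- The target of the next block of a pivot chain. It is recalculated after every `Φ` blocks, from
the duration of the epoch that has ended; the genesis block has timestamp `0`. -/
def nextTarget : List (Block S) → ℕ+
  | [] => S.T₀
  | B :: C =>
    if S.Φ ∣ (B :: C).length then
      recalculate S B.header.target
        ((B.header.time : ℝ) - (((B :: C)[S.Φ]?).elim 0 fun B' => (B'.header.time : ℝ)))
    else B.header.target

/-- The header `x` correctly refers to the pivot chain `P`, and its target is inferred from `P`. -/
def PivotLink (P : List (Block S)) (x : Header S) : Prop :=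
  x.parent 0 = tip P ∧ x.target = nextTarget P ∧ Before P x.time

/-- Valid pivot chains made of blocks in `V`. -/
inductive PivotChain (V : Set (Block S)) : List (Block S) → Prop
  | genesis : PivotChain V []
  | extend (C : List (Block S)) (B : Block S) :
      PivotChain V C → B ∈ V → OnTree 0 B.header.target B.hash → PivotLink C B.header →
      PivotChain V (B :: C)

/-- The header `x` correctly extends the chain `C` of the tree `i` and refers to the pivot chain
`P'`, where the last block of `C` refers to the pivot chain `P`. The chain difficulty of the pivot
chain must not decrease. -/
def NonPivotLink (i : Fin (S.m + 1)) (C P P' : List (Block S)) (x : Header S) : Prop :=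
  x.parent i = tip C ∧ Before C x.time ∧ PivotLink P' x ∧ chainDiff P ≤ chainDiff P'

/-- `NonPivotChain i V C P`: `C` is a valid chain of the non-pivot tree `i`, made of blocks in `V`,
and its last block refers to the pivot chain `P`. -/
inductive NonPivotChain (i : Fin (S.m + 1)) (V : Set (Block S)) :
    List (Block S) → List (Block S) → Prop
  | genesis : NonPivotChain i V [] []
  | extend (C P P' : List (Block S)) (B : Block S) :
      NonPivotChain i V C P → PivotChain V P' → B ∈ V → OnTree i B.header.target B.hash →
      NonPivotLink i C P P' B.header → NonPivotChain i V (B :: C) P'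

/-- `C` is a valid chain of the tree `i`, made of blocks in `V`. -/
def ValidChain (i : Fin (S.m + 1)) (V : Set (Block S)) (C : List (Block S)) : Prop :=
  if i = 0 then PivotChain V C else ∃ P, NonPivotChain i V C P

/-- The header `x` extends a valid chain of the tree `i` that is made of blocks in `V`. -/
def Extends (i : Fin (S.m + 1)) (V : Set (Block S)) (x : Header S) : Prop :=
  if i = 0 then ∃ C, PivotChain V C ∧ PivotLink C x
  else ∃ C P P', NonPivotChain i V C P ∧ PivotChain V P' ∧ NonPivotLink i C P P' x

/-! ### Executions -/

/-- An honest party that is active in a round: its name, the blocks it has received, the chains it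
has adopted (one for each tree) and the content of the blocks that it tries to mine. -/
structure Activation (S : Setup) where
  party : ℕ
  view : Set (Block S)
  chain : Fin (S.m + 1) → List (Block S)
  payload : ℕ

/-- The header with which an active honest party queries the oracle at round `r`. -/
def Activation.header (a : Activation S) (r : ℕ) (nonce : Fin (2 ^ S.κ)) : Header S where
  time := r
  target := nextTarget (a.chain 0)
  parent := fun i => tip (a.chain i)
  payload := a.payload
  nonce := nonce

/-- What is decided at the beginning of a round: the active honest parties and the number of
corrupted ones. -/
structure Plan (S : Setup) where
  honest : List (Activation S)
  corrupted : ℕ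

/-- A query to the oracle: the round, the honest party that asks it (`none` for the adversary), the
header and the answer. -/
structure Query (S : Setup) where
  round : ℕ
  miner : Option ℕ
  block : Block S

/-- The record of an execution: all queries in their order, and the plans of all rounds. -/
structure Trace (S : Setup) where
  queries : List (Query S)
  plans : List (Plan S)

/-- The adversary together with the environment. It knows its coins and everything that has
happened so far. -/
structure Strategy (S : Setup) (coins : Type) where
  plan : coins → Trace S → Plan S
  query : coins → Trace S → Header S

/-- The randomness of at most `N` queries: for each of them a nonce (used by honest parties) and the
answer of the oracle in case the query is new. -/
abbrev Tape (S : Setup) (N : ℕ) : Type := Fin N → Fin (2 ^ S.κ) × Fin (2 ^ S.κ)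

/-- The `k`-th entry of the tape (the executions considered ask at most `N` queries). -/
def draw {N : ℕ} (ω : Tape S N) (k : ℕ) : Fin (2 ^ S.κ) × Fin (2 ^ S.κ) :=
  if h : k < N then ω ⟨k, h⟩ else (⟨0, Nat.two_pow_pos _⟩, ⟨0, Nat.two_pow_pos _⟩)

open Classical in
/-- One query to the random oracle: a new input gets a new uniform answer, an old input gets its old
answer. -/
def ask {N : ℕ} (ω : Tape S N) (r : ℕ) (miner : Option ℕ) (x : Fin (2 ^ S.κ) → Header S)
    (l : List (Query S)) : List (Query S) :=
  let d := draw ω l.length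
  let y := match l.find? (fun e => decide (e.block.header = x d.1)) with
    | some e => e.block.hash
    | none => d.2
  l ++ [⟨r, miner, ⟨x d.1, y⟩⟩]

/-- One round: every active honest party asks one query, then the adversary asks one query for each
corrupted party, each of them chosen with the knowledge of all previous answers. -/
def playRound {coins : Type} {N : ℕ} (Z : Strategy S coins) (ρ : coins) (ω : Tape S N)
    (t : Trace S) : Trace S :=
  let r := t.plans.length
  let π := Z.plan ρ t
  (fun t' : Trace S => ⟨ask ω r none (fun _ => Z.query ρ t') t'.queries, t'.plans⟩)^[π.corrupted]
    ⟨π.honest.foldl (fun l a => ask ω r (some a.party) (a.header r) l) t.queries, t.plans ++ [π]⟩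

/-- The execution of `R` rounds (numbered `0, …, R - 1`). -/
def run {coins : Type} {N : ℕ} (Z : Strategy S coins) (R : ℕ) (ρ : coins) (ω : Tape S N) : Trace S :=
  (playRound Z ρ ω)^[R] ⟨[], []⟩

namespace Trace

variable (t : Trace S)

/-- All headers that were queried in the execution, with their hash values. -/
def blocks : Set (Block S) := {B | ∃ e ∈ t.queries, e.block = B}

/-- The same for the queries of the rounds before `r`. -/
def blocksBefore (r : ℕ) : Set (Block S) := {B | ∃ e ∈ t.queries, e.round < r ∧ e.block = B}

/-- The honest parties that are active in round `r`. -/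
def active (r : ℕ) : List (Activation S) := (t.plans[r]?).elim [] fun π => π.honest

/-- The number `n_r` of honest parties that are active in round `r`. -/
def n (r : ℕ) : ℕ := (t.active r).length

/-- The number `t_r` of corrupted parties in round `r`. -/
def corrupted (r : ℕ) : ℕ := (t.plans[r]?).elim 0 fun π => π.corrupted

/-- The active honest parties of round `r` behave according to the protocol, and the network
delivers messages within `Δ` rounds. -/
structure HonestRound (r : ℕ) : Prop where
  /-- different active parties have different names -/
  nodup : ((t.active r).map fun a => a.party).Nodup
  /-- only blocks that exist can be received -/
  view_exists : ∀ a ∈ t.active r, a.view ⊆ t.blocksBefore r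
  /-- parties do not forget blocks they received … -/
  view_mono : ∀ a ∈ t.active r, ∀ r' < r, ∀ a' ∈ t.active r', a'.party = a.party → a'.view ⊆ a.view
  /-- … or mined -/
  view_own : ∀ a ∈ t.active r, ∀ e ∈ t.queries, e.round < r → e.miner = some a.party →
    e.block ∈ a.view
  /-- blocks received by some honest party reach every honest party within `Δ` rounds -/
  view_relayed : ∀ a ∈ t.active r, ∀ r', r' + S.Δ ≤ r → ∀ a' ∈ t.active r', a'.view ⊆ a.view
  /-- blocks mined by some honest party reach every honest party within `Δ` rounds -/
  view_mined : ∀ a ∈ t.active r, ∀ e ∈ t.queries, e.round + S.Δ ≤ r → e.miner.isSome →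
    e.block ∈ a.view
  /-- on each tree, parties adopt a valid chain they know … -/
  chain_valid : ∀ a ∈ t.active r, ∀ i, ValidChain i a.view (a.chain i) ∧ Before (a.chain i) r
  /-- … which is heaviest (ties are broken in an arbitrary way) -/
  chain_heaviest : ∀ a ∈ t.active r, ∀ i, ∀ C, ValidChain i a.view C → Before C r →
    chainDiff C ≤ chainDiff (a.chain i)

/-- The sequence `n_r` is `(γ, s)`-respecting: in any set of at most `s` consecutive rounds its
maximum is at most `γ` times its minimum. -/
def Respecting (γ s : ℝ) : Prop :=
  ∀ u v : ℕ, u ≤ v → v < t.plans.length → ((v - u + 1 : ℕ) : ℝ) ≤ s →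
    ∀ r ∈ Finset.Icc u v, ∀ r' ∈ Finset.Icc u v, (t.n r : ℝ) ≤ γ * t.n r'

/-- The rules of the model: at most `N` queries in total, honest majority, bounded fluctuation, and
honest parties that follow the protocol. -/
structure Legal (N : ℕ) : Prop where
  total : t.queries.length ≤ N
  majority : ∀ r < t.plans.length, (t.corrupted r : ℝ) < (1 - S.δ) * t.n r
  respecting : t.Respecting S.γ S.s
  honest : ∀ r < t.plans.length, t.HonestRound r

/-! ### Good rounds and the difficulty computed by honest parties -/

/-- The pivot chains that belong to an honest party at round `r` or could be adopted by one. -/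
def adoptable (r : ℕ) : Set (List (Block S)) :=
  {C | PivotChain (t.blocksBefore r) C ∧ Before C r ∧
    ∃ a ∈ t.active r, chainDiff (a.chain 0) ≤ chainDiff C}

/-- A round `r` is good if `f / (2 γ²) ≤ p n_r T ≤ (1 + δ) γ² f` for the target `T` of each of these
chains. -/
def Good (r : ℕ) : Prop :=
  ∀ C ∈ t.adoptable r, S.f / (2 * S.γ ^ 2) ≤ S.p * t.n r * ((nextTarget C : ℕ) : ℝ) ∧
    S.p * t.n r * ((nextTarget C : ℕ) : ℝ) ≤ (1 + S.δ) * S.γ ^ 2 * S.f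

open Classical in
/-- The difficulties of all blocks of the tree `i` computed by honest parties at round `r`. -/
def honestDiffs (i : Fin (S.m + 1)) (r : ℕ) : List ℝ :=
  (t.queries.filter fun e => decide (e.round = r ∧ e.miner.isSome = true ∧
    OnTree i e.block.header.target e.block.hash)).map fun e => e.block.header.diff

/-- The sum `D_r` of these difficulties. -/
def D (i : Fin (S.m + 1)) (r : ℕ) : ℝ := (t.honestDiffs i r).sum

/-- The maximum `Y_r` of these difficulties (`0` if there is no block). -/
def Y (i : Fin (S.m + 1)) (r : ℕ) : ℝ := (t.honestDiffs i r).foldr max 0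

open Classical in
/-- `Q_r = Y_r` if `D_u = 0` for all `r < u < r + Δ`, and `Q_r = 0` otherwise. -/
def Q (i : Fin (S.m + 1)) (r : ℕ) : ℝ :=
  if ∀ u, r < u → u < r + S.Δ → t.D i u = 0 then t.Y i r else 0

/-! ### The difficulty computed by the adversary -/

/-- All headers queried before the `k`-th query, with their hash values. -/
def blocksUntil (k : ℕ) : Set (Block S) := {B | ∃ e ∈ t.queries.take k, e.block = B}

/-- The header `x` was not queried before the `k`-th query. -/
def IsNew (k : ℕ) (x : Header S) : Prop := ∀ B ∈ t.blocksUntil k, B.header ≠ x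

/-- The `k`-th query exists and is asked by the adversary. -/
def IsAdv (k : ℕ) : Prop := ∃ e, t.queries[k]? = some e ∧ e.miner = none

open Classical in
/-- The consecutive adversarial queries between the `a`-th and the `b`-th query. -/
def advQueries (a b : ℕ) : Finset ℕ := (Finset.Icc a b).filter fun k => t.IsAdv k

open Classical in
/-- The difficulty of the block of the tree `i` that the `k`-th query creates if its answer is `y`
(and `0` if it does not create one). The block must extend a valid chain and be new. -/
def gain (i : Fin (S.m + 1)) (k : ℕ) (y : Fin (2 ^ S.κ)) : ℝ :=
  (t.queries[k]?).elim 0 fun e =>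
    if t.IsNew k e.block.header ∧ Extends i (t.blocksUntil k) e.block.header ∧
      OnTree i e.block.header.target y then e.block.header.diff else 0

/-- The difficulty of the block of the tree `i` that the `k`-th query creates. -/
def created (i : Fin (S.m + 1)) (k : ℕ) : ℝ := (t.queries[k]?).elim 0 fun e => t.gain i k e.block.hash

/-- `A^i(J)`: the total difficulty of the blocks of the tree `i` created in the queries `J`. -/
def A (i : Fin (S.m + 1)) (J : Finset ℕ) : ℝ := ∑ k ∈ J, t.created i k

/-- `b^i(J)`: the maximum, over the queries in `J`, of the largest difficulty that the query can
contribute to `A^i(J)`, given the execution before its answer. -/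
def b (i : Fin (S.m + 1)) (J : Finset ℕ) : ℝ := ⨆ x : J × Fin (2 ^ S.κ), t.gain i x.1 x.2

/-- The target of the `k`-th query. -/
def targetAt (k : ℕ) : ℝ := (t.queries[k]?).elim 0 fun e => ((e.block.header.target : ℕ) : ℝ)

open Classical in
/-- The total difficulty of the pivot blocks created in those queries in `J` that have a target of
at least `T`. -/
def pivotA (T : ℝ) (J : Finset ℕ) : ℝ := ∑ k ∈ J.filter (fun k => T ≤ t.targetAt k), t.created 0 k

/-! ### Insertions, copies and predictions -/

/-- The block `B` is created in the `k`-th query. -/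
def CreatedAt (k : ℕ) (B : Block S) : Prop :=
  (∃ e, t.queries[k]? = some e ∧ e.block = B) ∧ t.IsNew k B.header

/-- Some block `B₁`, created after the block `B₂`, gets inserted between `B₀` and `B₂`, where `B₀`
and `B₂` are already consecutive in a valid chain. -/
def Insertion : Prop :=
  ∃ i C C' B₀ B₁ B₂ k₁ k₂, ValidChain i t.blocks (B₂ :: B₀ :: C) ∧
    ValidChain i t.blocks (B₂ :: B₁ :: B₀ :: C') ∧
    t.CreatedAt k₁ B₁ ∧ t.CreatedAt k₂ B₂ ∧ k₂ < k₁

/-- Some block occurs in two different positions. -/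
def Copy : Prop :=
  ∃ i B C C', ValidChain i t.blocks (B :: C) ∧ ValidChain i t.blocks (B :: C') ∧ C ≠ C'

/-- Some block refers to a block that is not created before it. -/
def Prediction : Prop :=
  ∃ i B B' k k', t.CreatedAt k B ∧ t.CreatedAt k' B' ∧ k' ≤ k ∧ B'.header.parent i = some B.hash

/-! ### Typical executions -/

/-- Typical executions. The factor `c` is the one in front of `b^i(J) λ (1/ε + 1/3)`. -/
structure Typical (c : ℝ) : Prop where
  /-- honest difficulty in at least `ell` consecutive good rounds, on all trees -/
  honest : ∀ (i : Fin (S.m + 1)) (u v : ℕ), u ≤ v → v < t.plans.length →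
    S.ell ≤ ((v - u + 1 : ℕ) : ℝ) → (∀ r ∈ Finset.Icc u v, t.Good r) →
    (1 - S.ε) * S.q ^ S.Δ * S.p * ∑ r ∈ Finset.Icc u v, (t.n r : ℝ)
        < ∑ r ∈ Finset.Icc u v, t.Q i r ∧
      ∑ r ∈ Finset.Icc u v, t.Q i r ≤ ∑ r ∈ Finset.Icc u v, t.D i r ∧
      ∑ r ∈ Finset.Icc u v, t.D i r
        < (1 + S.ε) * S.p * ∑ r ∈ Finset.Icc u v, (t.n r : ℝ)
  /-- adversarial difficulty on the pivot tree, for consecutive adversarial queries of which the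
  first one is the `a`-th query: blocks with targets at least `T(J) / τ` -/
  pivot : ∀ a b : ℕ, a ≤ b → t.IsAdv a →
    t.pivotA (t.targetAt a / S.τ) (t.advQueries a b) < S.p * (t.advQueries a b).card +
      max (S.ε * S.p * (t.advQueries a b).card)
        (S.τ * (2 * (1 / S.ε + 1 / 3) * S.lam / t.targetAt a))
  /-- the same for blocks with targets at least `T(J)` -/
  pivot' : ∀ a b : ℕ, a ≤ b → t.IsAdv a →
    t.pivotA (t.targetAt a) (t.advQueries a b) < S.p * (t.advQueries a b).card +
      max (S.ε * S.p * (t.advQueries a b).card)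
        (2 * (1 / S.ε + 1 / 3) * S.lam / t.targetAt a)
  /-- adversarial difficulty on the non-pivot trees -/
  nonPivot : ∀ (i : Fin (S.m + 1)) (a b : ℕ), i ≠ 0 → a ≤ b → t.IsAdv a →
    t.A i (t.advQueries a b) < S.p * (t.advQueries a b).card +
      max (S.ε * S.p * (t.advQueries a b).card)
        (c * t.b i (t.advQueries a b) * S.lam * (1 / S.ε + 1 / 3))
  no_insertion : ¬ t.Insertion
  no_copy : ¬ t.Copy
  no_prediction : ¬ t.Prediction

end Trace

/-- Probability of an event under the uniform distribution on a finite set. -/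
def prob {Ω : Type} (E : Set Ω) : ℝ := (Nat.card E : ℝ) / (Nat.card Ω : ℝ)

end ParallelChain

end

namespace ParallelChain

open Finset

/-! With the coins fixed (`prob_prod_le`), an execution is a function of a uniformly distributed
tape. Conditional expectations are replaced by resampling a single entry of the tape (`sum_reply`).
This is useful because of locality (`synced_run`): tapes that agree before entry `k` give executions
that agree in everything decided before the `k`-th answer. The header of the query, what it can
gain, and the plan and goodness of its round are therefore unaffected by resampling that answer.

Concentration comes from the exponential supermartingale of `sum_exp_weighted_le`. The obstacle is
that the size of the steps, such as `b^i(J)`, is chosen during the execution and is unknown when `J`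
begins. Each step is therefore divided by the running maximum of the bounds so far, which is known
before the answer. The deterministic `sum_lt_of_weighted_sums_lt` turns bounds on these weighted
sums from all starting points into a bound on the unweighted sum in terms of the final maximum. A
union over the `N²` pairs of endpoints suffices, with no union over scales and no loss in the
constant. On the pivot tree `T(J)` is known at the start of `J`, so a fixed weight is enough.

The exponent `x = bern ε` satisfies `1/x = 1/ε + 1/3` and `(e^x - 1)/x ≤ 1 + ε/2`. With failure
probability `e^{-L}` per pair, the excess over `p|J|` is below `(ε/2) p|J| + L b/x`. For `L = cλ/2`
this is the average of the two numbers in the claimed maximum, hence at most the maximum. This is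
why `c = 2` costs `e^{-λ}` and `c = 1` costs `e^{-λ/2}`.

For honest difficulty, a block of a good round has difficulty at most `β n_r`, and on intervals of
at most `s` rounds the `n_r` differ by a factor of at most `γ`; the size of `ell` then absorbs the
term with `λ`. Longer intervals are cut into pieces. The lower bound on `Q` counts only blocks that
are alone in the `Δ` rounds starting with their own. As `n_r` and the targets are adaptive, their
expected difficulty is controlled by the submartingale `segValue` (`sum_segValue_ge`), which gives
at least `q^Δ p n_r`. Segments starting in the same residue class modulo `Δ` are disjoint, so the
exponential bounds can be chained within a class (`sum_exp_classSum_le`), and the `Δ` classes are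
added up.

Insertions, copies and predictions require an answer to hit an earlier hash value or a reference
already made, which is excluded by a birthday bound. The same bound makes all honest queries new.
The cases `N = 0` and `λ < 1`, where the concentration argument is not applied, are treated
separately. -/

/-! ### Running maxima and weighted sums -/

/-- The maximum of `0` and `c a, …, c k`. -/
noncomputable def runMax (c : ℕ → ℝ) (a k : ℕ) : ℝ := (Icc a k).fold max 0 c

theorem runMax_nonneg (c : ℕ → ℝ) (a k : ℕ) : 0 ≤ runMax c a k :=
  (le_fold_max _).2 (Or.inl le_rfl)

theorem le_runMax {c : ℕ → ℝ} {a j k : ℕ} (h₁ : a ≤ j) (h₂ : j ≤ k) : c j ≤ runMax c a k :=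
  (le_fold_max _).2 (Or.inr ⟨j, mem_Icc.2 ⟨h₁, h₂⟩, le_rfl⟩)

theorem runMax_le {c : ℕ → ℝ} {a k : ℕ} {B : ℝ} (hB : 0 ≤ B) (h : ∀ j, a ≤ j → j ≤ k → c j ≤ B) :
    runMax c a k ≤ B :=
  (fold_max_le _).2 ⟨hB, fun j hj => h j (mem_Icc.1 hj).1 (mem_Icc.1 hj).2⟩

theorem runMax_mono {c : ℕ → ℝ} {a k k' : ℕ} (h : k ≤ k') : runMax c a k ≤ runMax c a k' :=
  runMax_le (runMax_nonneg _ _ _) fun _ h₁ h₂ => le_runMax h₁ (h₂.trans h)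

theorem runMax_congr {c c' : ℕ → ℝ} {a k : ℕ} (h : ∀ j, a ≤ j → j ≤ k → c j = c' j) :
    runMax c a k = runMax c' a k :=
  fold_congr fun j hj => h j (mem_Icc.1 hj).1 (mem_Icc.1 hj).2

/-- If the sums of `z` weighted by the inverse of the running maximum of `c` are small from every
starting point, then the sum of `z` is small in comparison with the maximum of `c`. -/
theorem sum_lt_of_weighted_sums_lt {z c : ℕ → ℝ} {B L : ℝ} {a₀ n : ℕ} (hB : 0 < B) (hL : 0 < L)
    (hcB : ∀ k, a₀ ≤ k → k < n → c k ≤ B) (hz : ∀ k, a₀ ≤ k → k < n → 0 < z k → 0 < c k)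
    (h : ∀ a, a₀ ≤ a → a < n → ∑ k ∈ Ico a n, z k / runMax c a k < L) :
    ∑ k ∈ Ico a₀ n, z k < L * B := by
  by_contra! hcon
  have hLB : 0 < L * B := mul_pos hL hB
  have ha₀n : a₀ < n := by
    by_contra! hn
    rw [Ico_eq_empty (by omega), sum_empty] at hcon
    linarith
  let s := (Icc a₀ n).filter fun a => L * B ≤ ∑ k ∈ Ico a n, z k
  have hs : s.Nonempty := ⟨a₀, by simp [s, hcon, ha₀n.le]⟩
  -- For the last starting point whose tail still reaches `L * B`, all partial sums from there are
  -- positive: cutting off a nonpositive beginning would leave a later tail that also reaches `L *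
  -- B`.
  set a := s.max' hs with ha
  have has : a ∈ s := s.max'_mem hs
  have has' : (a₀ ≤ a ∧ a ≤ n) ∧ L * B ≤ ∑ k ∈ Ico a n, z k := by simpa [s] using has
  obtain ⟨⟨h0a, han⟩, hGa⟩ := has'
  have han : a < n := by
    rcases han.lt_or_eq with h' | h'
    · exact h'
    · rw [h', Ico_self, sum_empty] at hGa
      linarith
  have hpos : ∀ k, a < k → k ≤ n → 0 < ∑ j ∈ Ico a k, z j := by
    intro k hak hkn
    have hk : ∑ j ∈ Ico k n, z j < L * B := by
      by_contra! hk
      have : k ∈ s := by simp [s, hk, hkn]; omega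
      have := s.le_max' k this
      omega
    have := sum_Ico_consecutive z hak.le hkn
    linarith
  have hca : 0 < c a := by
    refine hz a h0a han ?_
    simpa using hpos (a + 1) (by omega) (by omega)
  have hm : ∀ k, a ≤ k → 0 < runMax c a k := fun k hk => hca.trans_le (le_runMax le_rfl hk)
  -- Summation by parts: since the partial sums are positive, dividing them by a larger running
  -- maximum only makes them smaller.
  have key : ∀ k, a + 1 ≤ k → k ≤ n →
      (∑ j ∈ Ico a k, z j) / runMax c a (k - 1) ≤ ∑ j ∈ Ico a k, z j / runMax c a j := by
    intro k hk
    induction k, hk using Nat.le_induction with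
    | base => intro _; simp
    | succ k hk ih =>
      intro hkn
      rw [sum_Ico_succ_top (by omega), sum_Ico_succ_top (by omega), add_div, Nat.add_sub_cancel]
      refine add_le_add_left ((div_le_div_of_nonneg_left (hpos k (by omega) (by omega)).le
        (hm _ (by omega)) (runMax_mono (by omega))).trans (ih (by omega))) _
  have h1 := key n (by omega) le_rfl
  have h2 := h a h0a han
  have h3 : runMax c a (n - 1) ≤ B :=
    runMax_le hB.le fun j h₁ h₂ => hcB j (by omega) (by omega)
  have h4 : L ≤ (∑ j ∈ Ico a n, z j) / runMax c a (n - 1) := by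
    rw [le_div_iff₀ (hm _ (by omega))]
    exact (mul_le_mul_of_nonneg_left h3 hL.le).trans hGa
  linarith

/-! ### Exponential inequalities -/

/-- On `[0, x]` the convex function lies below its chord. The value `s = 1` serves the upper tails
and `s = -1` the lower tail. -/
theorem exp_mul_le_one_add {y x : ℝ} (s : ℝ) (hy : 0 ≤ y) (hyx : y ≤ x) (hx : 0 < x) :
    Real.exp (s * y) ≤ 1 + y * ((Real.exp (s * x) - 1) / x) := by
  have h := convexOn_exp.2 (Set.mem_univ (s * x)) (Set.mem_univ 0) (div_nonneg hy hx.le)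
    (sub_nonneg.2 ((div_le_one hx).2 hyx)) (by ring)
  simp only [smul_eq_mul, Real.exp_zero, mul_zero, add_zero, mul_one] at h
  have e : y / x * (s * x) = s * y := by field_simp
  rw [e] at h
  refine h.trans (le_of_eq ?_)
  field_simp
  ring

/-- The optimal exponent of the Bernstein bound for deviations by the factor `1 + e`. -/
noncomputable def bern (e : ℝ) : ℝ := e / (1 + e / 3)

theorem bern_pos {e : ℝ} (he : 0 < e) : 0 < bern e := by unfold bern; positivity

theorem bern_le {e : ℝ} (he : 0 < e) : bern e ≤ e := by
  unfold bern
  rw [div_le_iff₀ (by positivity)]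
  nlinarith

/-- Comparison of Taylor coefficients in `x = bern e`: inverting gives `e = x / (1 - x/3)`, which is
at least `x + x²/3 + x³/9`. The right side then has the cubic coefficient `1/18`, just above the
`5/96` from the remainder of the exponential series. -/
theorem exp_bern_le {e : ℝ} (he : 0 < e) (he1 : e ≤ 1) :
    (Real.exp (bern e) - 1) / bern e ≤ 1 + e / 2 := by
  have hx := bern_pos he
  have hx1 : bern e ≤ 1 := (bern_le he).trans he1
  have h := Real.exp_bound' hx.le hx1 (n := 4) (by norm_num)
  have hex : e = bern e / (1 - bern e / 3) := by
    unfold bern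
    field_simp
    ring
  set x := bern e
  have h3 : 0 < 1 - x / 3 := by linarith
  have hee : x * (1 + x / 3 + x ^ 2 / 9) ≤ e := by
    rw [hex, le_div_iff₀ h3]
    nlinarith [pow_pos hx 4]
  rw [div_le_iff₀ hx]
  simp only [Finset.sum_range_succ, Finset.sum_range_zero, Nat.factorial] at h
  norm_num at h
  nlinarith [pow_pos hx 4, pow_pos hx 3, mul_le_mul_of_nonneg_left hee hx.le]

/-- The product of `1 + e + e²/2` and `1 - e + e²/2` is `1 + e⁴/4`, hence at least `1`. -/
theorem one_sub_exp_neg_ge {e : ℝ} (he : 0 ≤ e) : e - e ^ 2 / 2 ≤ 1 - Real.exp (-e) := by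
  have h := Real.quadratic_le_exp_of_nonneg he
  have hp : 0 < 1 + e + e ^ 2 / 2 := by positivity
  have h2 : Real.exp (-e) ≤ 1 / (1 + e + e ^ 2 / 2) := by
    rw [Real.exp_neg, ← one_div]
    exact one_div_le_one_div_of_le hp h
  have h3 : 1 / (1 + e + e ^ 2 / 2) ≤ 1 - e + e ^ 2 / 2 := by
    rw [div_le_iff₀ hp]
    nlinarith [sq_nonneg (e ^ 2)]
  linarith

/-! ### Probabilities -/

section Prob

variable {Ω : Type}

theorem prob_empty : prob (∅ : Set Ω) = 0 := by simp [prob]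

theorem prob_union_le (E F : Set Ω) : prob (E ∪ F) ≤ prob E + prob F := by
  unfold prob
  rw [← add_div]
  gcongr
  simp only [Nat.card_coe_set_eq]
  exact_mod_cast Set.ncard_union_le E F

variable [Fintype Ω]

theorem prob_mono {E F : Set Ω} (h : E ⊆ F) : prob E ≤ prob F := by
  unfold prob
  gcongr
  exact Nat.card_mono (Set.toFinite F) h

theorem prob_le_one (E : Set Ω) : prob E ≤ 1 := by
  unfold prob
  refine div_le_one_of_le₀ ?_ (by positivity)
  exact_mod_cast (Nat.card_le_card_of_injective _ Subtype.val_injective)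

theorem prob_biUnion_le {ι : Type*} (s : Finset ι) (E : ι → Set Ω) :
    prob {ω | ∃ i ∈ s, ω ∈ E i} ≤ ∑ i ∈ s, prob (E i) := by
  classical
  induction s using Finset.induction_on with
  | empty => simp [prob_empty]
  | insert i s hi ih =>
    rw [sum_insert hi]
    refine le_trans (prob_mono ?_) ((prob_union_le (E i) _).trans (add_le_add_right ih _))
    rintro ω ⟨j, hj, hω⟩
    rcases mem_insert.1 hj with rfl | hj
    · exact Or.inl hω
    · exact Or.inr ⟨j, hj, hω⟩

theorem prob_biUnion_le_mul {ι : Type*} (s : Finset ι) (E : ι → Set Ω) {c : ℝ}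
    (h : ∀ i ∈ s, prob (E i) ≤ c) : prob {ω | ∃ i ∈ s, ω ∈ E i} ≤ s.card * c := by
  refine (prob_biUnion_le s E).trans ((sum_le_sum h).trans_eq ?_)
  simp

/-- Union bound over pairs of numbers less than `N`. -/
theorem prob_pairs_le (N : ℕ) (E : ℕ → ℕ → Set Ω) {c : ℝ} (h : ∀ a < N, ∀ b < N, prob (E a b) ≤ c) :
    prob {ω | ∃ a < N, ∃ b < N, ω ∈ E a b} ≤ (N : ℝ) ^ 2 * c := by
  refine le_trans (prob_mono ?_)
    ((prob_biUnion_le_mul (range N ×ˢ range N) (fun x => E x.1 x.2) (c := c) ?_).trans_eq ?_)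
  · rintro ω ⟨a, ha, b, hb, hω⟩
    exact ⟨(a, b), by simp [ha, hb], hω⟩
  · rintro ⟨a, b⟩ hab
    simp only [mem_product, mem_range] at hab
    exact h a hab.1 b hab.2
  · simp [sq]

theorem prob_le_of_sum_le [Nonempty Ω] {E : Set Ω} {F : Ω → ℝ} {c : ℝ} (hF : ∀ ω, 0 ≤ F ω)
    (hE : ∀ ω ∈ E, 1 ≤ F ω) (h : ∑ ω, F ω ≤ c * Fintype.card Ω) : prob E ≤ c := by
  classical
  unfold prob
  rw [Nat.card_eq_fintype_card (α := Ω), div_le_iff₀ (by exact_mod_cast Fintype.card_pos)]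
  refine le_trans ?_ h
  rw [Nat.card_coe_set_eq, Set.ncard_eq_toFinset_card', ← nsmul_one, ← sum_const]
  refine (sum_le_sum fun ω hω => hE ω (by simpa using hω)).trans ?_
  exact sum_le_sum_of_subset_of_nonneg (subset_univ _) fun _ _ _ => hF _

theorem prob_exp_markov [Nonempty Ω] {F : Ω → ℝ} (h : ∑ ω, Real.exp (F ω) ≤ Fintype.card Ω)
    (L : ℝ) : prob {ω | L ≤ F ω} ≤ Real.exp (-L) := by
  refine prob_le_of_sum_le (F := fun ω => Real.exp (-L) * Real.exp (F ω))
    (fun _ => by positivity) (fun ω hω => ?_) ?_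
  · rw [← Real.exp_add]
    exact Real.one_le_exp (by simpa using hω)
  · rw [← mul_sum]
    gcongr

theorem prob_prod_le {C : Type} [Fintype C] [Nonempty C] [Nonempty Ω] {E : Set (C × Ω)} {c : ℝ}
    (h : ∀ ρ, prob {ω | (ρ, ω) ∈ E} ≤ c) : prob E ≤ c := by
  classical
  refine prob_le_of_sum_le (F := E.indicator 1) (fun _ => Set.indicator_nonneg (by simp) _)
    (fun x hx => by simp [hx]) ?_
  rw [Fintype.sum_prod_type, Fintype.card_prod, Nat.cast_mul]
  refine (sum_le_sum (g := fun _ : C => c * Fintype.card Ω) fun ρ _ => ?_).trans_eq ?_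
  · have := h ρ
    unfold prob at this
    rw [Nat.card_eq_fintype_card (α := Ω), div_le_iff₀ (by exact_mod_cast Fintype.card_pos)] at this
    refine le_trans (le_of_eq ?_) this
    rw [Nat.card_coe_set_eq, Set.ncard_eq_toFinset_card']
    simp [Set.indicator_apply, Finset.sum_boole]
  · simp; ring

end Prob

/-! ### Replacing one answer or one nonce -/

section Tape

variable {S : Setup} {N : ℕ}

instance : Nonempty (Fin (2 ^ S.κ)) := ⟨⟨0, Nat.two_pow_pos _⟩⟩

/-- The tape `ω` with the `k`-th answer replaced by `y`. -/
def reply (ω : Tape S N) (k : Fin N) (y : Fin (2 ^ S.κ)) : Tape S N :=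
  Function.update ω k ((ω k).1, y)

/-- The tape `ω` with the `k`-th nonce replaced by `z`. -/
def renonce (ω : Tape S N) (k : Fin N) (z : Fin (2 ^ S.κ)) : Tape S N :=
  Function.update ω k (z, (ω k).2)

/-- Swapping the `k`-th answer with the spare value `y` is an involution on pairs. The identity is
the tower property of conditional expectation in counting form. -/
theorem sum_reply (k : Fin N) (F : Tape S N → ℝ) :
    ∑ ω, ∑ y, F (reply ω k y) = 2 ^ S.κ * ∑ ω, F ω := by
  have e : ∑ x : Tape S N × Fin (2 ^ S.κ), F (reply x.1 k x.2)
      = ∑ x : Tape S N × Fin (2 ^ S.κ), F x.1 := by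
    refine Fintype.sum_equiv (Function.Involutive.toPerm
      (fun x : Tape S N × Fin (2 ^ S.κ) => (reply x.1 k x.2, (x.1 k).2)) ?_) _ _ fun x => rfl
    rintro ⟨ω, y⟩
    simp [reply]
  rw [Fintype.sum_prod_type, Fintype.sum_prod_type] at e
  rw [e, mul_sum]
  simp

theorem sum_renonce (k : Fin N) (F : Tape S N → ℝ) :
    ∑ ω, ∑ z, F (renonce ω k z) = 2 ^ S.κ * ∑ ω, F ω := by
  have e : ∑ x : Tape S N × Fin (2 ^ S.κ), F (renonce x.1 k x.2)
      = ∑ x : Tape S N × Fin (2 ^ S.κ), F x.1 := by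
    refine Fintype.sum_equiv (Function.Involutive.toPerm
      (fun x : Tape S N × Fin (2 ^ S.κ) => (renonce x.1 k x.2, (x.1 k).1)) ?_) _ _ fun x => rfl
    rintro ⟨ω, y⟩
    simp [renonce]
  rw [Fintype.sum_prod_type, Fintype.sum_prod_type] at e
  rw [e, mul_sum]
  simp

theorem sum_le_sum_of_reply (k : Fin N) {F G : Tape S N → ℝ}
    (h : ∀ ω, ∑ y, F (reply ω k y) ≤ ∑ y, G (reply ω k y)) : ∑ ω, F ω ≤ ∑ ω, G ω := by
  have := sum_le_sum fun ω (_ : ω ∈ (univ : Finset (Tape S N))) => h ω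
  rw [sum_reply, sum_reply] at this
  exact le_of_mul_le_mul_left this (by positivity)

theorem reply_snd (ω : Tape S N) (k : Fin N) (y : Fin (2 ^ S.κ)) : (reply ω k y k).2 = y := by
  simp [reply]

theorem renonce_fst (ω : Tape S N) (k : Fin N) (z : Fin (2 ^ S.κ)) : (renonce ω k z k).1 = z := by
  simp [renonce]

theorem draw_of_lt (ω : Tape S N) (k : Fin N) : draw ω k = ω k := by simp [draw]

theorem draw_reply_fst (ω : Tape S N) (k : Fin N) (y : Fin (2 ^ S.κ)) (j : ℕ) :
    (draw (reply ω k y) j).1 = (draw ω j).1 := by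
  unfold draw reply
  split_ifs with h
  · by_cases hj : (⟨j, h⟩ : Fin N) = k
    · subst hj; simp
    · rw [Function.update_of_ne hj]
  · rfl

theorem draw_reply_of_ne (ω : Tape S N) (k : Fin N) (y : Fin (2 ^ S.κ)) {j : ℕ} (hj : j ≠ k) :
    draw (reply ω k y) j = draw ω j := by
  unfold draw reply
  split_ifs with h
  · rw [Function.update_of_ne (fun e => hj (congrArg Fin.val e))]
  · rfl

theorem draw_reply_self (ω : Tape S N) (k : Fin N) (y : Fin (2 ^ S.κ)) :
    (draw (reply ω k y) k).2 = y := by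
  rw [draw_of_lt, reply_snd]

theorem draw_renonce_of_ne (ω : Tape S N) (k : Fin N) (z : Fin (2 ^ S.κ)) {j : ℕ} (hj : j ≠ k) :
    draw (renonce ω k z) j = draw ω j := by
  unfold draw renonce
  split_ifs with h
  · rw [Function.update_of_ne (fun e => hj (congrArg Fin.val e))]
  · rfl

/-- An answer hits a set that is determined before with probability proportional to its size. -/
theorem prob_answer_mem_le (k : Fin N) (g : Tape S N → Finset (Fin (2 ^ S.κ))) (M : ℕ)
    (hg : ∀ ω y, g (reply ω k y) = g ω) (hM : ∀ ω, (g ω).card ≤ M) :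
    prob {ω : Tape S N | (ω k).2 ∈ g ω} ≤ M * (1 / 2 ^ S.κ) := by
  refine prob_le_of_sum_le (F := fun ω => if (ω k).2 ∈ g ω then 1 else 0)
    (fun ω => by split_ifs <;> simp) (fun ω hω => by simp only [Set.mem_ofPred_eq] at hω; simp [hω]) ?_
  refine (sum_le_sum_of_reply k (G := fun _ => M * (1 / 2 ^ S.κ)) fun ω => ?_).trans_eq
    (by simp; ring)
  simp only [hg, reply_snd]
  rw [Finset.sum_boole, sum_const, card_univ, Fintype.card_fin, nsmul_eq_mul]
  rw [Finset.filter_mem_eq_inter, Finset.univ_inter]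
  push_cast
  rw [mul_div_assoc', mul_one, mul_div_cancel₀ _ (by positivity)]
  exact_mod_cast hM ω

/-- A nonce hits a set that is determined before with probability proportional to its size. -/
theorem prob_nonce_mem_le (k : Fin N) (g : Tape S N → Finset (Fin (2 ^ S.κ))) (M : ℕ)
    (hg : ∀ ω y, g (renonce ω k y) = g ω) (hM : ∀ ω, (g ω).card ≤ M) :
    prob {ω : Tape S N | (ω k).1 ∈ g ω} ≤ M * (1 / 2 ^ S.κ) := by
  refine prob_le_of_sum_le (F := fun ω => if (ω k).1 ∈ g ω then 1 else 0)
    (fun ω => by split_ifs <;> simp) (fun ω hω => by simp only [Set.mem_ofPred_eq] at hω; simp [hω]) ?_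
  have h : ∑ ω : Tape S N, ∑ z, (if (renonce ω k z k).1 ∈ g (renonce ω k z) then (1 : ℝ) else 0)
      ≤ ∑ _ω : Tape S N, (M : ℝ) := by
    refine sum_le_sum fun ω _ => ?_
    simp only [hg, renonce_fst]
    rw [Finset.sum_boole, Finset.filter_mem_eq_inter, Finset.univ_inter]
    exact_mod_cast hM ω
  rw [sum_renonce k fun ω => if (ω k).1 ∈ g ω then (1 : ℝ) else 0] at h
  rw [sum_const, card_univ, nsmul_eq_mul] at h
  rw [mul_comm (M : ℝ), mul_assoc, one_div, ← div_eq_inv_mul, le_div_iff₀' (by positivity)]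
  linarith

/-! ### The exponential supermartingale -/

/-- The `j`-th member of the family is determined before the `j`-th answer. -/
def Predictable {α : Type*} (F : Tape S N → ℕ → α) : Prop :=
  ∀ (k : Fin N) (ω : Tape S N) (y : Fin (2 ^ S.κ)), ∀ j ≤ (k : ℕ), F (reply ω k y) j = F ω j

/-- Averaging over the last answer multiplies the sum by at most `1`: by the chord bound the mean of
`exp (w X)` is at most `1 + w p e s` with `e = (exp x - 1) / x`, and this is at most the exponential
of the compensator. The mean of `X` is the sum over the answers times `p`. -/
theorem sum_exp_weighted_le {X : Tape S N → ℕ → Fin (2 ^ S.κ) → ℝ} {w s : Tape S N → ℕ → ℝ} {x : ℝ}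
    (hx : 0 < x) (hX : Predictable X) (hw : Predictable w) (hs : Predictable s)
    (hX0 : ∀ ω k y, 0 ≤ X ω k y) (hw0 : ∀ ω k, 0 ≤ w ω k) (hwX : ∀ ω k y, w ω k * X ω k y ≤ x)
    (hmean : ∀ ω k, ∑ y, X ω k y ≤ s ω k) :
    ∑ ω, Real.exp (∑ k ∈ range N, w ω k *
      (X ω k (draw ω k).2 - S.p * ((Real.exp x - 1) / x) * s ω k)) ≤ Fintype.card (Tape S N) := by
  set e := (Real.exp x - 1) / x with he
  have he0 : 0 ≤ e := div_nonneg (by linarith [Real.add_one_le_exp x]) hx.le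
  have main : ∀ n ≤ N, ∑ ω, Real.exp (∑ k ∈ range n, w ω k * (X ω k (draw ω k).2 - S.p * e * s ω k))
      ≤ Fintype.card (Tape S N) := by
    intro n
    induction n with
    | zero => intro _; simp
    | succ n ih =>
      intro hn
      refine le_trans ?_ (ih (by omega))
      refine sum_le_sum_of_reply ⟨n, hn⟩ fun ω => ?_
      have h1 : ∀ y, ∑ k ∈ range n, w (reply ω ⟨n, hn⟩ y) k * (X (reply ω ⟨n, hn⟩ y) k
            (draw (reply ω ⟨n, hn⟩ y) k).2 - S.p * e * s (reply ω ⟨n, hn⟩ y) k)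
          = ∑ k ∈ range n, w ω k * (X ω k (draw ω k).2 - S.p * e * s ω k) := by
        intro y
        refine sum_congr rfl fun k hk => ?_
        have hk := mem_range.1 hk
        rw [hX ⟨n, hn⟩ ω y k hk.le, hw ⟨n, hn⟩ ω y k hk.le, hs ⟨n, hn⟩ ω y k hk.le,
          draw_reply_of_ne _ _ _ (by simpa using hk.ne)]
      have h2 : ∀ y, (draw (reply ω ⟨n, hn⟩ y) n).2 = y := fun y => draw_reply_self ω ⟨n, hn⟩ y
      simp only [sum_range_succ, h1, h2, hX ⟨n, hn⟩ ω _ n le_rfl, hw ⟨n, hn⟩ ω _ n le_rfl,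
        hs ⟨n, hn⟩ ω _ n le_rfl, Real.exp_add]
      rw [← mul_sum, sum_const, card_univ, nsmul_eq_mul, mul_comm]
      refine mul_le_mul_of_nonneg_right ?_ (Real.exp_pos _).le
      have hH : (0 : ℝ) < 2 ^ S.κ := by positivity
      calc ∑ y, Real.exp (w ω n * (X ω n y - S.p * e * s ω n))
          = Real.exp (-(w ω n * (S.p * e * s ω n))) * ∑ y, Real.exp (1 * (w ω n * X ω n y)) := by
            rw [mul_sum]
            refine sum_congr rfl fun y _ => ?_
            rw [← Real.exp_add]
            ring_nf
        _ ≤ Real.exp (-(w ω n * (S.p * e * s ω n))) * ∑ y, (1 + w ω n * X ω n y * e) := by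
            gcongr with y
            have := exp_mul_le_one_add 1 (mul_nonneg (hw0 ω n) (hX0 ω n y)) (hwX ω n y) hx
            rwa [one_mul x] at this
        _ = Real.exp (-(w ω n * (S.p * e * s ω n))) * (2 ^ S.κ + w ω n * e * ∑ y, X ω n y) := by
            rw [sum_add_distrib, mul_sum]
            simp only [sum_const, card_univ, Fintype.card_fin, nsmul_eq_mul, mul_one]
            push_cast
            congr 2
            exact sum_congr rfl fun y _ => by ring
        _ ≤ Real.exp (-(w ω n * (S.p * e * s ω n))) * (2 ^ S.κ + w ω n * e * s ω n) := by
            gcongr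
            · exact mul_nonneg (hw0 ω n) he0
            · exact hmean ω n
        _ = 2 ^ S.κ * (Real.exp (-(w ω n * (S.p * e * s ω n))) * (1 + w ω n * (S.p * e * s ω n))) := by
            unfold Setup.p
            field_simp
        _ ≤ 2 ^ S.κ * (Real.exp (-(w ω n * (S.p * e * s ω n)))
              * Real.exp (w ω n * (S.p * e * s ω n))) := by
            gcongr
            linarith [Real.add_one_le_exp (w ω n * (S.p * e * s ω n))]
        _ = Fintype.card (Fin (2 ^ S.κ)) := by
            rw [← Real.exp_add]
            simp
  exact main N le_rfl

/-- Uniform deviation bound: outside an event of probability `N² e^{-L}`, on all intervals the sum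
exceeds its mean by less than a multiple of the maximum of the predictable bounds `c`. -/
theorem prob_interval_deviation_le {X : Tape S N → ℕ → Fin (2 ^ S.κ) → ℝ} {c s : Tape S N → ℕ → ℝ}
    {x L : ℝ} (hx : 0 < x) (hL : 0 < L) (hX : Predictable X) (hc : Predictable c)
    (hs : Predictable s) (hX0 : ∀ ω k y, 0 ≤ X ω k y) (hXc : ∀ ω k y, X ω k y ≤ c ω k)
    (hmean : ∀ ω k, ∑ y, X ω k y ≤ s ω k) (hs0 : ∀ ω k, 0 ≤ s ω k) :
    prob {ω : Tape S N | ¬ ∀ a b B, b < N → 0 < B → (∀ k, a ≤ k → k ≤ b → c ω k ≤ B) →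
      ∑ k ∈ Ico a (b + 1), (X ω k (draw ω k).2 - S.p * ((Real.exp x - 1) / x) * s ω k) < L / x * B}
      ≤ (N : ℝ) ^ 2 * Real.exp (-L) := by
  set e := (Real.exp x - 1) / x with he
  have he0 : 0 ≤ e := div_nonneg (by linarith [Real.add_one_le_exp x]) hx.le
  have hp0 : 0 ≤ S.p := by unfold Setup.p; positivity
  -- The running maximum may include `c ω k` itself, because that bound is known before the `k`-th
  -- answer.
  let w : ℕ → ℕ → Tape S N → ℕ → ℝ := fun a b ω k =>
    if a ≤ k ∧ k ≤ b then x / runMax (c ω) a k else 0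
  let F : ℕ → ℕ → Tape S N → ℝ := fun a b ω =>
    ∑ k ∈ range N, w a b ω k * (X ω k (draw ω k).2 - S.p * e * s ω k)
  have hF : ∀ a b, prob {ω | L ≤ F a b ω} ≤ Real.exp (-L) := by
    intro a b
    refine prob_exp_markov (sum_exp_weighted_le hx hX ?_ hs hX0 ?_ ?_ hmean) L
    · intro k ω y j hj
      simp only [w]
      split_ifs with h
      · rw [runMax_congr fun i _ hi => hc k ω y i (by omega)]
      · rfl
    · intro ω k
      simp only [w]
      split_ifs
      · exact div_nonneg hx.le (runMax_nonneg _ _ _)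
      · exact le_rfl
    · intro ω k y
      simp only [w]
      split_ifs with h
      · rw [div_mul_eq_mul_div]
        refine div_le_of_le_mul₀ (runMax_nonneg _ _ _) hx.le ?_
        exact mul_le_mul_of_nonneg_left ((hXc ω k y).trans (le_runMax h.1 le_rfl)) hx.le
      · simpa using hx.le
  refine le_trans (prob_mono ?_) (prob_pairs_le N (fun a b => {ω | L ≤ F a b ω}) fun a _ b _ => hF a b)
  intro ω hω
  by_contra hcon
  refine hω fun a b B hb hB hcB => ?_
  refine sum_lt_of_weighted_sums_lt (c := c ω) hB (div_pos hL hx)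
    (fun k h₁ h₂ => hcB k h₁ (by omega)) ?_ ?_
  · intro k _ _ hz
    have : 0 ≤ S.p * e * s ω k := mul_nonneg (mul_nonneg hp0 he0) (hs0 ω k)
    linarith [hXc ω k (draw ω k).2]
  · intro a' _ hb'
    -- The critical starting point depends on the tape, so the exceptional event has to cover all
    -- starting points, not only `a`.
    have h1 : ¬ L ≤ F a' b ω := fun h => hcon ⟨a', by omega, b, hb, h⟩
    have h2 : F a' b ω = x * ∑ k ∈ Ico a' (b + 1),
        (X ω k (draw ω k).2 - S.p * e * s ω k) / runMax (c ω) a' k := by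
      have hsub : Ico a' (b + 1) ⊆ range N := fun k hk => by
        simp only [mem_Ico, mem_range] at hk ⊢; omega
      simp only [F]
      rw [← sum_subset hsub, mul_sum]
      · refine sum_congr rfl fun k hk => ?_
        simp only [mem_Ico] at hk
        simp only [w, if_pos (show a' ≤ k ∧ k ≤ b by omega)]
        ring
      · intro k _ hk
        simp only [mem_Ico] at hk
        simp only [w, if_neg (show ¬(a' ≤ k ∧ k ≤ b) by omega), zero_mul]
    rw [lt_div_iff₀ hx]
    linarith

end Tape

variable {S : Setup} {N : ℕ} {coins : Type}

/-! ### The steps of an execution -/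

/-- The answer to the query of `x` with the next entry of the tape. -/
noncomputable def answer (ω : Tape S N) (x : Header S) (l : List (Query S)) : Fin (2 ^ S.κ) :=
  open Classical in
  match l.find? (fun e => decide (e.block.header = x)) with
  | some e => e.block.hash
  | none => (draw ω l.length).2

theorem ask_eq (ω : Tape S N) (r : ℕ) (miner : Option ℕ) (x : Fin (2 ^ S.κ) → Header S)
    (l : List (Query S)) : ask ω r miner x l =
      l ++ [⟨r, miner, ⟨x (draw ω l.length).1, answer ω (x (draw ω l.length).1) l⟩⟩] := rfl

theorem answer_of_new {ω : Tape S N} {x : Header S} {l : List (Query S)}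
    (h : ∀ e ∈ l, e.block.header ≠ x) : answer ω x l = (draw ω l.length).2 := by
  classical
  unfold answer
  rw [List.find?_eq_none.2 (fun e he => by simpa using h e he)]

theorem exists_answer_of_old {ω : Tape S N} {x : Header S} {l : List (Query S)}
    (h : ∃ e ∈ l, e.block.header = x) : ∃ e ∈ l, e.block = ⟨x, answer ω x l⟩ := by
  classical
  unfold answer
  cases hf : l.find? (fun e => decide (e.block.header = x)) with
  | none =>
    obtain ⟨e, he, hx⟩ := h
    exact absurd hx (by simpa using List.find?_eq_none.1 hf e he)
  | some e =>
    refine ⟨e, List.mem_of_find?_eq_some hf, ?_⟩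
    have : e.block.header = x := by simpa using List.find?_some hf
    rw [← this]

/-- A query of the miner in the current round. -/
noncomputable def query (ω : Tape S N) (miner : Option ℕ) (x : Fin (2 ^ S.κ) → Header S)
    (t : Trace S) : Trace S :=
  -- The plan of the current round is already in the list, so its number is the length minus `1`.
  ⟨ask ω (t.plans.length - 1) miner x t.queries, t.plans⟩

/-- A query of an honest party in the current round. -/
noncomputable def honestStep (ω : Tape S N) (t : Trace S) (a : Activation S) : Trace S :=
  query ω (some a.party) (a.header (t.plans.length - 1)) t

/-- A query of the adversary in the current round. -/
noncomputable def advStep (Z : Strategy S coins) (ρ : coins) (ω : Tape S N) (t : Trace S) :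
    Trace S :=
  query ω none (fun _ => Z.query ρ t) t

/-- The beginning of a round with the plan `π`. -/
def openRound (π : Plan S) (t : Trace S) : Trace S := ⟨t.queries, t.plans ++ [π]⟩

theorem foldl_honestStep_plans (ω : Tape S N) (L : List (Activation S)) (t : Trace S) :
    (L.foldl (honestStep ω) t).plans = t.plans := by
  induction L generalizing t with
  | nil => rfl
  | cons a L ih => rw [List.foldl_cons, ih]; rfl

theorem foldl_honestStep_queries (ω : Tape S N) (L : List (Activation S)) (t : Trace S) :
    (L.foldl (honestStep ω) t).queries = L.foldl (fun l a =>
      ask ω (t.plans.length - 1) (some a.party) (a.header (t.plans.length - 1)) l) t.queries := by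
  induction L generalizing t with
  | nil => rfl
  | cons a L ih => rw [List.foldl_cons, ih]; rfl

theorem iterate_advStep_plans (Z : Strategy S coins) (ρ : coins) (ω : Tape S N) (c : ℕ)
    (t : Trace S) : ((advStep Z ρ ω)^[c] t).plans = t.plans := by
  induction c generalizing t with
  | zero => rfl
  | succ c ih => rw [Function.iterate_succ_apply, ih]; rfl

/-- Written as a composition of elementary steps, a round can be treated by induction on single
queries. -/
theorem playRound_eq (Z : Strategy S coins) (ρ : coins) (ω : Tape S N) (t : Trace S) :
    playRound Z ρ ω t = (advStep Z ρ ω)^[(Z.plan ρ t).corrupted]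
      ((Z.plan ρ t).honest.foldl (honestStep ω) (openRound (Z.plan ρ t) t)) := by
  set π := Z.plan ρ t with hπ
  have h : ∀ (c : ℕ) (u : Trace S), u.plans.length = t.plans.length + 1 →
      (fun t' : Trace S => (⟨ask ω t.plans.length none (fun _ => Z.query ρ t') t'.queries,
        t'.plans⟩ : Trace S))^[c] u = (advStep Z ρ ω)^[c] u := by
    intro c
    induction c with
    | zero => intro _ _; rfl
    | succ c ih =>
      intro u hu
      rw [Function.iterate_succ_apply, Function.iterate_succ_apply]
      refine (ih _ (by exact hu)).trans ?_
      simp [advStep, query, hu]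
  rw [← h]
  · unfold playRound
    simp only [← hπ]
    congr 1
    have h1 := foldl_honestStep_plans ω π.honest (openRound π t)
    have h2 := foldl_honestStep_queries ω π.honest (openRound π t)
    simp only [openRound, List.length_append, List.length_singleton, Nat.add_sub_cancel] at h1 h2 ⊢
    generalize List.foldl (honestStep ω) _ _ = u at h1 h2 ⊢
    cases u
    simp_all
  · rw [foldl_honestStep_plans]
    simp [openRound]

theorem run_succ (Z : Strategy S coins) (R : ℕ) (ρ : coins) (ω : Tape S N) :
    run Z (R + 1) ρ ω = playRound Z ρ ω (run Z R ρ ω) :=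
  Function.iterate_succ_apply' _ _ _

theorem playRound_plans_length (Z : Strategy S coins) (ρ : coins) (ω : Tape S N) (t : Trace S) :
    (playRound Z ρ ω t).plans.length = t.plans.length + 1 := by
  rw [playRound_eq, iterate_advStep_plans, foldl_honestStep_plans]
  simp [openRound]

theorem run_plans_length (Z : Strategy S coins) (R : ℕ) (ρ : coins) (ω : Tape S N) :
    (run Z R ρ ω).plans.length = R := by
  induction R with
  | zero => rfl
  | succ R ih => rw [run_succ, playRound_plans_length, ih]

theorem active_openRound (π : Plan S) (t : Trace S) :
    (openRound π t).active t.plans.length = π.honest := by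
  simp [openRound, Trace.active]

/-- Properties that are preserved by all steps hold for all executions. -/
theorem run_induction {P : Trace S → Prop} {Z : Strategy S coins} {ρ : coins} {ω : Tape S N}
    (h0 : P ⟨[], []⟩) (hopen : ∀ t π, P t → P (openRound π t))
    (hhon : ∀ t, ∀ a ∈ t.active (t.plans.length - 1), t.plans ≠ [] → P t → P (honestStep ω t a))
    (hadv : ∀ t, t.plans ≠ [] → P t → P (advStep Z ρ ω t)) (R : ℕ) : P (run Z R ρ ω) := by
  induction R with
  | zero => exact h0
  | succ R ih =>
    rw [run_succ, playRound_eq]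
    generalize run Z R ρ ω = t at ih
    have h1 : ∀ L : List (Activation S), ∀ u : Trace S, u.plans ≠ [] → P u →
        (∀ a ∈ L, a ∈ u.active (u.plans.length - 1)) → P (L.foldl (honestStep ω) u) := by
      intro L
      induction L with
      | nil => intro u _ hu _; exact hu
      | cons a L ihL =>
        intro u hu hPu hL
        rw [List.foldl_cons]
        exact ihL _ hu (hhon u a (hL a (by simp)) hu hPu) fun b hb => hL b (by simp [hb])
    have h2 : ∀ (c : ℕ) (u : Trace S), u.plans ≠ [] → P u → P ((advStep Z ρ ω)^[c] u) := by
      intro c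
      induction c with
      | zero => intro u _ hu; exact hu
      | succ c ihc =>
        intro u hu hPu
        rw [Function.iterate_succ_apply]
        exact ihc _ hu (hadv u hu hPu)
    refine h2 _ _ (by rw [foldl_honestStep_plans]; simp [openRound]) (h1 _ _ (by simp [openRound])
      (hopen _ _ ih) fun a ha => ?_)
    have := active_openRound (Z.plan ρ t) t
    simp only [openRound, List.length_append, List.length_singleton, Nat.add_sub_cancel] at this ⊢
    rwa [this]

/-! ### Invariants of executions -/

/-- The relation between an execution and its tape. -/
structure Consistent (ω : Tape S N) (t : Trace S) : Prop where
  round_lt : ∀ {k : ℕ} {e : Query S}, t.queries[k]? = some e → e.round < t.plans.length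
  round_mono : ∀ {j k : ℕ} {e e' : Query S}, j ≤ k → t.queries[j]? = some e → t.queries[k]? = some e' →
    e.round ≤ e'.round
  hash_of_new : ∀ {k : ℕ} {e : Query S}, t.queries[k]? = some e → t.IsNew k e.block.header →
    e.block.hash = (draw ω k).2
  block_of_old : ∀ {k : ℕ} {e : Query S}, t.queries[k]? = some e → ¬ t.IsNew k e.block.header →
    ∃ j < k, ∃ e', t.queries[j]? = some e' ∧ e'.block = e.block
  header_of_honest : ∀ {k : ℕ} {e : Query S} {party : ℕ}, t.queries[k]? = some e → e.miner = some party →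
    ∃ a ∈ t.active e.round, e.block.header = a.header e.round (draw ω k).1

theorem blocksUntil_congr {t t' : Trace S} {k : ℕ} (h : t.queries.take k = t'.queries.take k) :
    t.blocksUntil k = t'.blocksUntil k := by
  unfold Trace.blocksUntil
  rw [h]

theorem isNew_congr {t t' : Trace S} {k : ℕ} (h : t.queries.take k = t'.queries.take k)
    (x : Header S) : t.IsNew k x ↔ t'.IsNew k x := by
  unfold Trace.IsNew
  rw [blocksUntil_congr h]

theorem mem_take_iff {t : Trace S} {k : ℕ} {e : Query S} :
    e ∈ t.queries.take k ↔ ∃ j < k, t.queries[j]? = some e := by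
  rw [List.mem_iff_getElem?]
  constructor
  · rintro ⟨j, hj⟩
    rw [List.getElem?_take] at hj
    split_ifs at hj with h
    exact ⟨j, h, hj⟩
  · rintro ⟨j, hjk, hj⟩
    exact ⟨j, by rw [List.getElem?_take, if_pos hjk, hj]⟩

theorem isNew_iff {t : Trace S} {k : ℕ} {x : Header S} :
    t.IsNew k x ↔ ∀ j < k, ∀ e, t.queries[j]? = some e → e.block.header ≠ x := by
  unfold Trace.IsNew Trace.blocksUntil
  constructor
  · intro h j hj e he
    exact h e.block ⟨e, mem_take_iff.2 ⟨j, hj, he⟩, rfl⟩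
  · rintro h B ⟨e, he, rfl⟩
    obtain ⟨j, hj, he⟩ := mem_take_iff.1 he
    exact h j hj e he

theorem Consistent.query {ω : Tape S N} {t : Trace S} (h : Consistent ω t) (ht : t.plans ≠ [])
    {miner : Option ℕ} {x : Fin (2 ^ S.κ) → Header S}
    (hm : ∀ party, miner = some party → ∃ a ∈ t.active (t.plans.length - 1),
      x = a.header (t.plans.length - 1)) : Consistent ω (query ω miner x t) := by
  have hlen : 0 < t.plans.length := List.length_pos_iff.2 ht
  set y := answer ω (x (draw ω t.queries.length).1) t.queries with hy
  set f : Query S := ⟨t.plans.length - 1, miner, ⟨x (draw ω t.queries.length).1, y⟩⟩ with hf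
  have hq : (ParallelChain.query ω miner x t).queries = t.queries ++ [f] := ask_eq _ _ _ _ _
  have hp : (ParallelChain.query ω miner x t).plans = t.plans := rfl
  generalize ParallelChain.query ω miner x t = u at hq hp
  have hget : ∀ {k : ℕ} {e : Query S}, u.queries[k]? = some e →
      (t.queries[k]? = some e) ∨ (k = t.queries.length ∧ e = f) := by
    intro k e he
    rw [hq, List.getElem?_append] at he
    split_ifs at he with hk
    · exact Or.inl he
    · right
      obtain ⟨h1, h2⟩ := List.getElem?_eq_some_iff.1 he
      simp only [List.length_singleton] at h1
      have : k = t.queries.length := by omega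
      subst this
      simp only [Nat.sub_self, List.getElem_cons_zero] at h2
      exact ⟨rfl, h2.symm⟩
  have htake : ∀ {k}, k ≤ t.queries.length → u.queries.take k = t.queries.take k := by
    intro k hk
    rw [hq, List.take_append_of_le_length hk]
  have hlt : ∀ {k : ℕ} {e : Query S}, t.queries[k]? = some e → k < t.queries.length := fun he =>
    (List.getElem?_eq_some_iff.1 he).1
  have hact : ∀ r, u.active r = t.active r := by intro r; unfold Trace.active; rw [hp]
  have hup : ∀ {k : ℕ} {e : Query S}, t.queries[k]? = some e → u.queries[k]? = some e := by
    intro k e he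
    rw [hq, List.getElem?_append_left (hlt he), he]
  refine ⟨?_, ?_, ?_, ?_, ?_⟩
  · intro k e he
    rw [hp]
    rcases hget he with he | ⟨-, rfl⟩
    · exact h.round_lt he
    · simp only [hf]; omega
  · intro j k e e' hjk he he'
    rcases hget he with he | ⟨hj, rfl⟩ <;> rcases hget he' with he' | ⟨hk, rfl⟩
    · exact h.round_mono hjk he he'
    · have := h.round_lt he
      simp only [hf]; omega
    · have := hlt he'
      omega
    · exact le_rfl
  · intro k e he hnew
    rcases hget he with he | ⟨rfl, rfl⟩
    · exact h.hash_of_new he ((isNew_congr (htake (hlt he).le) _).1 hnew)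
    · refine answer_of_new fun e he => ?_
      obtain ⟨j, hj⟩ := List.mem_iff_getElem?.1 he
      exact isNew_iff.1 hnew j (hlt hj) e (hup hj)
  · intro k e he hnew
    rcases hget he with he | ⟨rfl, rfl⟩
    · obtain ⟨j, hj, e', he', hb⟩ := h.block_of_old he
        (fun h' => hnew ((isNew_congr (htake (hlt he).le) _).2 h'))
      exact ⟨j, hj, e', hup he', hb⟩
    · rw [isNew_iff] at hnew
      push Not at hnew
      obtain ⟨j, hj, e, he, hb⟩ := hnew
      rcases hget he with he | ⟨hj', -⟩
      · obtain ⟨e', he', hb'⟩ := exists_answer_of_old (ω := ω) ⟨e, List.mem_of_getElem? he, hb⟩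
        obtain ⟨j', hj'⟩ := List.mem_iff_getElem?.1 he'
        exact ⟨j', hlt hj', e', hup hj', hb'⟩
      · omega
  · intro k e party he hmin
    rcases hget he with he | ⟨rfl, rfl⟩
    · rw [hact]
      exact h.header_of_honest he hmin
    · obtain ⟨a, ha, hx⟩ := hm party hmin
      refine ⟨a, by rw [hact]; exact ha, ?_⟩
      simp only [hf, hx]

theorem Consistent.openRound {ω : Tape S N} {t : Trace S} (h : Consistent ω t) (π : Plan S) :
    Consistent ω (openRound π t) where
  round_lt he := (h.round_lt he).trans (by simp [ParallelChain.openRound])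
  round_mono := h.round_mono
  hash_of_new := h.hash_of_new
  block_of_old := h.block_of_old
  header_of_honest := by
    intro k e party he hm
    obtain ⟨a, ha, hx⟩ := h.header_of_honest he hm
    refine ⟨a, ?_, hx⟩
    have := h.round_lt he
    unfold Trace.active ParallelChain.openRound at *
    simp only [List.getElem?_append_left this]
    exact ha

theorem consistent_run (Z : Strategy S coins) (R : ℕ) (ρ : coins) (ω : Tape S N) :
    Consistent ω (run Z R ρ ω) := by
  refine run_induction ⟨?_, ?_, ?_, ?_, ?_⟩ (fun t π h => h.openRound π)
    (fun t a ha ht h => h.query ht fun party _ => ⟨a, ha, rfl⟩)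
    (fun t ht h => h.query ht fun party hp => by simp at hp) R <;> simp

/-- The number of queries of honest parties in round `r`. -/
def honestCount (t : Trace S) (r : ℕ) : ℕ :=
  t.queries.countP fun e => decide (e.round = r ∧ e.miner.isSome = true)

theorem honestCount_query (ω : Tape S N) (miner : Option ℕ) (x : Fin (2 ^ S.κ) → Header S)
    (t : Trace S) (r : ℕ) : honestCount (query ω miner x t) r =
      honestCount t r + if t.plans.length - 1 = r ∧ miner.isSome = true then 1 else 0 := by
  have hq : (query ω miner x t).queries = _ := ask_eq ω _ _ _ _
  unfold honestCount
  rw [hq, List.countP_append, List.countP_singleton]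
  simp

/-- This converts sums of `n_r` over rounds into counts of queries, on which the martingale
arguments operate. -/
theorem honestCount_run (Z : Strategy S coins) (R : ℕ) (ρ : coins) (ω : Tape S N) (r : ℕ) :
    honestCount (run Z R ρ ω) r = (run Z R ρ ω).n r := by
  induction R with
  | zero => simp [run, honestCount, Trace.n, Trace.active]
  | succ R ih =>
    have hcons := consistent_run Z R ρ ω
    have hlen := run_plans_length Z R ρ ω
    rw [run_succ, playRound_eq]
    generalize run Z R ρ ω = t at *
    set π := Z.plan ρ t
    have h1 : ∀ (L : List (Activation S)) (u : Trace S), honestCount (L.foldl (honestStep ω) u) r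
        = honestCount u r + if u.plans.length - 1 = r then L.length else 0 := by
      intro L
      induction L with
      | nil => intro u; simp
      | cons a L ihL =>
        intro u
        rw [List.foldl_cons, ihL]
        unfold honestStep
        rw [honestCount_query]
        simp only [query, Option.isSome_some, and_true, List.length_cons]
        by_cases hr : u.plans.length - 1 = r
        · simp only [hr, if_true]; omega
        · simp only [hr, if_false]
    have h2 : ∀ (c : ℕ) (u : Trace S), honestCount ((advStep Z ρ ω)^[c] u) r = honestCount u r := by
      intro c
      induction c with
      | zero => intro u; rfl
      | succ c ihc =>
        intro u
        rw [Function.iterate_succ_apply, ihc]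
        unfold advStep
        rw [honestCount_query]
        simp
    have h3 : ((advStep Z ρ ω)^[π.corrupted] (π.honest.foldl (honestStep ω) (openRound π t))).n r
        = (openRound π t).n r := by
      unfold Trace.n Trace.active
      rw [iterate_advStep_plans, foldl_honestStep_plans]
    rw [h2, h1, h3]
    have h4 : honestCount (openRound π t) r = honestCount t r := rfl
    rw [h4, ih]
    have h5 : (openRound π t).plans.length - 1 = R := by simp [openRound, hlen]
    rw [h5]
    unfold Trace.n Trace.active openRound
    rcases lt_trichotomy r R with hr | hr | hr
    · rw [if_neg (by omega), List.getElem?_append_left (by omega), add_zero]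
    · subst hr
      simp [← hlen]
    · rw [if_neg (by omega), List.getElem?_eq_none (by omega), List.getElem?_eq_none (by simp; omega), add_zero]

/-! ### Locality: what is determined by an initial segment of the tape -/

/-- Two traces are equal and have at most `k` queries, or agree in everything that was decided
before the `k`-th answer. -/
inductive Synced (ω ω' : Tape S N) (k : ℕ) (t t' : Trace S) : Prop
  | short : t = t' → t.queries.length ≤ k → Synced ω ω' k t t'
  | long (e e' : Query S) : t.queries[k]? = some e → t'.queries[k]? = some e' →
      t.queries.take k = t'.queries.take k → e.round = e'.round → e.miner = e'.miner →
      -- Headers are compared only under equal nonces, so that one relation serves both for replaced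
      -- answers and for replaced nonces.
      ((draw ω k).1 = (draw ω' k).1 → e.block.header = e'.block.header) →
      -- The plan of the round of the `k`-th query is included, since it is fixed before any answer
      -- of that round.
      t.plans.take (e.round + 1) = t'.plans.take (e.round + 1) →
      e.round < t.plans.length → e.round < t'.plans.length → Synced ω ω' k t t'

/-- `u` continues `t`. -/
def Continues (t u : Trace S) : Prop := t.queries <+: u.queries ∧ t.plans <+: u.plans

theorem Continues.refl (t : Trace S) : Continues t t := ⟨List.prefix_rfl, List.prefix_rfl⟩

theorem Continues.trans {t u v : Trace S} (h₁ : Continues t u) (h₂ : Continues u v) :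
    Continues t v := ⟨h₁.1.trans h₂.1, h₁.2.trans h₂.2⟩

theorem continues_query (ω : Tape S N) (miner : Option ℕ) (x : Fin (2 ^ S.κ) → Header S)
    (t : Trace S) : Continues t (query ω miner x t) :=
  ⟨⟨_, (ask_eq ω _ _ _ _).symm⟩, List.prefix_rfl⟩

theorem continues_playRound (Z : Strategy S coins) (ρ : coins) (ω : Tape S N) (t : Trace S) :
    Continues t (playRound Z ρ ω t) := by
  rw [playRound_eq]
  have h1 : ∀ (L : List (Activation S)) (u : Trace S), Continues u (L.foldl (honestStep ω) u) := by
    intro L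
    induction L with
    | nil => exact fun u => Continues.refl u
    | cons a L ih => exact fun u => (continues_query _ _ _ _).trans (ih _)
  have h2 : ∀ (c : ℕ) (u : Trace S), Continues u ((advStep Z ρ ω)^[c] u) := by
    intro c
    induction c with
    | zero => exact fun u => Continues.refl u
    | succ c ih => exact fun u => (continues_query _ _ _ _).trans (ih _)
  have h0 : Continues t (openRound (Z.plan ρ t) t) := ⟨List.prefix_rfl, List.prefix_append _ _⟩
  exact h0.trans ((h1 _ _).trans (h2 _ _))

theorem IsPrefix_getElem? {α : Type*} {l l' : List α} (h : l <+: l') {k : ℕ} {e : α}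
    (he : l[k]? = some e) : l'[k]? = some e := by
  obtain ⟨m, rfl⟩ := h
  rw [List.getElem?_append_left (List.getElem?_eq_some_iff.1 he).1, he]

theorem IsPrefix_take {α : Type*} {l l' : List α} (h : l <+: l') {k : ℕ} (hk : k ≤ l.length) :
    l'.take k = l.take k := by
  obtain ⟨m, rfl⟩ := h
  rw [List.take_append_of_le_length hk]

/-- Once the `k`-th query has been asked, the relation concerns initial segments only, and later
steps leave these alone. -/
theorem Synced.continues {ω ω' : Tape S N} {k : ℕ} {t t' u u' : Trace S} (h : Synced ω ω' k t t')
    (ht : k < t.queries.length) (hu : Continues t u) (hu' : Continues t' u') :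
    Synced ω ω' k u u' := by
  cases h with
  | short _ h => omega
  | long e e' h1 h2 h3 h4 h5 h6 h7 h8 h9 =>
    have ht' := (List.getElem?_eq_some_iff.1 h2).1
    refine .long e e' (IsPrefix_getElem? hu.1 h1) (IsPrefix_getElem? hu'.1 h2) ?_ h4 h5 h6 ?_
      (h8.trans_le hu.2.length_le) (h9.trans_le hu'.2.length_le)
    · rw [IsPrefix_take hu.1 ht.le, IsPrefix_take hu'.1 ht'.le, h3]
    · rw [IsPrefix_take hu.2 h8, IsPrefix_take hu'.2 h9, h7]

theorem Synced.query {ω ω' : Tape S N} {k : ℕ} {t t' : Trace S} (h : Synced ω ω' k t t')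
    (hω : ∀ j < k, draw ω j = draw ω' j) (ht : t.plans ≠ []) {m m' : Option ℕ}
    {x x' : Fin (2 ^ S.κ) → Header S} (hm : t = t' → m = m') (hx : t = t' → x = x') :
    Synced ω ω' k (query ω m x t) (query ω' m' x' t') := by
  have h0 := h
  cases h with
  | long e e' h1 h2 h3 h4 h5 h6 h7 =>
    exact h0.continues (List.getElem?_eq_some_iff.1 h1).1 (continues_query _ _ _ _)
      (continues_query _ _ _ _)
  | short e0 hk =>
    subst e0
    obtain rfl := hm rfl
    obtain rfl := hx rfl
    have hpos := List.length_pos_iff.2 ht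
    -- With fewer than `k` queries both runs draw the same entry and remain equal. With exactly `k`
    -- queries this step asks the `k`-th one, where the runs may separate.
    rcases hk.lt_or_eq with hk | hk
    · have e : ParallelChain.query ω' m x t = ParallelChain.query ω m x t := by
        unfold ParallelChain.query
        rw [ask_eq, ask_eq]
        unfold answer
        rw [hω _ hk]
      rw [e]
      refine .short rfl ?_
      unfold ParallelChain.query
      rw [ask_eq]
      simpa using hk
    · subst hk
      refine .long ⟨t.plans.length - 1, m, ⟨x (draw ω t.queries.length).1,
          answer ω (x (draw ω t.queries.length).1) t.queries⟩⟩
        ⟨t.plans.length - 1, m, ⟨x (draw ω' t.queries.length).1,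
          answer ω' (x (draw ω' t.queries.length).1) t.queries⟩⟩ ?_ ?_ ?_ rfl rfl ?_ rfl ?_ ?_
      · unfold ParallelChain.query
        rw [ask_eq]
        simp
      · unfold ParallelChain.query
        rw [ask_eq]
        simp
      · unfold ParallelChain.query
        rw [ask_eq, ask_eq]
        simp
      · intro e
        simp only [e]
      · simp only [ParallelChain.query]; omega
      · simp only [ParallelChain.query]; omega

theorem Synced.playRound {ω ω' : Tape S N} {k : ℕ} {t t' : Trace S} (h : Synced ω ω' k t t')
    (hω : ∀ j < k, draw ω j = draw ω' j) (Z : Strategy S coins) (ρ : coins) :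
    Synced ω ω' k (playRound Z ρ ω t) (playRound Z ρ ω' t') := by
  have h0 := h
  cases h with
  | long e e' h1 h2 h3 h4 h5 h6 h7 =>
    exact h0.continues (List.getElem?_eq_some_iff.1 h1).1 (continues_playRound _ _ _ _)
      (continues_playRound _ _ _ _)
  | short e0 hk =>
    subst e0
    rw [playRound_eq, playRound_eq]
    set π := Z.plan ρ t
    have h1 : ∀ (L : List (Activation S)) (u u' : Trace S), u.plans ≠ [] → u.plans = u'.plans →
        Synced ω ω' k u u' → Synced ω ω' k (L.foldl (honestStep ω) u) (L.foldl (honestStep ω') u') := by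
      intro L
      induction L with
      | nil => exact fun _ _ _ _ h => h
      | cons a L ih =>
        intro u u' hu huu' h
        exact ih _ _ hu huu' (h.query hω hu (fun _ => rfl) (fun _ => by rw [huu']))
    have h2 : ∀ (c : ℕ) (u u' : Trace S), u.plans ≠ [] →
        Synced ω ω' k u u' → Synced ω ω' k ((advStep Z ρ ω)^[c] u) ((advStep Z ρ ω')^[c] u') := by
      intro c
      induction c with
      | zero => exact fun _ _ _ h => h
      | succ c ih =>
        intro u u' hu h
        exact ih _ _ hu (h.query hω hu (fun _ => rfl) (fun e => by rw [e]))
    refine h2 _ _ _ (by rw [foldl_honestStep_plans]; simp [openRound])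
      (h1 _ _ _ (by simp [openRound]) rfl (.short rfl hk))

theorem synced_run {ω ω' : Tape S N} {k : ℕ} (hω : ∀ j < k, draw ω j = draw ω' j)
    (Z : Strategy S coins) (R : ℕ) (ρ : coins) :
    Synced ω ω' k (run Z R ρ ω) (run Z R ρ ω') := by
  induction R with
  | zero => exact .short rfl (Nat.zero_le _)
  | succ R ih =>
    rw [run_succ, run_succ]
    exact ih.playRound hω Z ρ

/-! ### The part of a query that is decided before its answer -/

/-- The `k`-th query without its answer. -/
def Trace.request (t : Trace S) (k : ℕ) : Option (ℕ × Option ℕ × Header S) :=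
  (t.queries[k]?).map fun e => (e.round, e.miner, e.block.header)

theorem isAdv_iff {t : Trace S} {k : ℕ} :
    t.IsAdv k ↔ ∃ x, t.request k = some x ∧ x.2.1 = none := by
  unfold Trace.IsAdv Trace.request
  cases t.queries[k]? <;> simp

theorem targetAt_eq (t : Trace S) (k : ℕ) :
    t.targetAt k = (t.request k).elim 0 fun x => ((x.2.2.target : ℕ) : ℝ) := by
  unfold Trace.targetAt Trace.request
  cases t.queries[k]? <;> simp

open Classical in
theorem gain_eq (t : Trace S) (i : Fin (S.m + 1)) (k : ℕ) (y : Fin (2 ^ S.κ)) :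
    t.gain i k y = (t.request k).elim 0 fun x =>
      if t.IsNew k x.2.2 ∧ Extends i (t.blocksUntil k) x.2.2 ∧ OnTree i x.2.2.target y
      then x.2.2.diff else 0 := by
  unfold Trace.gain Trace.request
  cases t.queries[k]? <;> simp

theorem Synced.take_eq {ω ω' : Tape S N} {j k : ℕ} {t t' : Trace S} (h : Synced ω ω' k t t')
    (hj : j ≤ k) : t.queries.take j = t'.queries.take j := by
  have hk : t.queries.take k = t'.queries.take k := by
    cases h with
    | short h => rw [h]
    | long _ _ _ _ h => exact h
  have := congrArg (List.take j) hk
  simpa [List.take_take, min_eq_left hj] using this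

theorem Synced.getElem?_eq {ω ω' : Tape S N} {j k : ℕ} {t t' : Trace S} (h : Synced ω ω' k t t')
    (hj : j < k) : t.queries[j]? = t'.queries[j]? := by
  have := congrArg (fun l => l[j]?) (h.take_eq le_rfl)
  simpa [List.getElem?_take, hj] using this

theorem Synced.request_eq {ω ω' : Tape S N} {j k : ℕ} {t t' : Trace S} (h : Synced ω ω' k t t')
    (hω : (draw ω k).1 = (draw ω' k).1) (hj : j ≤ k) : t.request j = t'.request j := by
  rcases hj.lt_or_eq with hj | rfl
  · unfold Trace.request
    rw [h.getElem?_eq hj]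
  · cases h with
    | short h => rw [h]
    | long e e' h1 h2 _ h4 h5 h6 =>
      unfold Trace.request
      rw [h1, h2, Option.map_some, Option.map_some, h4, h5, h6 hω]

theorem synced_reply (Z : Strategy S coins) (R : ℕ) (ρ : coins) (ω : Tape S N) (k : Fin N)
    (y : Fin (2 ^ S.κ)) : Synced (reply ω k y) ω k (run Z R ρ (reply ω k y)) (run Z R ρ ω) :=
  synced_run (fun _ hj => draw_reply_of_ne ω k y hj.ne) Z R ρ

theorem synced_renonce (Z : Strategy S coins) (R : ℕ) (ρ : coins) (ω : Tape S N) (k : Fin N)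
    (z : Fin (2 ^ S.κ)) : Synced (renonce ω k z) ω k (run Z R ρ (renonce ω k z)) (run Z R ρ ω) :=
  synced_run (fun _ hj => draw_renonce_of_ne ω k z hj.ne) Z R ρ

theorem request_reply (Z : Strategy S coins) (R : ℕ) (ρ : coins) (ω : Tape S N) (k : Fin N)
    (y : Fin (2 ^ S.κ)) {j : ℕ} (hj : j ≤ k) :
    (run Z R ρ (reply ω k y)).request j = (run Z R ρ ω).request j :=
  (synced_reply Z R ρ ω k y).request_eq (draw_reply_fst ω k y k) hj

theorem gain_reply (Z : Strategy S coins) (R : ℕ) (ρ : coins) (ω : Tape S N) (k : Fin N)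
    (y : Fin (2 ^ S.κ)) {j : ℕ} (hj : j ≤ k) (i : Fin (S.m + 1)) (y' : Fin (2 ^ S.κ)) :
    (run Z R ρ (reply ω k y)).gain i j y' = (run Z R ρ ω).gain i j y' := by
  classical
  have h := (synced_reply Z R ρ ω k y).take_eq hj
  rw [gain_eq, gain_eq, request_reply Z R ρ ω k y hj, blocksUntil_congr h]
  cases (run Z R ρ ω).request j with
  | none => rfl
  | some x => exact if_congr (and_congr (isNew_congr h _) Iff.rfl) rfl rfl

/-! ### Sortition -/

open Classical in
theorem card_onTree_le (i : Fin (S.m + 1)) (T : ℕ+) :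
    (univ.filter fun y : Fin (2 ^ S.κ) => OnTree i T y).card ≤ T := by
  refine (card_le_card_of_injOn (t := Ico ((i : ℕ) * T) (((i : ℕ) + 1) * T)) (fun y : Fin (2 ^ S.κ) => (y : ℕ))
    (fun y hy => ?_) (fun a _ b _ h => Fin.ext h)).trans ?_
  · exact mem_coe.2 (mem_Ico.2 (mem_filter.1 hy).2)
  · rw [Nat.card_Ico, Nat.add_mul, one_mul, Nat.add_sub_cancel_left]

-- The exact count, not just an upper bound, is needed for the submartingale of the lower bound; it
-- uses that the region of the tree fits into the hash range.
open Classical in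
theorem card_onTree (i : Fin (S.m + 1)) {T : ℕ+} (hT : (S.m + 1) * (T : ℕ) ≤ 2 ^ S.κ) :
    (univ.filter fun y : Fin (2 ^ S.κ) => OnTree i T y).card = T := by
  have hi : ((i : ℕ) + 1) * (T : ℕ) ≤ 2 ^ S.κ := (Nat.mul_le_mul_right _ (by omega)).trans hT
  have : (univ.filter fun y : Fin (2 ^ S.κ) => OnTree i T y).card
      = (Ico ((i : ℕ) * T) (((i : ℕ) + 1) * T)).card := by
    refine card_bij (fun y _ => (y : ℕ)) (fun y hy => mem_Ico.2 (mem_filter.1 hy).2)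
      (fun a _ b _ h => Fin.ext h) fun b hb => ?_
    have hb := mem_Ico.1 hb
    exact ⟨⟨b, hb.2.trans_le hi⟩, mem_filter.2 ⟨mem_univ _, hb⟩, rfl⟩
  rw [this, Nat.card_Ico, Nat.add_mul, one_mul, Nat.add_sub_cancel_left]

theorem Header.diff_pos (x : Header S) : 0 < x.diff := by
  have := x.target.pos
  unfold Header.diff
  positivity

open Classical in
theorem sum_onTree_le (i : Fin (S.m + 1)) (x : Header S) :
    ∑ y : Fin (2 ^ S.κ), (if OnTree i x.target y then x.diff else 0) ≤ 1 := by
  rw [← sum_filter, sum_const, nsmul_eq_mul]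
  have := card_onTree_le i x.target
  have hT : (0 : ℝ) < (x.target : ℕ) := by exact_mod_cast x.target.pos
  unfold Header.diff
  rw [mul_one_div, div_le_one hT]
  exact_mod_cast this

theorem gain_nonneg (t : Trace S) (i : Fin (S.m + 1)) (k : ℕ) (y : Fin (2 ^ S.κ)) :
    0 ≤ t.gain i k y := by
  rw [gain_eq]
  cases t.request k with
  | none => simp
  | some x =>
    simp only [Option.elim_some]
    split_ifs
    · exact x.2.2.diff_pos.le
    · exact le_rfl

theorem sum_gain_le (t : Trace S) (i : Fin (S.m + 1)) (k : ℕ) : ∑ y, t.gain i k y ≤ 1 := by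
  classical
  simp only [gain_eq]
  cases t.request k with
  | none => simp
  | some x =>
    simp only [Option.elim_some]
    refine le_trans (sum_le_sum fun y _ => ?_) (sum_onTree_le i x.2.2)
    split_ifs with h1 h2 h2
    · exact le_rfl
    · exact absurd h1.2.2 h2
    · exact x.2.2.diff_pos.le
    · exact le_rfl

/-- The created difficulty is a function of the entry of the tape. -/
theorem created_eq {ω : Tape S N} {t : Trace S} (h : Consistent ω t) (i : Fin (S.m + 1)) (k : ℕ) :
    t.created i k = t.gain i k (draw ω k).2 := by
  unfold Trace.created
  cases he : t.queries[k]? with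
  | none => simp [Trace.gain, he]
  | some e =>
    simp only [Option.elim_some]
    by_cases hnew : t.IsNew k e.block.header
    · rw [h.hash_of_new he hnew]
    · simp [Trace.gain, he, hnew]

/-! ### Targets of valid chains -/

theorem recalculate_le (hT₀ : (S.m + 1) * (S.T₀ : ℕ) ≤ 2 ^ S.κ) (T : ℕ+) (Λ : ℝ) :
    (S.m + 1) * (recalculate S T Λ : ℕ) ≤ 2 ^ S.κ := by
  have h1 : 1 ≤ 2 ^ S.κ / (S.m + 1) := by
    rw [Nat.le_div_iff_mul_le (by omega), one_mul]
    exact (Nat.le_mul_of_pos_right _ S.T₀.pos).trans hT₀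
  have h2 : (recalculate S T Λ : ℕ) ≤ 2 ^ S.κ / (S.m + 1) := max_le h1 (min_le_left _ _)
  calc (S.m + 1) * (recalculate S T Λ : ℕ) ≤ (S.m + 1) * (2 ^ S.κ / (S.m + 1)) := by gcongr
    _ ≤ 2 ^ S.κ := Nat.mul_div_le _ _

/-- The cap in `recalculate` preserves the condition imposed on the initial target. Honest queries
therefore succeed on every tree with probability exactly `p T`. -/
theorem nextTarget_le (hT₀ : (S.m + 1) * (S.T₀ : ℕ) ≤ 2 ^ S.κ) {V : Set (Block S)}
    {C : List (Block S)} (hC : PivotChain V C) : (S.m + 1) * (nextTarget C : ℕ) ≤ 2 ^ S.κ := by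
  induction hC with
  | genesis => exact hT₀
  | extend C B _ _ _ hl ih =>
    unfold nextTarget
    dsimp only
    split_ifs
    · exact recalculate_le hT₀ _ _
    · rw [hl.2.1]; exact ih

theorem PivotChain.mono {V W : Set (Block S)} (h : V ⊆ W) {C : List (Block S)}
    (hC : PivotChain V C) : PivotChain W C := by
  induction hC with
  | genesis => exact .genesis
  | extend C B _ hB ht hl ih => exact .extend C B ih (h hB) ht hl

/-! ### Insertions, copies and predictions -/

theorem ValidChain.of_cons {i : Fin (S.m + 1)} {V : Set (Block S)} {B : Block S}
    {C : List (Block S)} (h : ValidChain i V (B :: C)) :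
    B ∈ V ∧ B.header.parent i = tip C ∧ ValidChain i V C := by
  unfold ValidChain at *
  split_ifs at * with hi
  · cases h with
    | extend _ _ hC hB ht hl => exact ⟨hB, hi ▸ hl.1, hC⟩
  · obtain ⟨P, h⟩ := h
    cases h with
    | extend _ P₀ _ _ hC hP hB ht hl => exact ⟨hB, hl.1, P₀, hC⟩

/-- In the second chain `B₂` refers to `B₁`, which is created later. -/
theorem Trace.Insertion.prediction {t : Trace S} (h : t.Insertion) : t.Prediction := by
  obtain ⟨i, C, C', B₀, B₁, B₂, k₁, k₂, -, h2, hk₁, hk₂, hlt⟩ := h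
  exact ⟨i, B₁, B₂, k₁, k₂, hk₁, hk₂, hlt.le, h2.of_cons.2.1⟩

theorem not_copy_of_hash_injOn {t : Trace S}
    (h : ∀ B ∈ t.blocks, ∀ B' ∈ t.blocks, B.hash = B'.hash → B = B') : ¬ t.Copy := by
  rintro ⟨i, B, C, C', h1, h2, hne⟩
  -- If hash values identify blocks, a valid chain can be recovered from its tip by following parent
  -- references.
  have key : ∀ C C' : List (Block S), ValidChain i t.blocks C → ValidChain i t.blocks C' →
      tip C = tip C' → C = C' := by
    intro C
    induction C with
    | nil =>
      intro C' _ _ htip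
      cases C' with
      | nil => rfl
      | cons => simp [tip] at htip
    | cons B C ih =>
      intro C' hC hC' htip
      cases C' with
      | nil => simp [tip] at htip
      | cons B' C' =>
        have hB : B = B' := h B hC.of_cons.1 B' hC'.of_cons.1 (by simpa [tip] using htip)
        subst hB
        rw [ih C' hC.of_cons.2.2 hC'.of_cons.2.2 (hC.of_cons.2.1.symm.trans hC'.of_cons.2.1)]
  exact hne (key C C' h1.of_cons.2.2 h2.of_cons.2.2 (h1.of_cons.2.1.symm.trans h2.of_cons.2.1))

/-- The hash values to which a header refers. -/
def Header.refs (x : Header S) : Finset (Fin (2 ^ S.κ)) :=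
  univ.biUnion fun i => (x.parent i).toFinset

theorem Header.card_refs_le (x : Header S) : x.refs.card ≤ S.m + 1 := by
  refine (card_biUnion_le_card_mul _ _ 1 fun i _ => ?_).trans (by simp)
  cases x.parent i <;> simp

/-- The answers to the `k`-th query that lead to a collision or to a prediction. -/
def Trace.danger (t : Trace S) (k : ℕ) : Finset (Fin (2 ^ S.κ)) :=
  ((range k).biUnion fun j => (t.queries[j]?).elim ∅ fun e => {e.block.hash}) ∪
    -- The header of the `k`-th query is included: a block referring to its own hash also counts as
    -- a prediction.
    (range (k + 1)).biUnion fun j => (t.request j).elim ∅ fun x => x.2.2.refs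

theorem Trace.card_danger_le (t : Trace S) (k : ℕ) :
    (t.danger k).card ≤ (k + 1) * (S.m + 2) := by
  have h1 := card_biUnion_le_card_mul (range k)
    (fun j => (t.queries[j]?).elim ∅ fun e => {e.block.hash}) 1 fun j _ => by
      cases t.queries[j]? <;> simp
  have h2 := card_biUnion_le_card_mul (range (k + 1))
    (fun j => (t.request j).elim ∅ fun x => x.2.2.refs) (S.m + 1) fun j _ => by
      cases t.request j with
      | none => simp
      | some x => exact x.2.2.card_refs_le
  rw [card_range] at h1 h2
  refine (card_union_le _ _).trans ((add_le_add h1 h2).trans ?_)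
  nlinarith

/-- The nonces of the first `k` queries. -/
def Trace.nonces (t : Trace S) (k : ℕ) : Finset (Fin (2 ^ S.κ)) :=
  (range k).biUnion fun j => (t.queries[j]?).elim ∅ fun e => {e.block.header.nonce}

theorem Trace.card_nonces_le (t : Trace S) (k : ℕ) : (t.nonces k).card ≤ k := by
  refine (card_biUnion_le_card_mul _ _ 1 fun j _ => ?_).trans (by simp)
  cases t.queries[j]? <;> simp

/-- No answer hits an earlier hash value or reference, and no nonce is repeated by chance. -/
def NoCollision (ω : Tape S N) (t : Trace S) : Prop :=
  ∀ k : Fin N, (ω k).2 ∉ t.danger k ∧ (ω k).1 ∉ t.nonces k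

theorem prob_not_noCollision_le (Z : Strategy S coins) (R : ℕ) (ρ : coins) :
    prob {ω : Tape S N | ¬ NoCollision ω (run Z R ρ ω)}
      ≤ (S.m + 3) * (N : ℝ) ^ 2 * (1 / 2 ^ S.κ) := by
  have hpos : (0 : ℝ) ≤ 1 / 2 ^ S.κ := by positivity
  have h1 : ∀ k : Fin N, prob {ω : Tape S N | (ω k).2 ∈ (run Z R ρ ω).danger k}
      ≤ N * (S.m + 2) * (1 / 2 ^ S.κ) := by
    intro k
    refine (prob_answer_mem_le k _ ((k + 1) * (S.m + 2)) (fun ω y => ?_)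
      (fun ω => Trace.card_danger_le _ _)).trans ?_
    · unfold Trace.danger
      congr 1
      · refine biUnion_congr rfl fun j hj => ?_
        rw [(synced_reply Z R ρ ω k y).getElem?_eq (mem_range.1 hj)]
      · refine biUnion_congr rfl fun j hj => ?_
        rw [request_reply Z R ρ ω k y (Nat.lt_succ_iff.1 (mem_range.1 hj))]
    · have hk : ((k : ℕ) + 1 : ℝ) ≤ N := by exact_mod_cast k.2
      push_cast
      gcongr
  have h2 : ∀ k : Fin N, prob {ω : Tape S N | (ω k).1 ∈ (run Z R ρ ω).nonces k}
      ≤ N * (1 / 2 ^ S.κ) := by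
    intro k
    refine (prob_nonce_mem_le k _ k (fun ω y => ?_) (fun ω => Trace.card_nonces_le _ _)).trans ?_
    · unfold Trace.nonces
      refine biUnion_congr rfl fun j hj => ?_
      rw [(synced_renonce Z R ρ ω k y).getElem?_eq (mem_range.1 hj)]
    · have hk : ((k : ℕ) : ℝ) ≤ N := by exact_mod_cast k.2.le
      gcongr
  have h3 := prob_biUnion_le_mul (univ : Finset (Fin N))
    (fun k => {ω : Tape S N | (ω k).2 ∈ (run Z R ρ ω).danger k} ∪
      {ω : Tape S N | (ω k).1 ∈ (run Z R ρ ω).nonces k})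
    (c := N * (S.m + 3) * (1 / 2 ^ S.κ))
    (fun k _ => (prob_union_le _ _).trans ((add_le_add (h1 k) (h2 k)).trans (by nlinarith)))
  refine (prob_mono fun ω hω => ?_).trans (h3.trans_eq ?_)
  · unfold NoCollision at hω
    simp only [Set.mem_ofPred_eq, not_forall] at hω
    obtain ⟨k, hk⟩ := hω
    refine ⟨k, mem_univ _, ?_⟩
    by_contra hcon
    exact hk (not_or.1 hcon)
  · rw [card_univ, Fintype.card_fin]
    ring

section NoCollision

variable {ω : Tape S N} {t : Trace S}

theorem createdAt_hash (hc : Consistent ω t) {k : ℕ} {B : Block S} (h : t.CreatedAt k B) :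
    B.hash = (draw ω k).2 := by
  obtain ⟨⟨e, he, rfl⟩, hnew⟩ := h
  exact hc.hash_of_new he hnew

theorem exists_createdAt (hc : Consistent ω t) {B : Block S} (hB : B ∈ t.blocks) :
    ∃ k, t.CreatedAt k B := by
  obtain ⟨e, he, rfl⟩ := hB
  obtain ⟨k, hk⟩ := List.mem_iff_getElem?.1 he
  clear he
  induction k using Nat.strong_induction_on generalizing e with
  | _ k ih =>
    by_cases hnew : t.IsNew k e.block.header
    · exact ⟨k, ⟨e, hk, rfl⟩, hnew⟩
    · obtain ⟨j, hj, e', he', hb⟩ := hc.block_of_old hk hnew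
      rw [← hb]
      exact ih j hj e' he'

theorem Trace.CreatedAt.lt {k : ℕ} {B : Block S} (h : t.CreatedAt k B)
    (hN : t.queries.length ≤ N) : k < N := by
  obtain ⟨⟨e, he, -⟩, -⟩ := h
  exact (List.getElem?_eq_some_iff.1 he).1.trans_le hN

theorem NoCollision.not_prediction (h : NoCollision ω t) (hc : Consistent ω t)
    (hN : t.queries.length ≤ N) : ¬ t.Prediction := by
  rintro ⟨i, B, B', k, k', hk, hk', hle, hpar⟩
  have hkN := hk.lt hN
  refine (h ⟨k, hkN⟩).1 ?_
  have := createdAt_hash hc hk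
  rw [draw_of_lt ω ⟨k, hkN⟩] at this
  rw [← this]
  obtain ⟨⟨e, he, rfl⟩, -⟩ := hk'
  refine mem_union_right _ (mem_biUnion.2 ⟨k', mem_range.2 (Nat.lt_succ_iff.2 hle), ?_⟩)
  simp only [Trace.request, he, Option.map_some, Option.elim_some]
  exact mem_biUnion.2 ⟨i, mem_univ _, by simp [hpar]⟩

theorem NoCollision.not_copy (h : NoCollision ω t) (hc : Consistent ω t)
    (hN : t.queries.length ≤ N) : ¬ t.Copy := by
  have key : ∀ {k k' B B'}, t.CreatedAt k B → t.CreatedAt k' B' → k < k' → B.hash ≠ B'.hash := by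
    intro k k' B B' hk hk' hlt heq
    have hkN := hk'.lt hN
    refine (h ⟨k', hkN⟩).1 ?_
    have := createdAt_hash hc hk'
    rw [draw_of_lt ω ⟨k', hkN⟩] at this
    rw [← this, ← heq]
    obtain ⟨⟨e, he, rfl⟩, -⟩ := hk
    exact mem_union_left _ (mem_biUnion.2 ⟨k, mem_range.2 hlt, by simp [he]⟩)
  refine not_copy_of_hash_injOn fun B hB B' hB' heq => ?_
  obtain ⟨k, hk⟩ := exists_createdAt hc hB
  obtain ⟨k', hk'⟩ := exists_createdAt hc hB'
  rcases lt_trichotomy k k' with hlt | rfl | hlt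
  · exact absurd heq (key hk hk' hlt)
  · obtain ⟨⟨e, he, rfl⟩, -⟩ := hk
    obtain ⟨⟨e', he', rfl⟩, -⟩ := hk'
    rw [he] at he'
    rw [Option.some.inj he']
  · exact absurd heq.symm (key hk' hk hlt)

/-- Without collisions, the queries of honest parties are new. -/
theorem NoCollision.hash_of_honest (h : NoCollision ω t) (hc : Consistent ω t)
    (hN : t.queries.length ≤ N) {k : ℕ} {e : Query S} (he : t.queries[k]? = some e)
    (hm : e.miner.isSome) : e.block.hash = (draw ω k).2 := by
  have hkN : k < N := (List.getElem?_eq_some_iff.1 he).1.trans_le hN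
  refine hc.hash_of_new he (isNew_iff.2 fun j hj e' he' heq => (h ⟨k, hkN⟩).2 ?_)
  obtain ⟨party, hp⟩ := Option.isSome_iff_exists.1 hm
  obtain ⟨a, -, ha⟩ := hc.header_of_honest he hp
  have hnonce : (ω ⟨k, hkN⟩).1 = e'.block.header.nonce := by
    rw [heq, ha, ← draw_of_lt ω ⟨k, hkN⟩]
    rfl
  rw [hnonce]
  exact mem_biUnion.2 ⟨j, mem_range.2 hj, by simp [he']⟩

end NoCollision

/-! ### Difficulty created by the adversary -/

theorem p_pos (S : Setup) : 0 < S.p := by unfold Setup.p; positivity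

theorem bern_mul (e : ℝ) (he : 0 < e) : bern e * (1 / e + 1 / 3) = 1 := by
  unfold bern
  field_simp

theorem isAdv_reply (Z : Strategy S coins) (R : ℕ) (ρ : coins) (ω : Tape S N) (k : Fin N)
    (y : Fin (2 ^ S.κ)) {j : ℕ} (hj : j ≤ k) :
    (run Z R ρ (reply ω k y)).IsAdv j ↔ (run Z R ρ ω).IsAdv j := by
  rw [isAdv_iff, isAdv_iff, request_reply Z R ρ ω k y hj]

theorem targetAt_reply (Z : Strategy S coins) (R : ℕ) (ρ : coins) (ω : Tape S N) (k : Fin N)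
    (y : Fin (2 ^ S.κ)) {j : ℕ} (hj : j ≤ k) :
    (run Z R ρ (reply ω k y)).targetAt j = (run Z R ρ ω).targetAt j := by
  rw [targetAt_eq, targetAt_eq, request_reply Z R ρ ω k y hj]

theorem Trace.IsAdv.lt {t : Trace S} {k : ℕ} (h : t.IsAdv k) : k < t.queries.length := by
  obtain ⟨e, he, -⟩ := h
  exact (List.getElem?_eq_some_iff.1 he).1

theorem Trace.IsAdv.targetAt_pos {t : Trace S} {k : ℕ} (h : t.IsAdv k) : 0 < t.targetAt k := by
  obtain ⟨e, he, -⟩ := h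
  simp only [Trace.targetAt, he, Option.elim_some]
  exact_mod_cast e.block.header.target.pos

theorem mem_advQueries {t : Trace S} {a b k : ℕ} :
    k ∈ t.advQueries a b ↔ (a ≤ k ∧ k ≤ b) ∧ t.IsAdv k := by
  simp [Trace.advQueries]

theorem advQueries_min {t : Trace S} (hN : t.queries.length ≤ N) (a b : ℕ) :
    t.advQueries a b = t.advQueries a (min b (N - 1)) := by
  ext k
  rw [mem_advQueries, mem_advQueries]
  refine and_congr_left fun h => and_congr_right fun _ => ?_
  have := h.lt
  omega

theorem targetAt_nonneg (t : Trace S) (k : ℕ) : 0 ≤ t.targetAt k := by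
  unfold Trace.targetAt
  cases t.queries[k]? <;> simp

theorem targetAt_mul_gain_le (t : Trace S) (i : Fin (S.m + 1)) (k : ℕ) (y : Fin (2 ^ S.κ)) :
    t.targetAt k * t.gain i k y ≤ 1 := by
  unfold Trace.targetAt Trace.gain
  cases t.queries[k]? with
  | none => simp
  | some e =>
    simp only [Option.elim_some]
    split_ifs
    · unfold Header.diff
      rw [mul_one_div_cancel]
      exact_mod_cast e.block.header.target.ne_zero
    · simp

open Classical in
theorem pivotA_eq {ω : Tape S N} {t : Trace S} (hc : Consistent ω t) (T : ℝ) {a b : ℕ}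
    (hb : b < N) : t.pivotA T (t.advQueries a b) = ∑ k ∈ range N,
      if (a ≤ k ∧ k ≤ b) ∧ t.IsAdv k ∧ T ≤ t.targetAt k then t.gain 0 k (draw ω k).2 else 0 := by
  unfold Trace.pivotA
  rw [← sum_filter]
  refine sum_congr ?_ fun k _ => created_eq hc 0 k
  ext k
  simp only [mem_filter, mem_advQueries, mem_range]
  constructor
  · rintro ⟨⟨h1, h2⟩, h3⟩
    exact ⟨by omega, h1, h2, h3⟩
  · rintro ⟨-, h1, h2, h3⟩
    exact ⟨⟨h1, h2⟩, h3⟩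

open Classical in
theorem card_advQueries_eq (t : Trace S) {a b : ℕ} (hb : b < N) :
    ((t.advQueries a b).card : ℝ)
      = ∑ k ∈ range N, if (a ≤ k ∧ k ≤ b) ∧ t.IsAdv k then 1 else 0 := by
  rw [← sum_filter, sum_const, nsmul_eq_mul, mul_one]
  congr 2
  ext k
  simp only [mem_filter, mem_advQueries, mem_range]
  constructor
  · exact fun h => ⟨by omega, h⟩
  · exact fun h => h.2

/-- Only targets of at least `T(J) / σ` count, and `T(J)` is known before the first answer of `J`,
so `x T(J) / σ` is a legitimate constant weight. Both pivot bounds are instances, with `σ = τ` and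
`σ = 1`. -/
theorem prob_pivot_le (Z : Strategy S coins) (R : ℕ) (ρ : coins)
    (hN : ∀ ω : Tape S N, (run Z R ρ ω).queries.length ≤ N) (hε : 0 < S.ε) (hε1 : S.ε ≤ 1)
    {σ : ℝ} (hσ : 0 < σ) :
    prob {ω : Tape S N | ¬ ∀ a b : ℕ, a ≤ b → (run Z R ρ ω).IsAdv a →
      (run Z R ρ ω).pivotA ((run Z R ρ ω).targetAt a / σ) ((run Z R ρ ω).advQueries a b) <
        S.p * ((run Z R ρ ω).advQueries a b).card +
          max (S.ε * S.p * ((run Z R ρ ω).advQueries a b).card)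
            (σ * (2 * (1 / S.ε + 1 / 3) * S.lam / (run Z R ρ ω).targetAt a))}
      ≤ (N : ℝ) ^ 2 * Real.exp (-S.lam) := by
  classical
  have hx := bern_pos hε
  set x := bern S.ε with hxdef
  set e := (Real.exp x - 1) / x with he
  have he1 : e ≤ 1 + S.ε / 2 := exp_bern_le hε hε1
  let t : Tape S N → Trace S := run Z R ρ
  let X : ℕ → ℕ → Tape S N → ℕ → Fin (2 ^ S.κ) → ℝ := fun a b ω k y =>
    if (a ≤ k ∧ k ≤ b) ∧ (t ω).IsAdv k ∧ (t ω).targetAt a / σ ≤ (t ω).targetAt k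
    then (t ω).gain 0 k y else 0
  let s : ℕ → ℕ → Tape S N → ℕ → ℝ := fun a b ω k =>
    if (a ≤ k ∧ k ≤ b) ∧ (t ω).IsAdv k then 1 else 0
  let w : ℕ → Tape S N → ℕ → ℝ := fun a ω k =>
    if a ≤ k then x * ((t ω).targetAt a / σ) else 0
  have hw0 : ∀ a ω k, 0 ≤ w a ω k := by
    intro a ω k
    simp only [w]
    split_ifs
    · exact mul_nonneg hx.le (div_nonneg (targetAt_nonneg _ _) hσ.le)
    · exact le_rfl
  have hF : ∀ a b, prob {ω | S.lam ≤ ∑ k ∈ range N, w a ω k * (X a b ω k (draw ω k).2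
      - S.p * e * s a b ω k)} ≤ Real.exp (-S.lam) := by
    intro a b
    refine prob_exp_markov (sum_exp_weighted_le hx ?_ ?_ ?_ ?_ (hw0 a) ?_ ?_) S.lam
    · intro k ω y j hj
      funext y'
      simp only [X]
      by_cases haj : a ≤ j
      · simp only [t, isAdv_reply Z R ρ ω k y hj, targetAt_reply Z R ρ ω k y hj,
          targetAt_reply Z R ρ ω k y (haj.trans hj), gain_reply Z R ρ ω k y hj]
      · simp only [haj, false_and, if_false]
    · intro k ω y j hj
      simp only [w]
      by_cases haj : a ≤ j
      · simp only [t, targetAt_reply Z R ρ ω k y (haj.trans hj)]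
      · simp only [haj, if_false]
    · intro k ω y j hj
      simp only [s, t, isAdv_reply Z R ρ ω k y hj]
    · intro ω k y
      simp only [X]
      split_ifs
      · exact gain_nonneg _ _ _ _
      · exact le_rfl
    · intro ω k y
      simp only [X]
      split_ifs with h
      · simp only [w, if_pos h.1.1]
        rw [mul_assoc]
        refine mul_le_of_le_one_right hx.le ?_
        exact (mul_le_mul_of_nonneg_right h.2.2 (gain_nonneg _ _ _ _)).trans
          (targetAt_mul_gain_le _ _ _ _)
      · simpa using hx.le
    · intro ω k
      by_cases h : (a ≤ k ∧ k ≤ b) ∧ (t ω).IsAdv k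
      · simp only [s, if_pos h]
        refine le_trans (sum_le_sum fun y _ => ?_) (sum_gain_le (t ω) 0 k)
        simp only [X]
        split_ifs
        · exact le_rfl
        · exact gain_nonneg _ _ _ _
      · simp only [s, if_neg h]
        refine (sum_eq_zero fun y _ => ?_).le
        simp only [X]
        rw [if_neg fun h' => h ⟨h'.1, h'.2.1⟩]
  refine le_trans (prob_mono fun ω hω => ?_) (prob_pairs_le N _ fun a _ b _ => hF a b)
  by_contra hcon
  refine hω fun a b hab ha => ?_
  have haN : a < N := ha.lt.trans_le (hN ω)
  -- There is no restriction on `b`, but the union bound covers only ends below `N`; nothing is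
  -- asked after them.
  rw [advQueries_min (hN ω)]
  set b' := min b (N - 1) with hb'
  have hb'N : b' < N := by omega
  have hlt : ¬ S.lam ≤ ∑ k ∈ range N, w a ω k * (X a b' ω k (draw ω k).2 - S.p * e * s a b' ω k) :=
    fun h => hcon ⟨a, haN, b', hb'N, h⟩
  have hT := ha.targetAt_pos
  set T := (run Z R ρ ω).targetAt a with hTdef
  have hsum : ∑ k ∈ range N, w a ω k * (X a b' ω k (draw ω k).2 - S.p * e * s a b' ω k)
      = x * (T / σ) * ((run Z R ρ ω).pivotA (T / σ) ((run Z R ρ ω).advQueries a b')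
        - S.p * e * ((run Z R ρ ω).advQueries a b').card) := by
    rw [pivotA_eq (consistent_run Z R ρ ω) _ hb'N, card_advQueries_eq _ hb'N, mul_sum,
      ← sum_sub_distrib, mul_sum]
    refine sum_congr rfl fun k _ => ?_
    by_cases hk : a ≤ k
    · simp only [w, if_pos hk]
      rfl
    · simp only [w, if_neg hk, hk, false_and, if_false]
      ring
  rw [hsum, not_le] at hlt
  set P := (run Z R ρ ω).pivotA (T / σ) ((run Z R ρ ω).advQueries a b')
  set n : ℝ := (((run Z R ρ ω).advQueries a b').card : ℝ) with hn
  have hn0 : 0 ≤ n := by positivity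
  have hp := p_pos S
  have hxT : 0 < x * (T / σ) := by positivity
  have h1 : P - S.p * e * n < S.lam / (x * (T / σ)) := by
    rw [lt_div_iff₀ hxT]; linarith
  -- The excess is half of `ε p |J|` plus half of `σ α(J)`, which the maximum of the two dominates.
  -- This uses up the factor `2` in `α`.
  have h2 : S.lam / (x * (T / σ)) = σ * (2 * (1 / S.ε + 1 / 3) * S.lam / T) / 2 := by
    have : (1 / S.ε + 1 / 3) = 1 / x := by
      rw [eq_div_iff hx.ne', mul_comm]; exact bern_mul _ hε
    rw [this]
    field_simp
  have h3 : S.p * e * n ≤ S.p * n + S.ε * S.p * n / 2 := by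
    have := mul_le_mul_of_nonneg_right (mul_le_mul_of_nonneg_left he1 hp.le) hn0
    linarith
  have h4 := le_max_left (S.ε * S.p * n) (σ * (2 * (1 / S.ε + 1 / 3) * S.lam / T))
  have h5 := le_max_right (S.ε * S.p * n) (σ * (2 * (1 / S.ε + 1 / 3) * S.lam / T))
  rw [h2] at h1
  linarith

/-- The difficulty attainable by a query is known before its answer, and `b^i(J)` is a bound for all
of them, so the uniform deviation bound applies with `L = cλ/2`. -/
theorem prob_nonPivot_le (Z : Strategy S coins) (R : ℕ) (ρ : coins)
    (hN : ∀ ω : Tape S N, (run Z R ρ ω).queries.length ≤ N) (hε : 0 < S.ε) (hε1 : S.ε ≤ 1)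
    (hlam : 0 < S.lam) (i : Fin (S.m + 1)) {c : ℝ} (hc : 0 < c) :
    prob {ω : Tape S N | ¬ ∀ a b : ℕ, a ≤ b → (run Z R ρ ω).IsAdv a →
      (run Z R ρ ω).A i ((run Z R ρ ω).advQueries a b) <
        S.p * ((run Z R ρ ω).advQueries a b).card +
          max (S.ε * S.p * ((run Z R ρ ω).advQueries a b).card)
            (c * (run Z R ρ ω).b i ((run Z R ρ ω).advQueries a b) * S.lam * (1 / S.ε + 1 / 3))}
      ≤ (N : ℝ) ^ 2 * Real.exp (-(c * S.lam / 2)) := by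
  classical
  have hx := bern_pos hε
  set x := bern S.ε with hxdef
  have he1 : (Real.exp x - 1) / x ≤ 1 + S.ε / 2 := exp_bern_le hε hε1
  let t : Tape S N → Trace S := run Z R ρ
  let X : Tape S N → ℕ → Fin (2 ^ S.κ) → ℝ := fun ω k y =>
    if (t ω).IsAdv k then (t ω).gain i k y else 0
  let s : Tape S N → ℕ → ℝ := fun ω k => if (t ω).IsAdv k then 1 else 0
  let cap : Tape S N → ℕ → ℝ := fun ω k => ⨆ y, X ω k y
  have hXpred : Predictable X := by
    intro k ω y j hj
    funext y'
    simp only [X, t, isAdv_reply Z R ρ ω k y hj, gain_reply Z R ρ ω k y hj]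
  have hdev := prob_interval_deviation_le (L := c * S.lam / 2) (c := cap) (s := s) hx (by positivity)
    hXpred ?_ ?_ ?_ ?_ ?_ ?_
  · refine le_trans (prob_mono ?_) hdev
    intro ω hω h
    refine hω fun a b hab ha => ?_
    have haN : a < N := ha.lt.trans_le (hN ω)
    rw [advQueries_min (hN ω)]
    set b' := min b (N - 1) with hb'
    have hb'N : b' < N := by omega
    change (t ω).IsAdv a at ha
    change (t ω).A i ((t ω).advQueries a b') < S.p * ((t ω).advQueries a b').card +
      max (S.ε * S.p * ((t ω).advQueries a b').card)
        (c * (t ω).b i ((t ω).advQueries a b') * S.lam * (1 / S.ε + 1 / 3))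
    have hp := p_pos S
    have hbdd : BddAbove (Set.range fun z : (t ω).advQueries a b' × Fin (2 ^ S.κ) =>
      (t ω).gain i z.1 z.2) := (Set.finite_range _).bddAbove
    have haJ : a ∈ (t ω).advQueries a b' := mem_advQueries.2 ⟨by omega, ha⟩
    have hle : ∀ k ∈ (t ω).advQueries a b', ∀ y,
        (t ω).gain i k y ≤ (t ω).b i ((t ω).advQueries a b') := fun k hk y =>
      le_ciSup hbdd ⟨⟨k, hk⟩, y⟩
    have hcard : (1 : ℝ) ≤ ((t ω).advQueries a b').card := by
      exact_mod_cast card_pos.2 ⟨a, haJ⟩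
    have hA : (t ω).A i ((t ω).advQueries a b')
        = ∑ k ∈ Ico a (b' + 1), X ω k (draw ω k).2 := by
      simp only [X]
      rw [← sum_filter]
      refine sum_congr ?_ fun k _ => created_eq (consistent_run Z R ρ ω) i k
      ext k
      simp [mem_advQueries]
    have hs : (((t ω).advQueries a b').card : ℝ) = ∑ k ∈ Ico a (b' + 1), s ω k := by
      simp only [s]
      rw [← sum_filter, sum_const, nsmul_eq_mul, mul_one]
      congr 2
    set n : ℝ := (((t ω).advQueries a b').card : ℝ)
    set B := (t ω).b i ((t ω).advQueries a b') with hB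
    have hB0 : 0 ≤ B := (gain_nonneg _ _ _ _).trans (hle a haJ ⟨0, Nat.two_pow_pos _⟩)
    -- If no query of `J` can contribute, strictness comes from `p |J| > 0`, as `J` contains `a`.
    rcases hB0.eq_or_lt with hB0 | hB0
    · have hA0 : (t ω).A i ((t ω).advQueries a b') ≤ 0 := by
        refine sum_nonpos fun k hk => ?_
        rw [created_eq (consistent_run Z R ρ ω)]
        exact (hle k hk _).trans hB0.ge
      refine hA0.trans_lt (add_pos_of_pos_of_nonneg (by positivity) (le_max_of_le_left ?_))
      positivity
    · have h1 := h a b' B hb'N hB0 fun k h₁ h₂ => ?_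
      · rw [sum_sub_distrib, ← mul_sum, ← hs, ← hA] at h1
        have h2 : c * S.lam / 2 / x * B = c * B * S.lam * (1 / S.ε + 1 / 3) / 2 := by
          have : (1 / S.ε + 1 / 3) = 1 / x := by
            rw [eq_div_iff hx.ne', mul_comm]; exact bern_mul _ hε
          rw [this]
          ring
        have h3 := mul_le_mul_of_nonneg_right (mul_le_mul_of_nonneg_left he1 hp.le)
          (zero_le_one.trans hcard)
        have h4 := le_max_left (S.ε * S.p * n) (c * B * S.lam * (1 / S.ε + 1 / 3))
        have h5 := le_max_right (S.ε * S.p * n) (c * B * S.lam * (1 / S.ε + 1 / 3))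
        rw [h2] at h1
        linarith
      · refine ciSup_le fun y => ?_
        simp only [X]
        split_ifs with hk
        · exact hle k (mem_advQueries.2 ⟨⟨h₁, h₂⟩, hk⟩) y
        · exact hB0.le
  · intro k ω y j hj
    simp only [cap, hXpred k ω y j hj]
  · intro k ω y j hj
    simp only [s, t, isAdv_reply Z R ρ ω k y hj]
  · intro ω k y
    simp only [X]
    split_ifs
    · exact gain_nonneg _ _ _ _
    · exact le_rfl
  · intro ω k y
    exact le_ciSup (Set.finite_range (X ω k)).bddAbove y
  · intro ω k
    simp only [X, s]
    split_ifs
    · exact sum_gain_le _ _ _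
    · simp
  · intro ω k
    simp only [s]
    split_ifs <;> simp

/-! ### Difficulty computed by honest parties -/

open Classical in
/-- The difficulty that an honest `k`-th query contributes to the tree `i` if its answer is `y`. -/
noncomputable def Trace.honestGain (t : Trace S) (i : Fin (S.m + 1)) (k : ℕ) (y : Fin (2 ^ S.κ)) :
    ℝ :=
  (t.request k).elim 0 fun x =>
    if x.2.1.isSome ∧ OnTree i x.2.2.target y then x.2.2.diff else 0

/-- The difficulty of the header of an honest `k`-th query. -/
noncomputable def Trace.honestCap (t : Trace S) (k : ℕ) : ℝ :=
  (t.request k).elim 0 fun x => if x.2.1.isSome then x.2.2.diff else 0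

/-- Whether the `k`-th query is asked by an honest party. -/
def Trace.honestInd (t : Trace S) (k : ℕ) : ℝ :=
  (t.request k).elim 0 fun x => if x.2.1.isSome then 1 else 0

/-- The round of the `k`-th query. -/
def Trace.roundAt (t : Trace S) (k : ℕ) : ℕ := (t.request k).elim 0 fun x => x.1

theorem honestGain_nonneg (t : Trace S) (i : Fin (S.m + 1)) (k : ℕ) (y : Fin (2 ^ S.κ)) :
    0 ≤ t.honestGain i k y := by
  unfold Trace.honestGain
  cases t.request k with
  | none => simp
  | some x =>
    simp only [Option.elim_some]
    split_ifs
    · exact x.2.2.diff_pos.le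
    · exact le_rfl

theorem honestInd_nonneg (t : Trace S) (k : ℕ) : 0 ≤ t.honestInd k := by
  unfold Trace.honestInd
  cases t.request k with
  | none => simp
  | some x =>
    simp only [Option.elim_some]
    split_ifs <;> simp

theorem honestGain_le_honestCap (t : Trace S) (i : Fin (S.m + 1)) (k : ℕ) (y : Fin (2 ^ S.κ)) :
    t.honestGain i k y ≤ t.honestCap k := by
  unfold Trace.honestGain Trace.honestCap
  cases t.request k with
  | none => simp
  | some x =>
    simp only [Option.elim_some]
    split_ifs with h1 h2 h2
    · exact le_rfl
    · exact absurd h1.1 h2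
    · exact x.2.2.diff_pos.le
    · exact le_rfl

theorem sum_honestGain_le (t : Trace S) (i : Fin (S.m + 1)) (k : ℕ) :
    ∑ y, t.honestGain i k y ≤ t.honestInd k := by
  classical
  unfold Trace.honestGain Trace.honestInd
  cases t.request k with
  | none => simp
  | some x =>
    simp only [Option.elim_some]
    by_cases h : x.2.1.isSome = true
    · simp only [h, true_and, if_true]
      exact sum_onTree_le i x.2.2
    · simp [h]

theorem prob_honest_deviation_le (Z : Strategy S coins) (R : ℕ) (ρ : coins) (hε : 0 < S.ε)
    (hlam : 0 < S.lam) (i : Fin (S.m + 1)) :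
    prob {ω : Tape S N | ¬ ∀ a b B, b < N → 0 < B →
      (∀ k, a ≤ k → k ≤ b → (run Z R ρ ω).honestCap k ≤ B) →
      ∑ k ∈ Ico a (b + 1), ((run Z R ρ ω).honestGain i k (draw ω k).2
        - S.p * ((Real.exp (bern S.ε) - 1) / bern S.ε) * (run Z R ρ ω).honestInd k)
        < S.lam / bern S.ε * B} ≤ (N : ℝ) ^ 2 * Real.exp (-S.lam) := by
  refine prob_interval_deviation_le (X := fun ω => (run Z R ρ ω).honestGain i)
    (c := fun ω => (run Z R ρ ω).honestCap) (s := fun ω => (run Z R ρ ω).honestInd)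
    (bern_pos hε) hlam ?_ ?_ ?_ (fun _ _ _ => honestGain_nonneg _ _ _ _)
    (fun _ _ _ => honestGain_le_honestCap _ _ _ _) (fun _ _ => sum_honestGain_le _ _ _)
    (fun _ _ => honestInd_nonneg _ _)
  · intro k ω y j hj
    funext y'
    simp only [Trace.honestGain, request_reply Z R ρ ω k y hj]
  · intro k ω y j hj
    simp only [Trace.honestCap, request_reply Z R ρ ω k y hj]
  · intro k ω y j hj
    simp only [Trace.honestInd, request_reply Z R ρ ω k y hj]

theorem sum_map_filter_eq {α : Type*} (l : List α) (P : α → Bool) (f : α → ℝ) {N : ℕ}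
    (h : l.length ≤ N) : ((l.filter P).map f).sum
      = ∑ k ∈ range N, (l[k]?).elim 0 fun e => if P e then f e else 0 := by
  induction l generalizing N with
  | nil => simp
  | cons a l ih =>
    cases N with
    | zero => simp at h
    | succ N =>
      rw [sum_range_succ']
      simp only [List.getElem?_cons_succ, List.getElem?_cons_zero, Option.elim_some]
      rw [← ih (by simpa using h), List.filter_cons]
      split_ifs with hP
      · rw [List.map_cons, List.sum_cons, add_comm]
      · rw [add_zero]

theorem honestCount_eq (t : Trace S) (hN : t.queries.length ≤ N) (r : ℕ) :
    (honestCount t r : ℝ)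
      = ∑ k ∈ range N, if t.roundAt k = r then t.honestInd k else 0 := by
  have h := sum_map_filter_eq t.queries (fun e => decide (e.round = r ∧ e.miner.isSome = true))
    (fun _ => 1) hN
  have h2 : (honestCount t r : ℝ) = _ := Eq.trans ?_ h
  · rw [h2]
    refine sum_congr rfl fun k _ => ?_
    unfold Trace.roundAt Trace.honestInd Trace.request
    cases t.queries[k]? with
    | none => exact (ite_self _).symm
    | some e =>
      simp only [Option.elim_some, Option.map_some, decide_eq_true_eq]
      by_cases h1 : e.round = r <;> by_cases h2 : e.miner.isSome = true <;> simp [h1, h2]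
  · unfold honestCount
    rw [List.countP_eq_length_filter]
    simp

/-- A repeated honest header would receive an old answer instead of the fresh entry of the tape; the
absence of nonce collisions excludes this. -/
theorem D_eq {ω : Tape S N} {t : Trace S} (hc : Consistent ω t) (hnc : NoCollision ω t)
    (hN : t.queries.length ≤ N) (i : Fin (S.m + 1)) (r : ℕ) :
    t.D i r = ∑ k ∈ range N, if t.roundAt k = r then t.honestGain i k (draw ω k).2 else 0 := by
  classical
  unfold Trace.D Trace.honestDiffs
  rw [sum_map_filter_eq _ _ _ hN]
  refine sum_congr rfl fun k _ => ?_
  unfold Trace.roundAt Trace.honestGain Trace.request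
  cases he : t.queries[k]? with
  | none => exact (ite_self _).symm
  | some e =>
    simp only [Option.elim_some, Option.map_some, decide_eq_true_eq]
    by_cases h1 : e.round = r
    · by_cases h2 : e.miner.isSome = true
      · rw [hnc.hash_of_honest hc hN he h2]
        simp [h1, h2]
      · simp [h2]
    · simp [h1]

/-- The queries of consecutive rounds are consecutive. -/
theorem exists_first_query {ω : Tape S N} {t : Trace S} (hc : Consistent ω t) (u : ℕ) :
    ∃ a ≤ t.queries.length, ∀ k < t.queries.length, (k < a ↔ t.roundAt k < u) := by
  have hex : ∃ a : ℕ, ∀ e : Query S, t.queries[a]? = some e → u ≤ e.round :=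
    ⟨t.queries.length, fun e he => by simp at he⟩
  classical
  refine ⟨Nat.find hex, Nat.find_min' hex fun e he => by simp at he, fun k hk => ?_⟩
  obtain ⟨e, he⟩ : ∃ e, t.queries[k]? = some e := ⟨_, List.getElem?_eq_getElem hk⟩
  have hr : t.roundAt k = e.round := by simp [Trace.roundAt, Trace.request, he]
  rw [hr]
  constructor
  · intro hlt
    have := Nat.find_min hex hlt
    push Not at this
    obtain ⟨e', he', h⟩ := this
    rw [he] at he'
    rwa [Option.some.inj he']
  · intro hlt
    by_contra! hle
    have hlen : Nat.find hex < t.queries.length := hle.trans_lt hk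
    have h1 := Nat.find_spec hex _ (List.getElem?_eq_getElem hlen)
    have h2 := hc.round_mono hle (List.getElem?_eq_getElem hlen) he
    omega

theorem request_eq_none {t : Trace S} {k : ℕ} (h : t.queries.length ≤ k) : t.request k = none := by
  simp [Trace.request, h]

theorem sum_rounds_eq {t : Trace S} {a b u v : ℕ}
    (ha : ∀ k < t.queries.length, (k < a ↔ t.roundAt k < u))
    (hb : ∀ k < t.queries.length, (k < b ↔ t.roundAt k < v + 1)) (hbN : b ≤ N) (F : ℕ → ℝ)
    (hF : ∀ k, t.request k = none → F k = 0) :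
    ∑ r ∈ Icc u v, ∑ k ∈ range N, (if t.roundAt k = r then F k else 0) = ∑ k ∈ Ico a b, F k := by
  have hsub : Ico a b ⊆ range N := fun k hk => mem_range.2 ((mem_Ico.1 hk).2.trans_le hbN)
  rw [sum_comm]
  refine Eq.trans ?_ (sum_subset hsub (f := fun k => if k ∈ Ico a b then F k else 0)
    fun k _ hk => if_neg hk).symm |>.trans (sum_congr rfl fun k hk => if_pos hk)
  refine sum_congr rfl fun k _ => ?_
  rw [sum_ite_eq]
  by_cases hk : k < t.queries.length
  · have h1 := ha k hk
    have h2 := hb k hk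
    refine if_congr ?_ rfl rfl
    rw [mem_Icc, mem_Ico]
    omega
  · simp [hF k (request_eq_none (not_lt.1 hk))]

/-! ### Consequences of the rules of the model -/

section Legal

variable {ω : Tape S N} {t : Trace S}

theorem Trace.Legal.n_pos (hl : t.Legal N) {r : ℕ} (hr : r < t.plans.length) :
    1 ≤ t.n r := by
  have h := hl.majority r hr
  have h0 : (0 : ℝ) ≤ t.corrupted r := by positivity
  by_contra! hn
  have : t.n r = 0 := by omega
  rw [this] at h
  simp at h
  linarith

theorem Trace.Legal.honest_chain (hl : t.Legal N) (hc : Consistent ω t) {k : ℕ} {e : Query S}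
    (he : t.queries[k]? = some e) (hm : e.miner.isSome) :
    ∃ C ∈ t.adoptable e.round, e.block.header.target = nextTarget C := by
  obtain ⟨party, hp⟩ := Option.isSome_iff_exists.1 hm
  obtain ⟨a, ha, hx⟩ := hc.header_of_honest he hp
  have hh := hl.honest e.round (hc.round_lt he)
  have hv := hh.chain_valid a ha 0
  refine ⟨a.chain 0, ⟨?_, hv.2, a, ha, le_rfl⟩, by rw [hx]; rfl⟩
  have : PivotChain a.view (a.chain 0) := by simpa [ValidChain] using hv.1
  exact this.mono (hh.view_exists a ha)

theorem Trace.Legal.honest_target_le (hl : t.Legal N) (hc : Consistent ω t)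
    (hT₀ : (S.m + 1) * (S.T₀ : ℕ) ≤ 2 ^ S.κ) {k : ℕ} {e : Query S} (he : t.queries[k]? = some e)
    (hm : e.miner.isSome) : (S.m + 1) * (e.block.header.target : ℕ) ≤ 2 ^ S.κ := by
  obtain ⟨C, hC, hx⟩ := hl.honest_chain hc he hm
  rw [hx]
  exact nextTarget_le hT₀ hC.1

theorem Trace.Legal.honest_target_good (hl : t.Legal N) (hc : Consistent ω t) {k : ℕ} {e : Query S}
    (he : t.queries[k]? = some e) (hm : e.miner.isSome) (hg : t.Good e.round) :
    S.f / (2 * S.γ ^ 2) ≤ S.p * t.n e.round * ((e.block.header.target : ℕ) : ℝ) ∧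
      S.p * t.n e.round * ((e.block.header.target : ℕ) : ℝ) ≤ (1 + S.δ) * S.γ ^ 2 * S.f := by
  obtain ⟨C, hC, hx⟩ := hl.honest_chain hc he hm
  rw [hx]
  exact hg C hC

/-- The lower half of goodness bounds the target from below. This supplies the maximal step size for
honest concentration. -/
theorem Trace.Legal.honest_diff_le (hl : t.Legal N) (hc : Consistent ω t) (hf : 0 < S.f)
    (hγ : 1 ≤ S.γ) {k : ℕ} {e : Query S} (he : t.queries[k]? = some e) (hm : e.miner.isSome)
    (hg : t.Good e.round) :
    e.block.header.diff ≤ 2 * S.γ ^ 2 * S.p / S.f * t.n e.round := by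
  have h := (hl.honest_target_good hc he hm hg).1
  have hT : (0 : ℝ) < (e.block.header.target : ℕ) := by exact_mod_cast e.block.header.target.pos
  have hγ' : 0 < S.γ := by linarith
  unfold Header.diff
  rw [div_le_iff₀ (by positivity)] at h
  rw [div_le_iff₀ hT, div_mul_eq_mul_div, div_mul_eq_mul_div, le_div_iff₀ hf]
  linarith

end Legal

/-! ### Bounds on the parameters -/

namespace Setup.Admissible

theorem ε_le_one (h : S.Admissible) : S.ε ≤ 1 / 8 := by linarith [h.ε_le, h.δ_lt]

theorem q_lt_one (h : S.Admissible) : S.q < 1 := by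
  have := h.f_pos
  have := h.γ_ge
  have := h.δ_pos
  unfold Setup.q
  have : 0 < (1 + S.δ) * S.γ ^ 2 * S.f := by positivity
  linarith

theorem f_lt_one (h : S.Admissible) : S.f < 1 := by
  have h1 := h.q_pos
  unfold Setup.q at h1
  have hf := h.f_pos
  have : 1 ≤ (1 + S.δ) * S.γ ^ 2 :=
    one_le_mul_of_one_le_of_one_le (by linarith [h.δ_pos]) (one_le_pow₀ h.γ_ge)
  nlinarith

theorem ell_mul_ge (h : S.Admissible) : 4 * (1 + 3 * S.ε) * max (S.Δ : ℝ) S.τ * S.γ ^ 3 * S.lam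
    ≤ S.ell * (S.ε ^ 2 * S.f * S.q ^ (S.Δ + 1)) := by
  have := h.f_pos
  have := h.ε_pos
  have := h.q_pos
  have h1 := h.ell_ge
  have h0 : 0 < S.ε ^ 2 * S.f * S.q ^ (S.Δ + 1) := by positivity
  rw [div_mul_eq_mul_div, div_mul_eq_mul_div, div_mul_eq_mul_div, div_le_iff₀ h0] at h1
  exact h1

theorem ell_pos (h : S.Admissible) : 0 < S.ell := by
  have := h.f_pos
  have := h.ε_pos
  have := h.q_pos
  have := h.lam_pos
  have h2 := h.γ_ge
  have h3 : (0 : ℝ) < max (S.Δ : ℝ) S.τ := lt_max_of_lt_right (by linarith [h.τ_ge])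
  have h1 := h.ell_mul_ge
  have h0 : 0 < S.ε ^ 2 * S.f * S.q ^ (S.Δ + 1) := by positivity
  by_contra! hneg
  have h4 : 0 < 4 * (1 + 3 * S.ε) * max (S.Δ : ℝ) S.τ * S.γ ^ 3 * S.lam := by positivity
  nlinarith

/-- Pieces with fewer than `2 ⌈ell⌉` rounds thus lie in the range where the respecting condition
applies. -/
theorem two_ell_le_s (h : S.Admissible) : 2 * S.ell + 6 ≤ S.s := by
  have hf := h.f_pos
  have hγ := h.γ_ge
  have hδ := h.δ_pos
  have hΔ : (1 : ℝ) ≤ S.Δ := by exact_mod_cast h.Δ_pos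
  have hΦ : (0 : ℝ) ≤ S.Φ := by positivity
  have h1 := h.ell_le
  have h2 : 1 ≤ (1 + S.δ) * S.γ ^ 2 :=
    one_le_mul_of_one_le_of_one_le (by linarith) (one_le_pow₀ hγ)
  have h3 : S.ε * S.Φ / (2 * (1 + S.δ) * S.γ ^ 2 * S.f) ≤ S.s := by
    unfold Setup.s
    rw [div_le_div_iff₀ (by positivity) hf]
    have h4 : S.ε ≤ 2 * (1 + S.δ) * S.γ ^ 2 * (2 * (1 + S.δ) * S.γ ^ 2) := by
      have := h.ε_le_one
      nlinarith
    calc S.ε * S.Φ * S.f = S.ε * (S.Φ * S.f) := by ring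
      _ ≤ 2 * (1 + S.δ) * S.γ ^ 2 * (2 * (1 + S.δ) * S.γ ^ 2) * (S.Φ * S.f) := by gcongr
      _ = 2 * (1 + S.δ) * S.γ ^ 2 * S.Φ * (2 * (1 + S.δ) * S.γ ^ 2 * S.f) := by ring
  linarith

end Setup.Admissible

/-! ### Splitting long intervals -/

theorem sum_pos_of_pieces {F : ℕ → ℝ} {L U V : ℕ} (hL : 0 < L)
    (h : ∀ u v, U ≤ u → v ≤ V → u + L ≤ v → v < u + 2 * L → 0 < ∑ r ∈ Ico u v, F r) :
    ∀ u v, U ≤ u → v ≤ V → u + L ≤ v → 0 < ∑ r ∈ Ico u v, F r := by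
  intro u v
  induction hd : v - u using Nat.strong_induction_on generalizing u with
  | _ d ih =>
    intro hu hv huv
    by_cases hlt : v < u + 2 * L
    · exact h u v hu hv huv hlt
    · rw [← sum_Ico_consecutive F (show u ≤ u + L by omega) huv]
      exact add_pos (h u (u + L) hu (by omega) le_rfl (by omega))
        (ih (v - (u + L)) (by omega) (u + L) rfl (by omega) hv (by omega))

/-! ### The upper bound for the difficulty computed by honest parties -/

section Legal

variable {ω : Tape S N} {t : Trace S}

theorem Trace.Legal.exists_max_n (hl : t.Legal N) {u w : ℕ} (huw : u < w)
    (hw : w ≤ t.plans.length) (hs : ((w - u : ℕ) : ℝ) ≤ S.s) :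
    ∃ M : ℝ, 0 < M ∧ ∀ r ∈ Ico u w, (t.n r : ℝ) ≤ M ∧ M ≤ S.γ * t.n r := by
  obtain ⟨r₀, hr₀, hmax⟩ := exists_max_image (Ico u w) t.n ⟨u, by simpa using huw⟩
  have hr₀' := mem_Ico.1 hr₀
  refine ⟨t.n r₀, ?_, fun r hr => ⟨by exact_mod_cast hmax r hr, ?_⟩⟩
  · exact_mod_cast hl.n_pos (hr₀'.2.trans_le hw)
  · have hr' := mem_Ico.1 hr
    refine hl.respecting u (w - 1) (by omega) (by omega) ?_ r₀ (mem_Icc.2 (by omega)) r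
      (mem_Icc.2 (by omega))
    rwa [show w - 1 - u + 1 = w - u by omega]

/-- The sum of the `n r` in an interval in comparison with their maximum. -/
theorem length_mul_le_sum_n {u w : ℕ} {M : ℝ}
    (hM : ∀ r ∈ Ico u w, (t.n r : ℝ) ≤ M ∧ M ≤ S.γ * t.n r) :
    ((w - u : ℕ) : ℝ) * M ≤ S.γ * ∑ r ∈ Ico u w, (t.n r : ℝ) := by
  rw [mul_sum]
  refine le_trans (le_of_eq ?_) (sum_le_sum fun r hr => (hM r hr).2)
  simp

/-- Rounds correspond to blocks of consecutive queries, so the deviation bound applies with the cap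
`β M`, where `M` bounds all `n_r` of the interval. Half of the slack `ε p n(S)` pays for `(e^x -
1)/x > 1`, the other half for the term with `λ`. -/
theorem Trace.Legal.honest_upper (hl : t.Legal N) (hA : S.Admissible) (hc : Consistent ω t)
    (hnc : NoCollision ω t) (hn : ∀ r, honestCount t r = t.n r) {i : Fin (S.m + 1)}
    (hdev : ∀ a b B, b < N → 0 < B → (∀ k, a ≤ k → k ≤ b → t.honestCap k ≤ B) →
      ∑ k ∈ Ico a (b + 1), (t.honestGain i k (draw ω k).2
        - S.p * ((Real.exp (bern S.ε) - 1) / bern S.ε) * t.honestInd k) < S.lam / bern S.ε * B)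
    {u w : ℕ} (huw : u < w) (hw : w ≤ t.plans.length) (hs : ((w - u : ℕ) : ℝ) ≤ S.s)
    (hell : S.ell ≤ ((w - u : ℕ) : ℝ)) (hg : ∀ r ∈ Ico u w, t.Good r) :
    ∑ r ∈ Ico u w, t.D i r < (1 + S.ε) * S.p * ∑ r ∈ Ico u w, (t.n r : ℝ) := by
  have hN := hl.total
  have hε := hA.ε_pos
  have hε1 := hA.ε_le_one
  have hf := hA.f_pos
  have hγ := hA.γ_ge
  have hlam := hA.lam_pos
  have hp := p_pos S
  have hx := bern_pos hε
  obtain ⟨M, hM0, hM⟩ := hl.exists_max_n huw hw hs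
  have hMsum := length_mul_le_sum_n hM
  obtain ⟨v, rfl⟩ : ∃ v, w = v + 1 := ⟨w - 1, by omega⟩
  have hIco : Ico u (v + 1) = Icc u v := by
    ext r
    rw [mem_Ico, mem_Icc, Nat.lt_succ_iff]
  rw [hIco] at hg hM hMsum ⊢
  obtain ⟨a, -, ha⟩ := exists_first_query hc u
  obtain ⟨b, hbN, hb⟩ := exists_first_query hc (v + 1)
  have hD : ∑ r ∈ Icc u v, t.D i r = ∑ k ∈ Ico a b, t.honestGain i k (draw ω k).2 := by
    rw [← sum_rounds_eq ha hb (hbN.trans hN) (fun k => t.honestGain i k (draw ω k).2)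
      (fun k hk => by simp [Trace.honestGain, hk])]
    exact sum_congr rfl fun r _ => D_eq hc hnc hN i r
  have hn' : ∑ r ∈ Icc u v, (t.n r : ℝ) = ∑ k ∈ Ico a b, t.honestInd k := by
    rw [← sum_rounds_eq ha hb (hbN.trans hN) t.honestInd
      (fun k hk => by simp [Trace.honestInd, hk])]
    exact sum_congr rfl fun r _ => by rw [← hn, honestCount_eq t hN]
  have hsum0 : 0 < ∑ r ∈ Icc u v, (t.n r : ℝ) :=
    sum_pos (fun r hr => by
      have := hl.n_pos (r := r) (by have := (mem_Icc.1 hr).2; omega)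
      exact_mod_cast this) ⟨u, mem_Icc.2 (by omega)⟩
  have hab : a < b := by
    by_contra! hle
    rw [hn', Ico_eq_empty (by omega), sum_empty] at hsum0
    exact lt_irrefl _ hsum0
  obtain ⟨b', rfl⟩ : ∃ b', b = b' + 1 := ⟨b - 1, by omega⟩
  set B := 2 * S.γ ^ 2 * S.p / S.f * M with hB
  have hγ0 : 0 < S.γ := by linarith
  have hB0 : 0 < B := by positivity
  have h1 := hdev a b' B (by omega) hB0 fun k h₁ h₂ => ?_
  · rw [sum_sub_distrib, ← mul_sum, ← hD, ← hn'] at h1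
    set D := ∑ r ∈ Icc u v, t.D i r
    set n := ∑ r ∈ Icc u v, (t.n r : ℝ)
    have he : (Real.exp (bern S.ε) - 1) / bern S.ε ≤ 1 + S.ε / 2 := exp_bern_le hε (by linarith)
    have h2 : S.p * ((Real.exp (bern S.ε) - 1) / bern S.ε) * n ≤ S.p * (1 + S.ε / 2) * n := by
      gcongr
    have hxinv : 1 / bern S.ε = 1 / S.ε + 1 / 3 := by
      rw [div_eq_iff hx.ne', mul_comm]; exact (bern_mul _ hε).symm
    -- One of the factors `γ³` in `ell` pays for `M ≤ γ n_r`, the other two for the `γ²` in the cap.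
    have h3 : S.lam / bern S.ε * B ≤ S.ε / 2 * S.p * n := by
      have h4 : S.ell * M ≤ S.γ * n := (mul_le_mul_of_nonneg_right hell hM0.le).trans hMsum
      have h5 : 4 * (1 + 3 * S.ε) * S.γ ^ 3 * S.lam ≤ S.ell * (S.ε ^ 2 * S.f) := by
        have h6 := hA.ell_mul_ge
        have hq1 : S.q ^ (S.Δ + 1) ≤ 1 := pow_le_one₀ hA.q_pos.le hA.q_lt_one.le
        have hΔ : (1 : ℝ) ≤ max (S.Δ : ℝ) S.τ := le_max_of_le_right hA.τ_ge
        have hell0 := hA.ell_pos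
        calc 4 * (1 + 3 * S.ε) * S.γ ^ 3 * S.lam
            = 4 * (1 + 3 * S.ε) * 1 * S.γ ^ 3 * S.lam := by ring
          _ ≤ 4 * (1 + 3 * S.ε) * max (S.Δ : ℝ) S.τ * S.γ ^ 3 * S.lam := by gcongr
          _ ≤ S.ell * (S.ε ^ 2 * S.f * S.q ^ (S.Δ + 1)) := h6
          _ ≤ S.ell * (S.ε ^ 2 * S.f * 1) := by gcongr
          _ = _ := by ring
      have h7 : 4 * (1 + 3 * S.ε) * S.γ ^ 2 * S.lam * M ≤ n * (S.ε ^ 2 * S.f) := by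
        have h8 : S.γ * (4 * (1 + 3 * S.ε) * S.γ ^ 2 * S.lam * M) ≤ S.γ * (n * (S.ε ^ 2 * S.f)) :=
          calc S.γ * (4 * (1 + 3 * S.ε) * S.γ ^ 2 * S.lam * M)
              = 4 * (1 + 3 * S.ε) * S.γ ^ 3 * S.lam * M := by ring
            _ ≤ S.ell * (S.ε ^ 2 * S.f) * M := by gcongr
            _ = S.ell * M * (S.ε ^ 2 * S.f) := by ring
            _ ≤ S.γ * n * (S.ε ^ 2 * S.f) := by gcongr
            _ = _ := by ring
        exact le_of_mul_le_mul_left h8 hγ0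
      calc S.lam / bern S.ε * B = S.lam * (1 / bern S.ε) * B := by ring
        _ = S.p / (2 * S.f * S.ε) * (4 * (1 + S.ε / 3) * S.γ ^ 2 * S.lam * M) := by
          rw [hxinv, hB]; field_simp; ring
        _ ≤ S.p / (2 * S.f * S.ε) * (4 * (1 + 3 * S.ε) * S.γ ^ 2 * S.lam * M) := by
          gcongr
          linarith
        _ ≤ S.p / (2 * S.f * S.ε) * (n * (S.ε ^ 2 * S.f)) := by gcongr
        _ = S.ε / 2 * S.p * n := by field_simp
    linarith
  · unfold Trace.honestCap
    cases he : t.queries[k]? with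
    | none => simpa [Trace.request, he] using hB0.le
    | some e =>
      simp only [Trace.request, he, Option.map_some, Option.elim_some]
      split_ifs with hm
      · have hk := (List.getElem?_eq_some_iff.1 he).1
        have hr : t.roundAt k = e.round := by simp [Trace.roundAt, Trace.request, he]
        have hk1 := ha k hk
        have hk2 := hb k hk
        have hmem : e.round ∈ Icc u v := mem_Icc.2 (by omega)
        refine (hl.honest_diff_le hc hf hγ he hm (hg _ hmem)).trans ?_
        exact mul_le_mul_of_nonneg_left (hM _ hmem).1 (by positivity)
      · exact hB0.le

end Legal

/-! ### What is decided at the beginning of a round -/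

theorem blocksBefore_eq {ω : Tape S N} {t : Trace S} (hc : Consistent ω t) {k : ℕ} {e : Query S}
    (he : t.queries[k]? = some e) {r : ℕ} (hr : r ≤ e.round) :
    t.blocksBefore r = {B | ∃ e' ∈ t.queries.take k, e'.round < r ∧ e'.block = B} := by
  ext B
  constructor
  · rintro ⟨e', he', hlt, hB⟩
    obtain ⟨j, hj⟩ := List.mem_iff_getElem?.1 he'
    refine ⟨e', mem_take_iff.2 ⟨j, ?_, hj⟩, hlt, hB⟩
    by_contra! hkj
    have := hc.round_mono hkj he hj
    omega
  · rintro ⟨e', he', h⟩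
    exact ⟨e', List.mem_of_mem_take he', h⟩

/-- The runs are synchronized at query `c`: the existence of a query in a round not before `r` means
that the plan of `r` and all blocks from before `r` are settled by then. -/
theorem active_reply (Z : Strategy S coins) (R : ℕ) (ρ : coins) (ω : Tape S N) (k : Fin N)
    (y : Fin (2 ^ S.κ)) {c r : ℕ} (hck : c ≤ k) {e : Query S}
    (he : (run Z R ρ ω).queries[c]? = some e) (hr : r ≤ e.round) :
    (run Z R ρ (reply ω k y)).active r = (run Z R ρ ω).active r ∧
      (run Z R ρ (reply ω k y)).blocksBefore r = (run Z R ρ ω).blocksBefore r := by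
  have hs : Synced (reply ω k y) ω c (run Z R ρ (reply ω k y)) (run Z R ρ ω) :=
    synced_run (fun _ hj => draw_reply_of_ne ω k y (by omega)) Z R ρ
  have h1 := consistent_run Z R ρ ω
  have h2 := consistent_run Z R ρ (reply ω k y)
  cases hs with
  | short h _ => rw [h]; exact ⟨rfl, rfl⟩
  | long e₁ e₂ he₁ he₂ htake hround _ _ hplans _ _ =>
    rw [he] at he₂
    obtain rfl := Option.some.inj he₂
    rw [blocksBefore_eq h1 he hr, blocksBefore_eq h2 he₁ (hround ▸ hr), htake]
    refine ⟨?_, rfl⟩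
    unfold Trace.active
    have := congrArg (fun l => l[r]?) hplans
    simp only [List.getElem?_take] at this
    rw [if_pos (by omega), if_pos (by omega)] at this
    rw [this]

open Classical in
/-- The number of honest parties in a good round, and `0` in other rounds. -/
noncomputable def Trace.goodN (t : Trace S) (r : ℕ) : ℝ := if t.Good r then (t.n r : ℝ) else 0

theorem goodN_nonneg (t : Trace S) (r : ℕ) : 0 ≤ t.goodN r := by
  unfold Trace.goodN
  split_ifs <;> simp

theorem round_reply (Z : Strategy S coins) (R : ℕ) (ρ : coins) (ω : Tape S N) (k : Fin N)
    (y : Fin (2 ^ S.κ)) {c r : ℕ} (hck : c ≤ k) {x : ℕ × Option ℕ × Header S}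
    (hx : (run Z R ρ ω).request c = some x) (hr : r ≤ x.1) :
    (run Z R ρ (reply ω k y)).n r = (run Z R ρ ω).n r ∧
      ((run Z R ρ (reply ω k y)).Good r ↔ (run Z R ρ ω).Good r) ∧
      (run Z R ρ (reply ω k y)).goodN r = (run Z R ρ ω).goodN r := by
  unfold Trace.request at hx
  obtain ⟨e, he, rfl⟩ := Option.map_eq_some_iff.1 hx
  obtain ⟨h1, h2⟩ := active_reply Z R ρ ω k y hck he hr
  have hn : (run Z R ρ (reply ω k y)).n r = (run Z R ρ ω).n r := by
    unfold Trace.n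
    rw [h1]
  have hg : (run Z R ρ (reply ω k y)).Good r ↔ (run Z R ρ ω).Good r := by
    unfold Trace.Good Trace.adoptable
    rw [h1, h2, hn]
  refine ⟨hn, hg, ?_⟩
  classical
  unfold Trace.goodN
  rw [hn]
  exact if_congr hg rfl rfl

/-! ### One segment of `Δ` rounds -/

/-- The `k`-th query is asked by an honest party, in a good round `u` with `r ≤ u < r + Δ`. -/
def Trace.InSegment (t : Trace S) (r k : ℕ) : Prop :=
  ∃ x, t.request k = some x ∧ x.2.1.isSome ∧ r ≤ x.1 ∧ x.1 < r + S.Δ ∧ t.Good x.1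

/-- The answer `y` to the `k`-th query gives a block of the tree `i`. -/
def Trace.Hit (t : Trace S) (i : Fin (S.m + 1)) (k : ℕ) (y : Fin (2 ^ S.κ)) : Prop :=
  ∃ x, t.request k = some x ∧ OnTree i x.2.2.target y

open Classical in
/-- `1` if there is no block of the segment among the first `k` queries, and `0` otherwise. -/
noncomputable def segNone (ω : Tape S N) (t : Trace S) (i : Fin (S.m + 1)) (r k : ℕ) : ℝ :=
  ∏ c ∈ range k, if t.InSegment r c ∧ t.Hit i c (draw ω c).2 then 0 else 1

open Classical in
/-- The difficulty of the only block of the segment among the first `k` queries, if there is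
exactly one and it belongs to the first round. -/
noncomputable def segSingle (ω : Tape S N) (t : Trace S) (i : Fin (S.m + 1)) (r : ℕ) : ℕ → ℝ
  | 0 => 0
  | k + 1 =>
    if t.InSegment r k ∧ t.Hit i k (draw ω k).2 then
      -- The factor `segNone` makes the value `0` after an earlier hit. A hit in a later round of
      -- the segment destroys what was gained.
      if t.roundAt k = r then segNone ω t i r k / t.targetAt k else 0
    else segSingle ω t i r k

open Classical in
/-- A lower bound for the probability that the first `k` queries give no block of the segment. -/
noncomputable def segProb (t : Trace S) (r k : ℕ) : ℝ :=
  ∏ c ∈ range k, if t.InSegment r c then 1 - (1 - S.q) / t.n (t.roundAt c) else 1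

open Classical in
/-- The number of queries in the first round of the segment among the first `k` queries. -/
noncomputable def segCount (t : Trace S) (r k : ℕ) : ℝ :=
  ∑ c ∈ range k, if t.InSegment r c ∧ t.roundAt c = r then 1 else 0

/-- The submartingale that connects the number of honest parties in the first round of the segment
with the difficulty of the only block of the segment. -/
noncomputable def segValue (ω : Tape S N) (t : Trace S) (i : Fin (S.m + 1)) (r k : ℕ) : ℝ :=
  (segNone ω t i r k * S.p * (t.goodN r - segCount t r k) + segSingle ω t i r k) / segProb t r k

section Reply

variable (Z : Strategy S coins) (R : ℕ) (ρ : coins) (ω : Tape S N) (k : Fin N)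
  (y : Fin (2 ^ S.κ)) (i : Fin (S.m + 1)) (r : ℕ)

theorem inSegment_reply {c : ℕ} (hc : c ≤ k) :
    (run Z R ρ (reply ω k y)).InSegment r c ↔ (run Z R ρ ω).InSegment r c := by
  unfold Trace.InSegment
  rw [request_reply Z R ρ ω k y hc]
  refine exists_congr fun x => and_congr_right fun hx => and_congr_right fun _ =>
    and_congr_right fun _ => and_congr_right fun _ => ?_
  exact (round_reply Z R ρ ω k y hc hx le_rfl).2.1

theorem hit_reply {c : ℕ} (hc : c ≤ k) (y' : Fin (2 ^ S.κ)) :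
    (run Z R ρ (reply ω k y)).Hit i c y' ↔ (run Z R ρ ω).Hit i c y' := by
  unfold Trace.Hit
  rw [request_reply Z R ρ ω k y hc]

theorem roundAt_reply {c : ℕ} (hc : c ≤ k) :
    (run Z R ρ (reply ω k y)).roundAt c = (run Z R ρ ω).roundAt c := by
  unfold Trace.roundAt
  rw [request_reply Z R ρ ω k y hc]

theorem segNone_reply {c : ℕ} (hc : c ≤ k) :
    segNone (reply ω k y) (run Z R ρ (reply ω k y)) i r c = segNone ω (run Z R ρ ω) i r c := by
  classical
  refine prod_congr rfl fun j hj => ?_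
  have hj := mem_range.1 hj
  rw [draw_reply_of_ne ω k y (by omega)]
  exact if_congr (and_congr (inSegment_reply Z R ρ ω k y r (by omega))
    (hit_reply Z R ρ ω k y i (by omega) _)) rfl rfl

theorem segSingle_reply {c : ℕ} (hc : c ≤ k) :
    segSingle (reply ω k y) (run Z R ρ (reply ω k y)) i r c = segSingle ω (run Z R ρ ω) i r c := by
  classical
  induction c with
  | zero => rfl
  | succ c ih =>
    unfold segSingle
    rw [ih (by omega), draw_reply_of_ne ω k y (by omega), segNone_reply Z R ρ ω k y i r (by omega),
      roundAt_reply Z R ρ ω k y (by omega), targetAt_reply Z R ρ ω k y (by omega)]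
    exact if_congr (and_congr (inSegment_reply Z R ρ ω k y r (by omega))
      (hit_reply Z R ρ ω k y i (by omega) _)) rfl rfl

theorem segProb_reply {c : ℕ} (hc : c ≤ (k : ℕ) + 1) :
    segProb (run Z R ρ (reply ω k y)) r c = segProb (run Z R ρ ω) r c := by
  refine prod_congr rfl fun j hj => ?_
  have hj := mem_range.1 hj
  by_cases h : (run Z R ρ ω).InSegment r j
  · rw [if_pos h, if_pos ((inSegment_reply Z R ρ ω k y r (by omega)).2 h),
      roundAt_reply Z R ρ ω k y (by omega)]
    obtain ⟨x, hx, -⟩ := h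
    have hr : (run Z R ρ ω).roundAt j = x.1 := by simp [Trace.roundAt, hx]
    rw [hr, (round_reply Z R ρ ω k y (by omega) hx le_rfl).1]
  · rw [if_neg h, if_neg fun h' => h ((inSegment_reply Z R ρ ω k y r (by omega)).1 h')]

theorem segCount_reply {c : ℕ} (hc : c ≤ (k : ℕ) + 1) :
    segCount (run Z R ρ (reply ω k y)) r c = segCount (run Z R ρ ω) r c := by
  classical
  refine sum_congr rfl fun j hj => ?_
  have hj := mem_range.1 hj
  rw [roundAt_reply Z R ρ ω k y (by omega)]
  exact if_congr (and_congr (inSegment_reply Z R ρ ω k y r (by omega)) Iff.rfl) rfl rfl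

end Reply

section Segment

variable {ω : Tape S N} {t : Trace S} {i : Fin (S.m + 1)} {r : ℕ}

theorem segNone_nonneg (ω : Tape S N) (t : Trace S) (i : Fin (S.m + 1)) (r k : ℕ) :
    0 ≤ segNone ω t i r k :=
  prod_nonneg fun _ _ => by split_ifs <;> simp

theorem segSingle_nonneg (ω : Tape S N) (t : Trace S) (i : Fin (S.m + 1)) (r k : ℕ) :
    0 ≤ segSingle ω t i r k := by
  induction k with
  | zero => exact le_rfl
  | succ k ih =>
    unfold segSingle
    split_ifs
    · exact div_nonneg (segNone_nonneg _ _ _ _ _) (targetAt_nonneg _ _)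
    · exact le_rfl
    · exact ih

/-- If the value of `segSingle` is not `0`, then it is the difficulty of the only block. -/
theorem segSingle_eq (k : ℕ) (h : segSingle ω t i r k ≠ 0) :
    ∃ c < k, (t.InSegment r c ∧ t.Hit i c (draw ω c).2) ∧ t.roundAt c = r ∧
      segSingle ω t i r k = 1 / t.targetAt c ∧
      ∀ j < k, t.InSegment r j ∧ t.Hit i j (draw ω j).2 → j = c := by
  induction k with
  | zero => exact absurd rfl h
  | succ k ih =>
    unfold segSingle at h ⊢
    by_cases hs : t.InSegment r k ∧ t.Hit i k (draw ω k).2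
    · rw [if_pos hs] at h ⊢
      by_cases hr : t.roundAt k = r
      · rw [if_pos hr] at h ⊢
        have hnone : ∀ c < k, ¬ (t.InSegment r c ∧ t.Hit i c (draw ω c).2) := by
          intro c hc hcon
          refine h ?_
          have h0 : segNone ω t i r k = 0 := prod_eq_zero (mem_range.2 hc) (if_pos hcon)
          rw [h0, zero_div]
        have h1 : segNone ω t i r k = 1 :=
          prod_eq_one fun c hc => if_neg (hnone c (mem_range.1 hc))
        refine ⟨k, by omega, hs, hr, by rw [h1], fun j hj hjs => ?_⟩
        by_contra hne
        exact hnone j (by omega) hjs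
      · rw [if_neg hr] at h
        exact absurd rfl h
    · rw [if_neg hs] at h ⊢
      obtain ⟨c, hc, h1, h2, h3, h4⟩ := ih h
      refine ⟨c, by omega, h1, h2, h3, fun j hj hjs => ?_⟩
      rcases Nat.lt_succ_iff_lt_or_eq.1 hj with hj | rfl
      · exact h4 j hj hjs
      · exact absurd hjs hs

theorem segSingle_eq_of_le {k k' : ℕ} (hkk' : k ≤ k')
    (h : ∀ c, k ≤ c → c < k' → ¬ t.InSegment r c) :
    segSingle ω t i r k' = segSingle ω t i r k := by
  induction k', hkk' using Nat.le_induction with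
  | base => rfl
  | succ k' hk ih =>
    rw [segSingle, if_neg fun h' => h k' hk (by omega) h'.1]
    exact ih fun c h₁ h₂ => h c h₁ (by omega)

open Classical in
theorem card_honest_round (hN : t.queries.length ≤ N) (hn : ∀ r, honestCount t r = t.n r) (u : ℕ) :
    ((range N).filter fun c => t.honestInd c = 1 ∧ t.roundAt c = u).card = t.n u := by
  have h := honestCount_eq t hN u
  rw [hn] at h
  have h2 : (((range N).filter fun c => t.honestInd c = 1 ∧ t.roundAt c = u).card : ℝ) = t.n u := by
    rw [h, card_filter]
    push_cast
    refine sum_congr rfl fun k _ => ?_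
    by_cases h1 : t.roundAt k = u
    · rw [if_pos h1]
      unfold Trace.honestInd
      cases t.request k with
      | none => simp
      | some x =>
        simp only [Option.elim_some]
        by_cases h2 : x.2.1.isSome = true <;> simp [h1, h2]
    · simp [h1]
  exact_mod_cast h2

theorem inSegment_iff {k : ℕ} : t.InSegment r k ↔
    t.honestInd k = 1 ∧ r ≤ t.roundAt k ∧ t.roundAt k < r + S.Δ ∧ t.Good (t.roundAt k) := by
  unfold Trace.InSegment Trace.honestInd Trace.roundAt
  cases t.request k with
  | none => simp
  | some x => by_cases h : x.2.1.isSome = true <;> simp [h]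

open Classical in
theorem segCount_total (hN : t.queries.length ≤ N) (hn : ∀ r, honestCount t r = t.n r)
    (hΔ : 1 ≤ S.Δ) : segCount t r N = t.goodN r := by
  unfold segCount Trace.goodN
  rw [← sum_filter, sum_const, nsmul_eq_mul, mul_one]
  split_ifs with hg
  · rw [← card_honest_round hN hn r]
    congr 2
    ext c
    rw [mem_filter, mem_filter]
    refine and_congr_right fun _ => ?_
    rw [inSegment_iff]
    constructor
    · rintro ⟨⟨h1, -⟩, h2⟩
      exact ⟨h1, h2⟩
    · rintro ⟨h1, h2⟩
      rw [h2]
      exact ⟨⟨h1, le_rfl, by omega, hg⟩, rfl⟩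
  · rw [filter_eq_empty_iff.2, card_empty, Nat.cast_zero]
    intro c _ hc
    have := (inSegment_iff.1 hc.1).2.2.2
    rw [hc.2] at this
    exact hg this

theorem segCount_le (hN : t.queries.length ≤ N) (hn : ∀ r, honestCount t r = t.n r)
    (hΔ : 1 ≤ S.Δ) {k : ℕ} (hk : k ≤ N) : segCount t r k ≤ t.goodN r := by
  rw [← segCount_total hN hn hΔ]
  exact sum_le_sum_of_subset_of_nonneg (range_mono hk) fun _ _ _ => by split_ifs <;> simp

theorem Trace.InSegment.n_pos (hn : ∀ r, honestCount t r = t.n r) {k : ℕ}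
    (h : t.InSegment r k) : 1 ≤ t.n (t.roundAt k) := by
  obtain ⟨x, hx, hm, -⟩ := h
  unfold Trace.request at hx
  obtain ⟨e, he, rfl⟩ := Option.map_eq_some_iff.1 hx
  rw [← hn, Nat.one_le_iff_ne_zero, ← Nat.pos_iff_ne_zero]
  refine List.countP_pos_iff.2 ⟨e, List.mem_of_getElem? he, ?_⟩
  have : t.roundAt k = e.round := by simp [Trace.roundAt, Trace.request, he]
  simp only [this, decide_eq_true_eq, true_and]
  exact hm

theorem segFactor_pos (hA : S.Admissible) (n : ℕ) : 0 < 1 - (1 - S.q) / n := by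
  have hq := hA.q_pos
  rcases Nat.eq_zero_or_pos n with rfl | hn
  · simp
  · have : (1 : ℝ) ≤ n := by exact_mod_cast hn
    have := div_le_self (sub_nonneg.2 hA.q_lt_one.le) this
    linarith

theorem segProb_pos (hA : S.Admissible) (k : ℕ) : 0 < segProb t r k :=
  prod_pos fun c _ => by
    split_ifs
    · exact segFactor_pos hA _
    · exact one_pos

/-- A round contributes at most `n` factors `1 - (1 - q)/n`, whose product is at least `q` by
Bernoulli's inequality, and the segment has `Δ` rounds. -/
theorem segProb_ge (hA : S.Admissible) (hN : t.queries.length ≤ N)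
    (hn : ∀ r, honestCount t r = t.n r) : S.q ^ S.Δ ≤ segProb t r N := by
  classical
  unfold segProb
  rw [← prod_filter, ← prod_fiberwise_of_maps_to (t := Ico r (r + S.Δ)) (g := t.roundAt)]
  · have hcard : S.q ^ S.Δ = ∏ _u ∈ Ico r (r + S.Δ), S.q := by simp
    rw [hcard]
    refine prod_le_prod (fun _ _ => hA.q_pos.le) fun u hu => ?_
    have h1 : ∀ c ∈ ((range N).filter (t.InSegment r)).filter fun c => t.roundAt c = u,
        1 - (1 - S.q) / t.n (t.roundAt c) = 1 - (1 - S.q) / (t.n u : ℝ) := by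
      intro c hc
      rw [(mem_filter.1 hc).2]
    rw [prod_congr rfl h1, prod_const]
    have h2 : (((range N).filter (t.InSegment r)).filter fun c => t.roundAt c = u).card ≤ t.n u := by
      rw [← card_honest_round hN hn u, filter_filter]
      refine card_le_card (monotone_filter_right _ fun c _ hc => ?_)
      exact ⟨(inSegment_iff.1 hc.1).1, hc.2⟩
    have h0 := segFactor_pos hA (t.n u)
    have hq1 := hA.q_lt_one
    have hq0 := hA.q_pos
    have h3 : 1 - (1 - S.q) / (t.n u : ℝ) ≤ 1 := by
      have : 0 ≤ (1 - S.q) / (t.n u : ℝ) := div_nonneg (by linarith) (by positivity)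
      linarith
    refine le_trans ?_ (pow_le_pow_of_le_one h0.le h3 h2)
    rcases Nat.eq_zero_or_pos (t.n u) with h | h
    · rw [h, pow_zero]; exact hq1.le
    · have hnu : (1 : ℝ) ≤ t.n u := by exact_mod_cast h
      have hb := one_add_mul_le_pow (a := -((1 - S.q) / (t.n u : ℝ))) (by linarith) (t.n u)
      have e1 : 1 + (t.n u : ℝ) * -((1 - S.q) / (t.n u : ℝ)) = S.q := by
        field_simp
        ring
      rw [e1] at hb
      simpa [sub_eq_add_neg] using hb
  · intro c hc
    have := inSegment_iff.1 (mem_filter.1 hc).2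
    exact mem_Ico.2 ⟨this.2.1, this.2.2.1⟩

end Segment

/-! ### The expected difficulty of isolated blocks -/

section Step

variable {Z : Strategy S coins} {R : ℕ} {ρ : coins} {i : Fin (S.m + 1)} {r : ℕ}

theorem segValue_succ_of_not {ω : Tape S N} {t : Trace S} {k : ℕ} (h : ¬ t.InSegment r k) :
    segValue ω t i r (k + 1) = segValue ω t i r k := by
  unfold segValue segNone segCount segProb
  rw [prod_range_succ, prod_range_succ, sum_range_succ, segSingle, if_neg fun h' => h h'.1,
    if_neg fun h' => h h'.1, if_neg fun h' => h h'.1, if_neg h, mul_one, mul_one, add_zero]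

/-- Let `V` be the numerator before the query. In the first round its mean afterwards is `pA + (1 -
pT)(V - pA)`, where `A` is `segNone`: a hit is worth `A/T` and has probability `pT`. This is at
least `(1 - pT) V`. In later rounds the mean is exactly `(1 - pT) V`. Goodness gives `pT ≤ (1 -
q)/n`, and the new factor of `segProb` compensates for the loss. -/
theorem sum_segValue_ge (hA : S.Admissible) (hl : ∀ ω : Tape S N, (run Z R ρ ω).Legal N)
    (ω : Tape S N) (k : Fin N) (h : (run Z R ρ ω).InSegment r k) :
    2 ^ S.κ * segValue ω (run Z R ρ ω) i r k
      ≤ ∑ y, segValue (reply ω k y) (run Z R ρ (reply ω k y)) i r (k + 1) := by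
  classical
  have hc := consistent_run Z R ρ ω
  have hn := honestCount_run Z R ρ ω
  obtain ⟨x, hx, hm, hr1, hr2, hg⟩ := id h
  have hx' := hx
  unfold Trace.request at hx'
  obtain ⟨e, he, hex⟩ := Option.map_eq_some_iff.1 hx'
  subst hex
  have hround : (run Z R ρ ω).roundAt k = e.round := by simp [Trace.roundAt, hx]
  have htarget : (run Z R ρ ω).targetAt k = (e.block.header.target : ℕ) := by
    simp [Trace.targetAt, he]
  have hn1 := h.n_pos hn
  rw [hround] at hn1
  have hT := (hl ω).honest_target_le hc hA.T₀_le he hm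
  have hTg := ((hl ω).honest_target_good hc he hm hg).2
  have hgood : ∀ y, (run Z R ρ (reply ω k y)).goodN r = (run Z R ρ ω).goodN r := fun y =>
    (round_reply Z R ρ ω k y le_rfl hx hr1).2.2
  have hcount0 := segCount_le (r := r) (hl ω).total hn hA.Δ_pos k.2.le
  have hcount1 := segCount_le (r := r) (hl ω).total hn hA.Δ_pos (k := k + 1) k.2
  have hP := segProb_pos (t := run Z R ρ ω) (r := r) hA k
  have hfac := segFactor_pos hA ((run Z R ρ ω).n e.round)
  have hP' : segProb (run Z R ρ ω) r (k + 1)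
      = segProb (run Z R ρ ω) r k * (1 - (1 - S.q) / (run Z R ρ ω).n e.round) := by
    unfold segProb
    rw [prod_range_succ, if_pos h, hround]
  have hC' : segCount (run Z R ρ ω) r (k + 1)
      = segCount (run Z R ρ ω) r k + if e.round = r then 1 else 0 := by
    unfold segCount
    rw [sum_range_succ, hround]
    simp [h]
  have hA0 := segNone_nonneg ω (run Z R ρ ω) i r k
  have hB0 := segSingle_nonneg ω (run Z R ρ ω) i r k
  have hstep : ∀ y, segValue (reply ω k y) (run Z R ρ (reply ω k y)) i r (k + 1)
      = (if OnTree i e.block.header.target y then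
          (if e.round = r then segNone ω (run Z R ρ ω) i r k / (e.block.header.target : ℕ) else 0)
        else segNone ω (run Z R ρ ω) i r k * S.p *
          ((run Z R ρ ω).goodN r - segCount (run Z R ρ ω) r (k + 1))
          + segSingle ω (run Z R ρ ω) i r k) / segProb (run Z R ρ ω) r (k + 1) := by
    intro y
    have hin := (inSegment_reply Z R ρ ω k y r le_rfl).2 h
    have hhit : (run Z R ρ (reply ω k y)).Hit i k y ↔ OnTree i e.block.header.target y := by
      rw [hit_reply Z R ρ ω k y i le_rfl]
      unfold Trace.Hit
      rw [hx]
      simp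
    have h1 : segNone (reply ω k y) (run Z R ρ (reply ω k y)) i r (k + 1)
        = segNone ω (run Z R ρ ω) i r k * if OnTree i e.block.header.target y then 0 else 1 := by
      unfold segNone
      rw [prod_range_succ]
      have := segNone_reply Z R ρ ω k y i r le_rfl
      unfold segNone at this
      rw [this, draw_reply_self]
      simp only [hin, true_and, hhit]
    unfold segValue
    rw [h1, segSingle, draw_reply_self, segNone_reply Z R ρ ω k y i r le_rfl,
      segSingle_reply Z R ρ ω k y i r le_rfl, segProb_reply Z R ρ ω k y r le_rfl,
      segCount_reply Z R ρ ω k y r le_rfl, hgood, roundAt_reply Z R ρ ω k y le_rfl, hround,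
      targetAt_reply Z R ρ ω k y le_rfl, htarget]
    simp only [hin, true_and, hhit]
    congr 1
    split_ifs <;> simp
  rw [sum_congr rfl fun y _ => hstep y, ← sum_div, sum_ite, sum_const, sum_const, nsmul_eq_mul,
    nsmul_eq_mul, card_onTree i hT, filter_not, card_sdiff_of_subset (filter_subset _ _),
    card_onTree i hT, card_univ, Fintype.card_fin, Nat.cast_sub, hP', hC']
  · rw [hC'] at hcount1
    unfold segValue
    set A := segNone ω (run Z R ρ ω) i r k
    set B := segSingle ω (run Z R ρ ω) i r k
    set P := segProb (run Z R ρ ω) r k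
    set G := (run Z R ρ ω).goodN r
    set c := segCount (run Z R ρ ω) r k
    set n : ℝ := ((run Z R ρ ω).n e.round : ℝ)
    have hTpos : (0 : ℝ) < (e.block.header.target : ℕ) := by exact_mod_cast e.block.header.target.pos
    set T : ℝ := ((e.block.header.target : ℕ) : ℝ) with hTdef
    have hp := p_pos S
    have hH : (2 : ℝ) ^ S.κ = 1 / S.p := by unfold Setup.p; simp
    have hn0 : (0 : ℝ) < n := by
      have : (1 : ℝ) ≤ ((run Z R ρ ω).n e.round : ℝ) := by exact_mod_cast hn1
      exact one_pos.trans_le this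
    have hpT : S.p * T ≤ (1 - S.q) / n := by
      rw [le_div_iff₀ hn0]
      unfold Setup.q
      linarith
    have hpT1 : S.p * T ≤ 1 := by linarith
    push_cast
    rw [hH, mul_div_assoc', div_le_div_iff₀ hP (mul_pos hP hfac)]
    have key : (A * S.p * (G - c) + B) * (1 - (1 - S.q) / n) ≤
        S.p * (T * (if e.round = r then A / T else 0)) + (1 - S.p * T) *
          (A * S.p * (G - (c + if e.round = r then 1 else 0)) + B) := by
      have hX : 0 ≤ A * S.p * (G - c) + B :=
        add_nonneg (mul_nonneg (mul_nonneg hA0 hp.le) (by linarith)) hB0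
      have h1 := mul_le_mul_of_nonneg_left (show 1 - (1 - S.q) / n ≤ 1 - S.p * T by linarith) hX
      refine h1.trans ?_
      split_ifs
      · rw [mul_div_cancel₀ _ hTpos.ne']
        have : 0 ≤ S.p * T * (A * S.p) := by positivity
        nlinarith
      · simp only [mul_zero, zero_add, add_zero]
        linarith
    calc 1 / S.p * (A * S.p * (G - c) + B) * (P * (1 - (1 - S.q) / n))
        = 1 / S.p * P * ((A * S.p * (G - c) + B) * (1 - (1 - S.q) / n)) := by ring
      _ ≤ 1 / S.p * P * (S.p * (T * (if e.round = r then A / T else 0)) + (1 - S.p * T) *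
          (A * S.p * (G - (c + if e.round = r then 1 else 0)) + B)) := by gcongr
      _ = _ := by
        field_simp
  · exact (Nat.le_mul_of_pos_left _ (by omega)).trans hT

/-- The chord bound for `exp (-w · segSingle)` reduces the claim to a linear one, and the mean of
`segSingle` is bounded by following `segValue` from `p n_r` at the start to the end. The factors `C`
and `w` may depend on everything that the answers inside the segment do not influence. -/
theorem sum_segment_le (hA : S.Admissible) (hl : ∀ ω : Tape S N, (run Z R ρ ω).Legal N)
    {C w : Tape S N → ℝ} {x : ℝ} (hx : 0 < x) (hC : ∀ ω, 0 ≤ C ω) (hw : ∀ ω, 0 ≤ w ω)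
    (hconst : ∀ (k : Fin N) (ω : Tape S N) (y : Fin (2 ^ S.κ)), (run Z R ρ ω).InSegment r k →
      C (reply ω k y) = C ω ∧ w (reply ω k y) = w ω)
    (hwx : ∀ ω, w ω * segSingle ω (run Z R ρ ω) i r N ≤ x) :
    ∑ ω, C ω * Real.exp (w ω * (S.q ^ S.Δ * S.p * ((1 - Real.exp (-x)) / x)
      * (run Z R ρ ω).goodN r - segSingle ω (run Z R ρ ω) i r N)) ≤ ∑ ω, C ω := by
  set φ := (1 - Real.exp (-x)) / x with hφ
  have hφ0 : 0 ≤ φ := div_nonneg (by simpa using hx.le) hx.le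
  have hq := hA.q_pos
  have hp := p_pos S
  set C' : Tape S N → ℝ := fun ω =>
    C ω * Real.exp (w ω * (S.q ^ S.Δ * S.p * φ * (run Z R ρ ω).goodN r)) with hC'
  have hC'0 : ∀ ω, 0 ≤ C' ω := fun ω => mul_nonneg (hC ω) (Real.exp_pos _).le
  have hC'const : ∀ (k : Fin N) (ω : Tape S N) (y : Fin (2 ^ S.κ)), (run Z R ρ ω).InSegment r k →
      C' (reply ω k y) = C' ω := by
    intro k ω y h
    obtain ⟨h1, h2⟩ := hconst k ω y h
    obtain ⟨z, hz, -, hz1, -⟩ := h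
    simp only [hC']
    rw [h1, h2, (round_reply Z R ρ ω k y le_rfl hz hz1).2.2]
  have hstep : ∀ k ≤ N,
      ∑ ω, C' ω * (1 - w ω * φ * S.q ^ S.Δ * segValue ω (run Z R ρ ω) i r k)
      ≤ ∑ ω, C' ω * (1 - w ω * φ * S.q ^ S.Δ * segValue ω (run Z R ρ ω) i r 0) := by
    intro k
    induction k with
    | zero => exact fun _ => le_rfl
    | succ k ih =>
      intro hk
      refine le_trans (sum_le_sum_of_reply ⟨k, hk⟩ fun ω => ?_) (ih (by omega))
      by_cases h : (run Z R ρ ω).InSegment r k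
      · have hv : ∀ y, segValue (reply ω ⟨k, hk⟩ y) (run Z R ρ (reply ω ⟨k, hk⟩ y)) i r k
            = segValue ω (run Z R ρ ω) i r k := by
          intro y
          obtain ⟨z, hz, -, hz1, -⟩ := h
          unfold segValue
          rw [segNone_reply Z R ρ ω ⟨k, hk⟩ y i r le_rfl,
            segSingle_reply Z R ρ ω ⟨k, hk⟩ y i r le_rfl,
            segProb_reply Z R ρ ω ⟨k, hk⟩ y r (Nat.le_succ k),
            segCount_reply Z R ρ ω ⟨k, hk⟩ y r (Nat.le_succ k),
            (round_reply Z R ρ ω ⟨k, hk⟩ y le_rfl hz hz1).2.2]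
        simp only [hC'const ⟨k, hk⟩ ω _ h, (hconst ⟨k, hk⟩ ω _ h).2, hv]
        rw [← mul_sum, ← mul_sum]
        refine mul_le_mul_of_nonneg_left ?_ (hC'0 ω)
        rw [sum_sub_distrib, sum_sub_distrib, ← mul_sum, ← mul_sum]
        refine sub_le_sub_left (mul_le_mul_of_nonneg_left ?_
          (mul_nonneg (mul_nonneg (hw ω) hφ0) (pow_nonneg hq.le _))) _
        refine le_trans (le_of_eq ?_) (sum_segValue_ge hA hl ω ⟨k, hk⟩ h)
        simp
      · refine (sum_congr rfl fun y _ => ?_).le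
        rw [segValue_succ_of_not fun h' => h ((inSegment_reply Z R ρ ω ⟨k, hk⟩ y r le_rfl).1 h')]
  have hlast : ∀ ω, C ω * Real.exp (w ω * (S.q ^ S.Δ * S.p * φ * (run Z R ρ ω).goodN r
      - segSingle ω (run Z R ρ ω) i r N))
      ≤ C' ω * (1 - w ω * φ * S.q ^ S.Δ * segValue ω (run Z R ρ ω) i r N) := by
    intro ω
    have hn := honestCount_run Z R ρ ω
    rw [mul_sub, sub_eq_add_neg, Real.exp_add, ← mul_assoc]
    refine mul_le_mul_of_nonneg_left ?_ (hC'0 ω)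
    have h1 := exp_mul_le_one_add (-1)
      (mul_nonneg (hw ω) (segSingle_nonneg ω (run Z R ρ ω) i r N)) (hwx ω) hx
    rw [neg_one_mul, neg_one_mul] at h1
    refine h1.trans ?_
    -- At the end all queries of the first round are counted, so the first summand of `segValue`
    -- vanishes.
    have h2 : S.q ^ S.Δ * segValue ω (run Z R ρ ω) i r N ≤ segSingle ω (run Z R ρ ω) i r N := by
      unfold segValue
      rw [segCount_total (hl ω).total hn hA.Δ_pos, sub_self, mul_zero, zero_add, mul_div_assoc',
        div_le_iff₀ (segProb_pos hA N), mul_comm]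
      exact mul_le_mul_of_nonneg_left (segProb_ge hA (hl ω).total hn) (segSingle_nonneg _ _ _ _ _)
    have h3 := mul_le_mul_of_nonneg_left h2 (mul_nonneg (hw ω) hφ0)
    have h4 : (Real.exp (-x) - 1) / x = -φ := by rw [hφ]; ring
    rw [h4]
    linarith
  have hfirst : ∀ ω, C' ω * (1 - w ω * φ * S.q ^ S.Δ * segValue ω (run Z R ρ ω) i r 0) ≤ C ω := by
    intro ω
    have h0 : segValue ω (run Z R ρ ω) i r 0 = S.p * (run Z R ρ ω).goodN r := by
      simp [segValue, segNone, segSingle, segCount, segProb]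
    rw [h0]
    simp only [hC']
    set z := w ω * (S.q ^ S.Δ * S.p * φ * (run Z R ρ ω).goodN r) with hz
    have h1 : 1 - w ω * φ * S.q ^ S.Δ * (S.p * (run Z R ρ ω).goodN r) ≤ Real.exp (-z) := by
      have := Real.add_one_le_exp (-z)
      refine le_trans (le_of_eq ?_) this
      rw [hz]; ring
    calc C ω * Real.exp z * (1 - w ω * φ * S.q ^ S.Δ * (S.p * (run Z R ρ ω).goodN r))
        ≤ C ω * Real.exp z * Real.exp (-z) :=
          mul_le_mul_of_nonneg_left h1 (mul_nonneg (hC ω) (Real.exp_pos _).le)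
      _ = C ω := by rw [mul_assoc, ← Real.exp_add, add_neg_cancel, Real.exp_zero, mul_one]
  exact (sum_le_sum fun ω _ => hlast ω).trans
    ((hstep N le_rfl).trans (sum_le_sum fun ω _ => hfirst ω))

end Step

/-! ### Segments whose first rounds have distance `Δ` -/

theorem not_inSegment_of_le {ω : Tape S N} {t : Trace S} (hc : Consistent ω t) {r r' k c : ℕ}
    (h : t.InSegment r' k) (hr : r + S.Δ ≤ r') (hkc : k ≤ c) : ¬ t.InSegment r c := by
  rintro ⟨x, hx, -, -, hx2, -⟩
  obtain ⟨z, hz, -, hz1, -⟩ := h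
  unfold Trace.request at hx hz
  obtain ⟨e, he, rfl⟩ := Option.map_eq_some_iff.1 hx
  obtain ⟨e', he', rfl⟩ := Option.map_eq_some_iff.1 hz
  have := hc.round_mono hkc he' he
  dsimp only at *
  omega

/-- The difficulty of the only block of the segment that begins with round `r`. -/
noncomputable def isolated (ω : Tape S N) (t : Trace S) (i : Fin (S.m + 1)) (r : ℕ) : ℝ :=
  segSingle ω t i r N

/-- The largest possible difficulty of an honest block of a good round, per honest party. -/
noncomputable def Setup.β (S : Setup) : ℝ := 2 * S.γ ^ 2 * S.p / S.f

theorem Setup.Admissible.β_pos (hA : S.Admissible) : 0 < S.β := by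
  have := hA.f_pos
  have := hA.γ_ge
  have := p_pos S
  unfold Setup.β
  positivity

theorem isolated_nonneg (ω : Tape S N) (t : Trace S) (i : Fin (S.m + 1)) (r : ℕ) :
    0 ≤ isolated ω t i r := segSingle_nonneg _ _ _ _ _

theorem isolated_le {ω : Tape S N} {t : Trace S} (hA : S.Admissible) (hl : t.Legal N)
    (hc : Consistent ω t) (i : Fin (S.m + 1)) (r : ℕ) :
    isolated ω t i r ≤ S.β * t.goodN r := by
  by_cases h : isolated ω t i r = 0
  · rw [h]
    exact mul_nonneg hA.β_pos.le (goodN_nonneg _ _)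
  · obtain ⟨c, -, ⟨⟨x, hx, hm, -, -, hg⟩, -⟩, hr, heq, -⟩ := segSingle_eq N h
    have hx' := hx
    unfold Trace.request at hx'
    obtain ⟨e, he, hex⟩ := Option.map_eq_some_iff.1 hx'
    subst hex
    have hround : e.round = r := by
      rw [← hr]; simp [Trace.roundAt, hx]
    have h1 := hl.honest_diff_le hc hA.f_pos hA.γ_ge he hm hg
    have h2 : isolated ω t i r = e.block.header.diff := by
      unfold isolated
      rw [heq]
      simp [Trace.targetAt, he, Header.diff]
    rw [h2]
    simp only [hround] at hg h1
    unfold Trace.goodN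
    rw [if_pos hg]
    exact h1

section Class

variable (Z : Strategy S coins) (R : ℕ) (ρ : coins) (i : Fin (S.m + 1)) (u : ℕ) (x : ℝ)

/-- The weighted sum over the segments that begin in the rounds `u + j Δ` with `j < J`. -/
noncomputable def classSum (J : ℕ) (ω : Tape S N) : ℝ :=
  ∑ j ∈ range J, x / runMax (fun j => S.β * (run Z R ρ ω).goodN (u + j * S.Δ)) 0 j *
    (S.q ^ S.Δ * S.p * ((1 - Real.exp (-x)) / x) * (run Z R ρ ω).goodN (u + j * S.Δ)
      - isolated ω (run Z R ρ ω) i (u + j * S.Δ))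

theorem goodN_reply_of_inSegment {ω : Tape S N} {k : Fin N} {r' : ℕ}
    (h : (run Z R ρ ω).InSegment r' k) {r : ℕ} (hr : r ≤ r') (y : Fin (2 ^ S.κ)) :
    (run Z R ρ (reply ω k y)).goodN r = (run Z R ρ ω).goodN r := by
  obtain ⟨z, hz, -, hz1, -⟩ := h
  exact (round_reply Z R ρ ω k y le_rfl hz (hr.trans hz1)).2.2

/-- The last segment is averaged out first. Its answers come after all earlier segments of the
class, and the running maximum involves only rounds up to its first one, so everything else is
constant during it. -/
theorem sum_exp_classSum_le (hA : S.Admissible) (hl : ∀ ω : Tape S N, (run Z R ρ ω).Legal N)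
    (hx : 0 < x) (J : ℕ) :
    ∑ ω : Tape S N, Real.exp (classSum Z R ρ i u x J ω) ≤ Fintype.card (Tape S N) := by
  induction J with
  | zero => simp [classSum]
  | succ J ih =>
    refine le_trans ?_ ih
    have hmax : ∀ (k : Fin N) (ω : Tape S N) (y : Fin (2 ^ S.κ)),
        (run Z R ρ ω).InSegment (u + J * S.Δ) k → ∀ j ≤ J,
        runMax (fun j => S.β * (run Z R ρ (reply ω k y)).goodN (u + j * S.Δ)) 0 j
          = runMax (fun j => S.β * (run Z R ρ ω).goodN (u + j * S.Δ)) 0 j := by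
      intro k ω y h j hj
      refine runMax_congr fun j' _ hj' => ?_
      have := Nat.mul_le_mul_right S.Δ (hj'.trans hj)
      rw [goodN_reply_of_inSegment Z R ρ h (by omega)]
    have h := sum_segment_le (i := i) (r := u + J * S.Δ) hA hl
      (C := fun ω => Real.exp (classSum Z R ρ i u x J ω))
      (w := fun ω => x / runMax (fun j => S.β * (run Z R ρ ω).goodN (u + j * S.Δ)) 0 J)
      hx (fun ω => (Real.exp_pos _).le) (fun ω => div_nonneg hx.le (runMax_nonneg _ _ _)) ?_ ?_
    · refine le_trans (le_of_eq ?_) h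
      refine sum_congr rfl fun ω _ => ?_
      rw [← Real.exp_add]
      unfold classSum
      rw [sum_range_succ]
      rfl
    · intro k ω y h
      refine ⟨?_, by rw [hmax k ω y h J le_rfl]⟩
      congr 1
      refine sum_congr rfl fun j hj => ?_
      have hj := mem_range.1 hj
      have hjJ : u + j * S.Δ + S.Δ ≤ u + J * S.Δ := by
        have := Nat.mul_le_mul_right S.Δ (Nat.succ_le_iff.2 hj)
        rw [Nat.succ_mul] at this
        omega
      rw [hmax k ω y h j hj.le, goodN_reply_of_inSegment Z R ρ h (by omega)]
      have hiso : isolated (reply ω k y) (run Z R ρ (reply ω k y)) i (u + j * S.Δ)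
          = isolated ω (run Z R ρ ω) i (u + j * S.Δ) := by
        unfold isolated
        rw [segSingle_eq_of_le k.2.le fun c hc _ => not_inSegment_of_le (consistent_run Z R ρ ω) h hjJ hc,
          segSingle_eq_of_le k.2.le fun c hc _ => not_inSegment_of_le
            (consistent_run Z R ρ (reply ω k y)) ((inSegment_reply Z R ρ ω k y _ le_rfl).2 h) hjJ hc,
          segSingle_reply Z R ρ ω k y i _ le_rfl]
      rw [hiso]
    · intro ω
      rw [div_mul_eq_mul_div]
      refine div_le_of_le_mul₀ (runMax_nonneg _ _ _) hx.le (mul_le_mul_of_nonneg_left ?_ hx.le)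
      exact (isolated_le hA (hl ω) (consistent_run Z R ρ ω) i _).trans
        (le_runMax (c := fun j => S.β * (run Z R ρ ω).goodN (u + j * S.Δ)) (Nat.zero_le J) le_rfl)

end Class

theorem runMax_add (c : ℕ → ℝ) (a j : ℕ) :
    runMax c a (a + j) = runMax (fun j => c (a + j)) 0 j := by
  refine le_antisymm (runMax_le (runMax_nonneg _ _ _) fun k h₁ h₂ => ?_)
    (runMax_le (runMax_nonneg _ _ _) fun k _ h₂ => le_runMax (by omega) (by omega))
  obtain ⟨k, rfl⟩ := Nat.exists_eq_add_of_le h₁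
  exact le_runMax (c := fun j => c (a + j)) (Nat.zero_le k) (by omega)

theorem prob_isolated_deviation_le (Z : Strategy S coins) (R : ℕ) (ρ : coins) (i : Fin (S.m + 1))
    (hA : S.Admissible) (hl : ∀ ω : Tape S N, (run Z R ρ ω).Legal N) {x : ℝ} (hx : 0 < x) :
    prob {ω : Tape S N | ¬ ∀ (u J : ℕ) (B : ℝ), 0 < J → u + (J - 1) * S.Δ < N → 0 < B →
      (∀ j < J, S.β * (run Z R ρ ω).goodN (u + j * S.Δ) ≤ B) →
      ∑ j ∈ range J, (S.q ^ S.Δ * S.p * ((1 - Real.exp (-x)) / x)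
        * (run Z R ρ ω).goodN (u + j * S.Δ) - isolated ω (run Z R ρ ω) i (u + j * S.Δ))
        < S.lam / x * B} ≤ (N : ℝ) ^ 2 * Real.exp (-S.lam) := by
  refine le_trans (prob_mono ?_) (prob_pairs_le N
    (fun u J => {ω : Tape S N | S.lam ≤ classSum Z R ρ i u x (J + 1) ω}) fun u _ J _ =>
      prob_exp_markov (sum_exp_classSum_le Z R ρ i u x hA hl hx (J + 1)) S.lam)
  intro ω hω
  by_contra hcon
  refine hω fun u J B hJ hu hB hcB => ?_
  have hΔ := hA.Δ_pos
  rw [range_eq_Ico]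
  refine sum_lt_of_weighted_sums_lt (c := fun j => S.β * (run Z R ρ ω).goodN (u + j * S.Δ)) hB
    (div_pos hA.lam_pos hx) (fun j _ h => hcB j h) ?_ ?_
  · intro j _ _ hz
    refine mul_pos hA.β_pos ((goodN_nonneg _ _).lt_of_ne' fun h0 => ?_)
    rw [h0, mul_zero, zero_sub] at hz
    linarith [isolated_nonneg ω (run Z R ρ ω) i (u + j * S.Δ)]
  · intro a _ haJ
    have haN : u + a * S.Δ < N := by
      have := Nat.mul_le_mul_right S.Δ (show a ≤ J - 1 by omega)
      omega
    have hJN : J - a - 1 < N := by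
      have := Nat.le_mul_of_pos_right (J - 1) hΔ
      omega
    have h1 : ¬ S.lam ≤ classSum Z R ρ i (u + a * S.Δ) x (J - a - 1 + 1) ω :=
      fun h => hcon ⟨_, haN, _, hJN, h⟩
    have h2 : classSum Z R ρ i (u + a * S.Δ) x (J - a - 1 + 1) ω = x * ∑ j ∈ Ico a J,
        (S.q ^ S.Δ * S.p * ((1 - Real.exp (-x)) / x) * (run Z R ρ ω).goodN (u + j * S.Δ)
          - isolated ω (run Z R ρ ω) i (u + j * S.Δ))
        / runMax (fun j => S.β * (run Z R ρ ω).goodN (u + j * S.Δ)) a j := by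
      rw [show J - a - 1 + 1 = J - a by omega, sum_Ico_eq_sum_range, mul_sum]
      refine sum_congr rfl fun j _ => ?_
      rw [runMax_add]
      have : ∀ j, u + a * S.Δ + j * S.Δ = u + (a + j) * S.Δ := fun j => by ring
      simp only [this]
      ring
    rw [lt_div_iff₀ hx]
    linarith

/-! ### The lower bound for isolated honest difficulty -/

section Legal

variable {ω : Tape S N} {t : Trace S}

theorem Y_nonneg (t : Trace S) (i : Fin (S.m + 1)) (r : ℕ) : 0 ≤ t.Y i r := by
  unfold Trace.Y
  induction t.honestDiffs i r with
  | nil => exact le_rfl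
  | cons a l ih => exact ih.trans (le_max_right _ _)

theorem le_Y {t : Trace S} {i : Fin (S.m + 1)} {r : ℕ} {d : ℝ} (h : d ∈ t.honestDiffs i r) :
    d ≤ t.Y i r := by
  unfold Trace.Y
  revert h
  generalize t.honestDiffs i r = l
  intro h
  induction l with
  | nil => simp at h
  | cons a l ih =>
    rcases List.mem_cons.1 h with rfl | h
    · exact le_max_left _ _
    · exact (ih h).trans (le_max_right _ _)

theorem honestDiffs_nonneg {t : Trace S} {i : Fin (S.m + 1)} {r : ℕ} {d : ℝ}
    (h : d ∈ t.honestDiffs i r) : 0 ≤ d := by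
  unfold Trace.honestDiffs at h
  obtain ⟨e, -, rfl⟩ := List.mem_map.1 h
  exact e.block.header.diff_pos.le

theorem Y_le_D (t : Trace S) (i : Fin (S.m + 1)) (r : ℕ) : t.Y i r ≤ t.D i r := by
  unfold Trace.Y Trace.D
  have h : ∀ d ∈ t.honestDiffs i r, 0 ≤ d := fun d => honestDiffs_nonneg
  revert h
  generalize t.honestDiffs i r = l
  intro h
  induction l with
  | nil => exact le_rfl
  | cons a l ih =>
    have hl : ∀ d ∈ l, 0 ≤ d := fun d hd => h d (List.mem_cons_of_mem _ hd)
    have ha := h a List.mem_cons_self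
    rw [List.foldr_cons, List.sum_cons]
    exact max_le (le_add_of_nonneg_right (List.sum_nonneg hl))
      ((ih hl).trans (le_add_of_nonneg_left ha))

theorem Q_nonneg (t : Trace S) (i : Fin (S.m + 1)) (r : ℕ) : 0 ≤ t.Q i r := by
  unfold Trace.Q
  split_ifs
  · exact Y_nonneg _ _ _
  · exact le_rfl

theorem Q_le_D (t : Trace S) (i : Fin (S.m + 1)) (r : ℕ) : t.Q i r ≤ t.D i r := by
  unfold Trace.Q
  split_ifs
  · exact Y_le_D _ _ _
  · exact (Y_nonneg t i r).trans (Y_le_D t i r)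

/-- Segments look only at good rounds, so the following rounds must be good to conclude that they
contain no honest block at all. -/
theorem isolated_le_Q (hl : t.Legal N) (hc : Consistent ω t) (hnc : NoCollision ω t)
    {i : Fin (S.m + 1)} {r : ℕ} (hg : ∀ u ∈ Ico r (r + S.Δ), t.Good u) :
    isolated ω t i r ≤ t.Q i r := by
  classical
  by_cases h : isolated ω t i r = 0
  · rw [h]; exact Q_nonneg _ _ _
  obtain ⟨c, hcN, ⟨⟨x, hx, hm, -, -, -⟩, z, hz, hhit⟩, hr, heq, huniq⟩ := segSingle_eq N h
  have hx' := hx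
  unfold Trace.request at hx'
  obtain ⟨e, he, hex⟩ := Option.map_eq_some_iff.1 hx'
  subst hex
  rw [hx] at hz
  obtain rfl := Option.some.inj hz
  have hround : e.round = r := by rw [← hr]; simp [Trace.roundAt, hx]
  unfold Trace.Q
  rw [if_pos]
  · have h2 : isolated ω t i r = e.block.header.diff := by
      unfold isolated
      rw [heq]
      simp [Trace.targetAt, he, Header.diff]
    rw [h2]
    refine le_Y ?_
    unfold Trace.honestDiffs
    refine List.mem_map.2 ⟨e, List.mem_filter.2 ⟨List.mem_of_getElem? he, ?_⟩, rfl⟩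
    refine decide_eq_true ⟨hround, hm, ?_⟩
    rwa [hnc.hash_of_honest hc hl.total he hm]
  · intro u hu1 hu2
    rw [D_eq hc hnc hl.total]
    refine sum_eq_zero fun k hk => ?_
    by_cases hku : t.roundAt k = u
    · rw [if_pos hku]
      unfold Trace.honestGain
      cases hxk : t.request k with
      | none => rfl
      | some x =>
        have hxu : x.1 = u := by rw [← hku]; simp [Trace.roundAt, hxk]
        refine if_neg fun hcon => ?_
        have := huniq k (mem_range.1 hk) ⟨⟨x, hxk, hcon.1, by omega, by omega,
          hg _ (mem_Ico.2 (by omega))⟩, x, hxk, hcon.2⟩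
        subst this
        omega
    · exact if_neg hku

/-- Rounds that are sorted by their residues modulo `Δ`. -/
theorem sum_range_eq_sum_classes {Δ : ℕ} (hΔ : 0 < Δ) (m : ℕ) (F : ℕ → ℝ) :
    ∑ d ∈ range m, F d
      = ∑ a ∈ range Δ, ∑ j ∈ range ((m + Δ - 1 - a) / Δ), F (a + j * Δ) := by
  rw [sum_sigma']
  refine sum_bij' (fun d _ => ⟨d % Δ, d / Δ⟩) (fun x _ => x.1 + x.2 * Δ) ?_ ?_ ?_ ?_ ?_
  · intro d hd
    have h1 := Nat.mod_lt d hΔ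
    have h2 := Nat.mod_add_div' d Δ
    simp only [mem_sigma, mem_range] at hd ⊢
    refine ⟨h1, ?_⟩
    rw [Nat.lt_iff_add_one_le, Nat.le_div_iff_mul_le hΔ, Nat.add_mul, one_mul]
    omega
  · rintro ⟨a, j⟩ hx
    simp only [mem_sigma, mem_range] at hx ⊢
    rw [Nat.lt_iff_add_one_le (m := j), Nat.le_div_iff_mul_le hΔ, Nat.add_mul, one_mul] at hx
    omega
  · intro d _
    exact Nat.mod_add_div' d Δ
  · rintro ⟨a, j⟩ hx
    simp only [mem_sigma, mem_range] at hx
    have h1 : (a + j * Δ) % Δ = a := by rw [Nat.add_mul_mod_self_right, Nat.mod_eq_of_lt hx.1]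
    have h2 : (a + j * Δ) / Δ = j := by
      rw [Nat.add_mul_div_right _ _ hΔ, Nat.div_eq_of_lt hx.1, zero_add]
    simp [h1, h2]
  · intro d _
    rw [Nat.mod_add_div' d Δ]

theorem one_sub_lt_of_le_eighth {e : ℝ} (he : 0 < e) (he1 : e ≤ 1 / 8) :
    1 - e < (1 - e / 2) * (1 - e ^ 2 / 4) - e / 2 / (1 + 3 * e) := by
  have h2 := pow_pos he 2
  have h3 := pow_pos he 3
  have h : e / 2 / (1 + 3 * e) ≤ e / 2 - e ^ 2 := by
    rw [div_le_iff₀ (by positivity)]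
    nlinarith
  nlinarith

/-- Three losses have to fit into `ε`: the factor `1 - ε/2` from linearizing the exponential with
exponent `ε`, the last rounds whose segment leaves the interval, and the deviations of the `Δ`
residue classes. -/
theorem Trace.Legal.honest_lower (hl : t.Legal N) (hA : S.Admissible) (hlam1 : 1 ≤ S.lam)
    (hc : Consistent ω t) (hnc : NoCollision ω t) (hRN : t.plans.length ≤ N) {i : Fin (S.m + 1)}
    (hdev : ∀ (u J : ℕ) (B : ℝ), 0 < J → u + (J - 1) * S.Δ < N → 0 < B →
      (∀ j < J, S.β * t.goodN (u + j * S.Δ) ≤ B) →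
      ∑ j ∈ range J, (S.q ^ S.Δ * S.p * ((1 - Real.exp (-S.ε)) / S.ε)
        * t.goodN (u + j * S.Δ) - isolated ω t i (u + j * S.Δ)) < S.lam / S.ε * B)
    {u w : ℕ} (huw : u < w) (hw : w ≤ t.plans.length) (hs : ((w - u : ℕ) : ℝ) ≤ S.s)
    (hell : S.ell ≤ ((w - u : ℕ) : ℝ)) (hg : ∀ r ∈ Ico u w, t.Good r) :
    (1 - S.ε) * S.q ^ S.Δ * S.p * ∑ r ∈ Ico u w, (t.n r : ℝ) < ∑ r ∈ Ico u w, t.Q i r := by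
  have hε := hA.ε_pos
  have hε1 := hA.ε_le_one
  have hεsq : S.ε ^ 2 / 4 < 1 := by nlinarith
  have hf := hA.f_pos
  have hf1 := hA.f_lt_one
  have hγ := hA.γ_ge
  have hlam := hA.lam_pos
  have hp := p_pos S
  have hq := hA.q_pos
  have hΔ := hA.Δ_pos
  have hΔ1 : (1 : ℝ) ≤ S.Δ := by exact_mod_cast hΔ
  have hγ0 : 0 < S.γ := by linarith
  have hqΔ : 0 < S.q ^ S.Δ := by positivity
  obtain ⟨M, hM0, hM⟩ := hl.exists_max_n huw hw hs
  have hMsum := length_mul_le_sum_n hM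
  set n := ∑ r ∈ Ico u w, (t.n r : ℝ) with hn
  have hn0 : 0 < n := by
    refine pos_of_mul_pos_right (lt_of_lt_of_le ?_ hMsum) hγ0.le
    have : (0 : ℝ) < ((w - u : ℕ) : ℝ) := by exact_mod_cast (by omega : 0 < w - u)
    positivity
  have hellM : S.ell * M ≤ S.γ * n := (mul_le_mul_of_nonneg_right hell hM0.le).trans hMsum
  have hkey : 4 * (1 + 3 * S.ε) * S.Δ * S.γ ^ 2 * S.lam * M ≤ n * (S.ε ^ 2 * S.f * S.q ^ S.Δ) := by
    have h6 := hA.ell_mul_ge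
    have hell0 := hA.ell_pos
    have h8 : S.γ * (4 * (1 + 3 * S.ε) * S.Δ * S.γ ^ 2 * S.lam * M)
        ≤ S.γ * (n * (S.ε ^ 2 * S.f * S.q ^ S.Δ)) :=
      calc S.γ * (4 * (1 + 3 * S.ε) * S.Δ * S.γ ^ 2 * S.lam * M)
          = 4 * (1 + 3 * S.ε) * S.Δ * S.γ ^ 3 * S.lam * M := by ring
        _ ≤ 4 * (1 + 3 * S.ε) * max (S.Δ : ℝ) S.τ * S.γ ^ 3 * S.lam * M := by
          gcongr
          exact le_max_left _ _
        _ ≤ S.ell * (S.ε ^ 2 * S.f * S.q ^ (S.Δ + 1)) * M := by gcongr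
        _ ≤ S.ell * (S.ε ^ 2 * S.f * S.q ^ S.Δ) * M := by
          have : S.q ^ (S.Δ + 1) ≤ S.q ^ S.Δ :=
            pow_le_pow_of_le_one hq.le hA.q_lt_one.le (Nat.le_succ _)
          gcongr
        _ = S.ell * M * (S.ε ^ 2 * S.f * S.q ^ S.Δ) := by ring
        _ ≤ S.γ * n * (S.ε ^ 2 * S.f * S.q ^ S.Δ) := by gcongr
        _ = _ := by ring
    exact le_of_mul_le_mul_left h8 hγ0
  -- The assumption `1 ≤ λ` enters here: `Δ` rounds are a negligible part of the interval only if
  -- `ell` is large compared with `Δ`.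
  have hΔM : S.Δ * M ≤ n * (S.ε ^ 2 / 4) := by
    have hq1 : S.q ^ S.Δ ≤ 1 := pow_le_one₀ hq.le hA.q_lt_one.le
    have h1 : 4 * (S.Δ * M) ≤ 4 * (1 + 3 * S.ε) * S.Δ * S.γ ^ 2 * S.lam * M :=
      calc 4 * (S.Δ * M) = 4 * 1 * S.Δ * 1 ^ 2 * 1 * M := by ring
        _ ≤ _ := by gcongr; linarith
    have h2 : n * (S.ε ^ 2 * S.f * S.q ^ S.Δ) ≤ n * (S.ε ^ 2 * 1 * 1) := by gcongr
    linarith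
  have hΔw : u + S.Δ ≤ w := by
    by_contra! hcon
    have h1 : ((w - u : ℕ) : ℝ) ≤ S.Δ := by exact_mod_cast (by omega : w - u ≤ S.Δ)
    have h2 : n ≤ ((w - u : ℕ) : ℝ) * M := by
      rw [hn]
      refine (sum_le_sum fun r hr => (hM r hr).1).trans ?_
      simp
    have h3 : n ≤ n * (S.ε ^ 2 / 4) := h2.trans ((mul_le_mul_of_nonneg_right h1 hM0.le).trans hΔM)
    have h4 := mul_lt_mul_of_pos_left hεsq hn0
    linarith
  -- This is the number of rounds whose whole segment of `Δ` rounds lies in the interval.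
  set m := w - u + 1 - S.Δ with hm
  set φ := S.q ^ S.Δ * S.p * ((1 - Real.exp (-S.ε)) / S.ε) with hφ
  set B := S.β * M with hB
  have hB0 : 0 < B := mul_pos hA.β_pos hM0
  have hclass : ∑ d ∈ range m, (φ * t.goodN (u + d) - isolated ω t i (u + d))
      < S.Δ * (S.lam / S.ε * B) := by
    rw [sum_range_eq_sum_classes hΔ]
    refine (sum_lt_sum_of_nonempty (g := fun _ => S.lam / S.ε * B) ⟨0, mem_range.2 hΔ⟩
      fun a ha => ?_).trans_eq (by simp)
    have ha := mem_range.1 ha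
    set J := (m + S.Δ - 1 - a) / S.Δ with hJ
    rcases Nat.eq_zero_or_pos J with h0 | h0
    · rw [h0, range_zero, sum_empty]
      positivity
    · have hJm : ∀ j < J, a + j * S.Δ < m := by
        intro j hj
        rw [hJ, Nat.lt_iff_add_one_le, Nat.le_div_iff_mul_le hΔ, Nat.add_mul, one_mul] at hj
        omega
      have h1 := hJm (J - 1) (by omega)
      have h2 := hdev (u + a) J B h0 (by omega) hB0 fun j hj => ?_
      · simpa only [add_assoc] using h2
      · refine mul_le_mul_of_nonneg_left ?_ hA.β_pos.le
        have := hJm j hj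
        unfold Trace.goodN
        split_ifs
        · exact (hM _ (mem_Ico.2 (by omega))).1
        · exact hM0.le
  have hgood : ∑ d ∈ range m, t.goodN (u + d) = ∑ r ∈ Ico u (u + m), (t.n r : ℝ) := by
    rw [sum_Ico_eq_sum_range, Nat.add_sub_cancel_left]
    refine sum_congr rfl fun d hd => ?_
    have := mem_range.1 hd
    unfold Trace.goodN
    rw [if_pos (hg _ (mem_Ico.2 (by omega)))]
  have hQ : ∑ d ∈ range m, isolated ω t i (u + d) ≤ ∑ r ∈ Ico u w, t.Q i r := by
    refine le_trans ?_ (sum_le_sum_of_subset_of_nonneg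
      (Ico_subset_Ico_right (show u + m ≤ w by omega)) fun _ _ _ => Q_nonneg _ _ _)
    rw [sum_Ico_eq_sum_range, Nat.add_sub_cancel_left]
    refine sum_le_sum fun d hd => isolated_le_Q hl hc hnc fun r hr => hg r ?_
    have := mem_range.1 hd
    have := mem_Ico.1 hr
    exact mem_Ico.2 (by omega)
  have hn' : n - S.Δ * M ≤ ∑ r ∈ Ico u (u + m), (t.n r : ℝ) := by
    have h1 := sum_Ico_consecutive (fun r => (t.n r : ℝ)) (show u ≤ u + m by omega)
      (show u + m ≤ w by omega)
    have h2 : ∑ r ∈ Ico (u + m) w, (t.n r : ℝ) ≤ S.Δ * M := by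
      refine (sum_le_sum fun r hr => (hM r (mem_Ico.2 ?_)).1).trans ?_
      · have := mem_Ico.1 hr
        omega
      · rw [sum_const, Nat.card_Ico, nsmul_eq_mul]
        have : ((w - (u + m) : ℕ) : ℝ) ≤ S.Δ := by exact_mod_cast (by omega : w - (u + m) ≤ S.Δ)
        gcongr
    linarith
  rw [sum_sub_distrib, ← mul_sum, hgood] at hclass
  have hφ1 : S.q ^ S.Δ * S.p * (1 - S.ε / 2) ≤ φ := by
    rw [hφ]
    have : 1 - S.ε / 2 ≤ (1 - Real.exp (-S.ε)) / S.ε := by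
      rw [le_div_iff₀ hε]
      have := one_sub_exp_neg_ge hε.le
      linarith
    gcongr
  have hφ0 : 0 ≤ S.q ^ S.Δ * S.p * (1 - S.ε / 2) := by
    have : 0 ≤ 1 - S.ε / 2 := by linarith
    positivity
  have h1 : S.q ^ S.Δ * S.p * (1 - S.ε / 2) * (n * (1 - S.ε ^ 2 / 4))
      ≤ φ * ∑ r ∈ Ico u (u + m), (t.n r : ℝ) :=
    mul_le_mul hφ1 (by linarith) (mul_nonneg hn0.le (by linarith)) (hφ0.trans hφ1)
  have h2 : S.Δ * (S.lam / S.ε * B) ≤ S.q ^ S.Δ * S.p * n * (S.ε / 2 / (1 + 3 * S.ε)) :=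
    calc S.Δ * (S.lam / S.ε * B)
        = S.p / (2 * S.f * S.ε * (1 + 3 * S.ε))
          * (4 * (1 + 3 * S.ε) * S.Δ * S.γ ^ 2 * S.lam * M) := by
          rw [hB, Setup.β]; field_simp; ring
      _ ≤ S.p / (2 * S.f * S.ε * (1 + 3 * S.ε)) * (n * (S.ε ^ 2 * S.f * S.q ^ S.Δ)) := by gcongr
      _ = _ := by field_simp
  have h3 := one_sub_lt_of_le_eighth hε hε1
  have h5 : 0 < S.q ^ S.Δ * S.p * n := by positivity
  have h6 := mul_lt_mul_of_pos_left h3 h5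
  linarith

end Legal

/-! ### Typical executions -/

/-- The strict honest majority forces an honest query in every round. Union bounds over rounds
therefore cost no more than over queries. -/
theorem Trace.Legal.plans_length_le {t : Trace S} (hl : t.Legal N)
    (hn : ∀ r, honestCount t r = t.n r) : t.plans.length ≤ N := by
  refine le_trans ?_ hl.total
  have hsub : range t.plans.length ⊆ (range t.queries.length).image t.roundAt := by
    intro r hr
    have h1 := hl.n_pos (mem_range.1 hr)
    rw [← hn] at h1
    obtain ⟨e, he, hround⟩ := List.countP_pos_iff.1 h1
    obtain ⟨k, hk⟩ := List.mem_iff_getElem?.1 he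
    refine mem_image.2 ⟨k, mem_range.2 (List.getElem?_eq_some_iff.1 hk).1, ?_⟩
    simp only [decide_eq_true_eq] at hround
    simp [Trace.roundAt, Trace.request, hk, hround.1]
  simpa using (card_le_card hsub).trans card_image_le

/-- Bounds for sums over intervals of moderate length give the bounds of typical executions. -/
theorem honest_of_pieces {t : Trace S} {i : Fin (S.m + 1)} (hA : S.Admissible)
    (hupper : ∀ u w, u < w → w ≤ t.plans.length → ((w - u : ℕ) : ℝ) ≤ S.s →
      S.ell ≤ ((w - u : ℕ) : ℝ) → (∀ r ∈ Ico u w, t.Good r) →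
      ∑ r ∈ Ico u w, t.D i r < (1 + S.ε) * S.p * ∑ r ∈ Ico u w, (t.n r : ℝ))
    (hlower : ∀ u w, u < w → w ≤ t.plans.length → ((w - u : ℕ) : ℝ) ≤ S.s →
      S.ell ≤ ((w - u : ℕ) : ℝ) → (∀ r ∈ Ico u w, t.Good r) →
      (1 - S.ε) * S.q ^ S.Δ * S.p * ∑ r ∈ Ico u w, (t.n r : ℝ) < ∑ r ∈ Ico u w, t.Q i r)
    (u v : ℕ) (hv : v < t.plans.length) (hell : S.ell ≤ ((v - u + 1 : ℕ) : ℝ))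
    (huv : u ≤ v) (hg : ∀ r ∈ Icc u v, t.Good r) :
    (1 - S.ε) * S.q ^ S.Δ * S.p * ∑ r ∈ Icc u v, (t.n r : ℝ) < ∑ r ∈ Icc u v, t.Q i r ∧
      ∑ r ∈ Icc u v, t.Q i r ≤ ∑ r ∈ Icc u v, t.D i r ∧
      ∑ r ∈ Icc u v, t.D i r < (1 + S.ε) * S.p * ∑ r ∈ Icc u v, (t.n r : ℝ) := by
  have hell0 := hA.ell_pos
  have hL : 0 < ⌈S.ell⌉₊ := Nat.ceil_pos.2 hell0
  have hL1 : S.ell ≤ (⌈S.ell⌉₊ : ℝ) := Nat.le_ceil _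
  have hL2 : (⌈S.ell⌉₊ : ℝ) < S.ell + 1 := Nat.ceil_lt_add_one hell0.le
  have hlen : ⌈S.ell⌉₊ ≤ v - u + 1 := Nat.ceil_le.2 hell
  have hs := hA.two_ell_le_s
  have hIco : Icc u v = Ico u (v + 1) := by
    ext r
    rw [mem_Ico, mem_Icc, Nat.lt_succ_iff]
  have hpiece : ∀ u' v', u' + ⌈S.ell⌉₊ ≤ v' → v' < u' + 2 * ⌈S.ell⌉₊ →
      ((v' - u' : ℕ) : ℝ) ≤ S.s ∧ S.ell ≤ ((v' - u' : ℕ) : ℝ) := by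
    intro u' v' h1 h2
    have h3 : ((v' - u' : ℕ) : ℝ) ≤ 2 * (⌈S.ell⌉₊ : ℝ) := by
      exact_mod_cast (by omega : v' - u' ≤ 2 * ⌈S.ell⌉₊)
    have h4 : (⌈S.ell⌉₊ : ℝ) ≤ ((v' - u' : ℕ) : ℝ) := by
      exact_mod_cast (by omega : ⌈S.ell⌉₊ ≤ v' - u')
    exact ⟨by linarith, by linarith⟩
  have hgood : ∀ u' v', u ≤ u' → v' ≤ v + 1 → ∀ r ∈ Ico u' v', t.Good r := by
    intro u' v' h1 h2 r hr
    have := mem_Ico.1 hr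
    exact hg r (mem_Icc.2 (by omega))
  rw [hIco]
  refine ⟨?_, sum_le_sum fun r _ => Q_le_D t i r, ?_⟩
  · have h := sum_pos_of_pieces (F := fun r => t.Q i r - (1 - S.ε) * S.q ^ S.Δ * S.p * t.n r)
      (U := u) (V := v + 1) hL (fun u' v' h1 h2 h3 h4 => ?_) u (v + 1) le_rfl le_rfl (by omega)
    · rw [sum_sub_distrib, ← mul_sum] at h
      linarith
    · rw [sum_sub_distrib, ← mul_sum, sub_pos]
      exact hlower u' v' (by omega) (by omega) (hpiece u' v' h3 h4).1 (hpiece u' v' h3 h4).2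
        (hgood u' v' h1 h2)
  · have h := sum_pos_of_pieces (F := fun r => (1 + S.ε) * S.p * t.n r - t.D i r)
      (U := u) (V := v + 1) hL (fun u' v' h1 h2 h3 h4 => ?_) u (v + 1) le_rfl le_rfl (by omega)
    · rw [sum_sub_distrib, ← mul_sum] at h
      linarith
    · rw [sum_sub_distrib, ← mul_sum, sub_pos]
      exact hupper u' v' (by omega) (by omega) (hpiece u' v' h3 h4).1 (hpiece u' v' h3 h4).2
        (hgood u' v' h1 h2)

theorem prob_not_typical_le (Z : Strategy S coins) (R : ℕ) (ρ : coins) (hA : S.Admissible)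
    (hl : ∀ ω : Tape S N, (run Z R ρ ω).Legal N) (hlam : 1 ≤ S.lam) {c : ℝ} (hc : 0 < c)
    (hc2 : c ≤ 2) :
    prob {ω : Tape S N | ¬ (run Z R ρ ω).Typical c}
      ≤ (3 * S.m + 5) * (N : ℝ) ^ 2 * (Real.exp (-(c * S.lam / 2)) + 1 / 2 ^ S.κ) := by
  have hε := hA.ε_pos
  have hε1 : S.ε ≤ 1 := by linarith [hA.ε_le_one]
  have hlam0 := hA.lam_pos
  have hN : ∀ ω : Tape S N, (run Z R ρ ω).queries.length ≤ N := fun ω => (hl ω).total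
  have hE : Real.exp (-S.lam) ≤ Real.exp (-(c * S.lam / 2)) := Real.exp_le_exp.2 (by nlinarith)
  set E := Real.exp (-(c * S.lam / 2)) with hEdef
  have h1 := prob_not_noCollision_le (N := N) Z R ρ
  have h2 := prob_pivot_le Z R ρ hN hε hε1 (σ := S.τ) (by linarith [hA.τ_ge])
  have h3 := prob_pivot_le Z R ρ hN hε hε1 one_pos
  have h4 := prob_biUnion_le_mul univ _
    fun i _ => prob_nonPivot_le Z R ρ hN hε hε1 hlam0 i hc
  have h5 := prob_biUnion_le_mul univ _
    fun i _ => prob_honest_deviation_le (N := N) Z R ρ hε hlam0 i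
  have h6 := prob_biUnion_le_mul univ _
    fun i _ => prob_isolated_deviation_le Z R ρ i hA hl hε
  refine (prob_mono ?_).trans ((prob_union_le _ _).trans (add_le_add h1
    ((prob_union_le _ _).trans (add_le_add h2 ((prob_union_le _ _).trans (add_le_add h3
    ((prob_union_le _ _).trans (add_le_add h4 ((prob_union_le _ _).trans
      (add_le_add h5 h6)))))))))) |>.trans ?_
  · intro ω hω
    by_contra hcon
    simp only [Set.mem_union, Set.mem_ofPred_eq, not_or, not_exists, not_and, not_not, mem_univ,
      true_implies] at hcon
    obtain ⟨hnc, hp, hp', hnp, hD, hQ⟩ := hcon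
    have hcs := consistent_run Z R ρ ω
    have hn := honestCount_run Z R ρ ω
    refine hω ⟨fun i u v huv hv hell hg => ?_, hp, ?_, fun i a b _ => hnp i a b,
      fun h => hnc.not_prediction hcs (hN ω) h.prediction, hnc.not_copy hcs (hN ω),
      hnc.not_prediction hcs (hN ω)⟩
    · exact honest_of_pieces hA
        (fun u w huw hw hs hell hg => (hl ω).honest_upper hA hcs hnc hn (hD i) huw hw hs hell hg)
        (fun u w huw hw hs hell hg => (hl ω).honest_lower hA hlam hcs hnc
          ((hl ω).plans_length_le hn) (hQ i) huw hw hs hell hg) u v hv hell huv hg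
    · simpa only [div_one, one_mul] using hp'
  -- Two pivot events and three families of `m + 1` events give `3m + 5`; the `m + 3` of the
  -- collisions is smaller.
  · rw [card_univ, Fintype.card_fin]
    push_cast
    have hH : (0 : ℝ) ≤ 1 / 2 ^ S.κ := by positivity
    have hm : (0 : ℝ) ≤ S.m := by positivity
    have hN2 : (0 : ℝ) ≤ (N : ℝ) ^ 2 := by positivity
    have hexp := mul_le_mul_of_nonneg_left hE hN2
    have hexp' := mul_le_mul_of_nonneg_left hexp hm
    have hNH := mul_nonneg hN2 hH
    have hmNH := mul_nonneg hm hNH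
    linarith

theorem typical_of_no_queries {t : Trace S} (hl : t.Legal 0) {ω : Tape S 0} (hc : Consistent ω t)
    (hn : ∀ r, honestCount t r = t.n r) (c : ℝ) : t.Typical c := by
  have hlen := hl.plans_length_le hn
  have hadv : ∀ k, ¬ t.IsAdv k := fun k h => by
    have := h.lt
    have := hl.total
    omega
  have hnc : NoCollision ω t := fun k => k.elim0
  exact ⟨fun i u v _ hv => by omega, fun a b _ h => absurd h (hadv a),
    fun a b _ h => absurd h (hadv a), fun i a b _ _ h => absurd h (hadv a),
    fun h => hnc.not_prediction hc hl.total h.prediction, hnc.not_copy hc hl.total,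
    hnc.not_prediction hc hl.total⟩

/-- The bound for fixed coins, for all values of the security parameter. -/
theorem prob_not_typical_le' (Z : Strategy S coins) (R : ℕ) (ρ : coins) (hA : S.Admissible)
    (hl : ∀ ω : Tape S N, (run Z R ρ ω).Legal N) {c : ℝ} (hc : 0 < c) (hc2 : c ≤ 2) :
    prob {ω : Tape S N | ¬ (run Z R ρ ω).Typical c}
      ≤ (3 * S.m + 8) * (N : ℝ) ^ 2 * (Real.exp (-(c * S.lam / 2)) + 1 / 2 ^ S.κ) := by
  rcases Nat.eq_zero_or_pos N with rfl | hN
  · have : {ω : Tape S 0 | ¬ (run Z R ρ ω).Typical c} = ∅ := by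
      refine Set.eq_empty_of_forall_notMem fun ω hω => hω ?_
      exact typical_of_no_queries (hl ω) (consistent_run Z R ρ ω) (honestCount_run Z R ρ ω) c
    rw [this, prob_empty]
    positivity
  · have hH : (0 : ℝ) ≤ 1 / 2 ^ S.κ := by positivity
    have hm : (0 : ℝ) ≤ S.m := by positivity
    rcases le_or_gt 1 S.lam with hlam | hlam
    · refine (prob_not_typical_le Z R ρ hA hl hlam hc hc2).trans ?_
      gcongr
      norm_num
    · refine (prob_le_one _).trans ?_
      have hN1 : (1 : ℝ) ≤ (N : ℝ) ^ 2 := one_le_pow₀ (by exact_mod_cast hN)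
      have hlam0 := hA.lam_pos
      have h1 : Real.exp (-1) ≤ Real.exp (-(c * S.lam / 2)) := Real.exp_le_exp.2 (by nlinarith)
      -- For `λ < 1` the claimed bound exceeds `1`, because `e < 3`; the larger constant `3m + 8`
      -- leaves ample room.
      have h2 : (1 : ℝ) ≤ 3 * Real.exp (-1) := by
        rw [Real.exp_neg, ← div_eq_mul_inv, le_div_iff₀ (Real.exp_pos _)]
        linarith [Real.exp_one_lt_d9]
      calc (1 : ℝ) ≤ 3 * 1 * (Real.exp (-1) + 0) := by linarith
        _ ≤ (3 * S.m + 8) * (N : ℝ) ^ 2 * (Real.exp (-(c * S.lam / 2)) + 1 / 2 ^ S.κ) := by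
          gcongr
          linarith

end ParallelChain

open ParallelChain in
theorem mainTheorem7 (c : Constants) :
    ∃ K : ℝ, 0 < K ∧
      ∀ (S : Setup), S.toConstants = c → S.Admissible →
      ∀ (coins : Type) [Fintype coins] [Nonempty coins] (R N : ℕ) (Z : Strategy S coins),
        (∀ (ρ : coins) (ω : Tape S N), (run Z R ρ ω).Legal N) →
        prob {x : coins × Tape S N | ¬ (run Z R x.1 x.2).Typical 2}
            ≤ K * (N : ℝ) ^ 2 * (Real.exp (-S.lam) + 1 / 2 ^ S.κ) ∧
        prob {x : coins × Tape S N | ¬ (run Z R x.1 x.2).Typical 1}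
            ≤ K * (N : ℝ) ^ 2 * (Real.exp (-(S.lam / 2)) + 1 / 2 ^ S.κ) := by
  refine ⟨3 * c.m + 8, by positivity, ?_⟩
  rintro S rfl hA coins _ _ R N Z hl
  constructor
  · refine prob_prod_le fun ρ => ?_
    have h := prob_not_typical_le' Z R ρ hA (hl ρ) (c := 2) two_pos le_rfl
    rwa [mul_div_cancel_left₀ _ two_ne_zero] at h
  · refine prob_prod_le fun ρ => ?_
    have h := prob_not_typical_le' Z R ρ hA (hl ρ) (c := 1) one_pos one_le_two
    rwa [one_mul] at h
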